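/- A graph is chordal if it has no induced cycle of length at least four. For $d\in\mathbb{N}$, a graph is $d$-orientable if its edges can be oriented so that every vertex has in-degree at most $d$. In $d$-Orientable Deletion one is given a finite graph $G=(V,E)$ and an integer $d\ge 0$, and is asked for a smallest set $K\subseteq V$ such that $G[V\setminus K]$ is $d$-orientable; in the decision version one is also given $k\in\mathbb{N}$ and is asked whether such a set $K$ with $|K|\le k$ exists. **Theorem.** On chordal graphs, $d$-Orientable Deletion can be solved in time $d^{O(d+k)}\,n^{O(1)}$, where $n=|V|$, $d$ is part of the input and $k$ is the size of the solution. That is, there are an absolute constant $c$ and a single random access machine algorithm (unit cost, with addition, truncated subtraction and comparison, but without multiplication) that, for every chordal graph $G$ with $n$ vertices, given by its adjacency matrix, and every $d$, outputs a smallest deletion set $K$ in time at most $c\cdot\max(d,2)^{c(d+k)}(n+1)^c$ with $k=|K|$. Likewise, there is an algorithm that, given a chordal graph $G$ with $n$ vertices, $d$ and $k$, decides in time at most $c\cdot\max(d,2)^{c(d+k)}(n+1)^c$, for some absolute constant $c$, whether $G$ has a deletion set of size at most $k$. Hence the problem is fixed-parameter tractable on chordal graphs when parameterized by $d+k$: a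 single algorithm decides it in time $f(d+k)\cdot (n+1)^{c}$ for some computable function $f$ and constant $c$. -/

import Mathlib

namespace OrientableDeletion

/-! ### Graphs and orientations -/

/-- A graph is chordal if it has no induced cycle of length at least four. -/
def IsChordal {V : Type*} (G : SimpleGraph V) : Prop :=
  ∀ m : ℕ, 4 ≤ m → ¬ (SimpleGraph.cycleGraph m).IsIndContained G

/-- `D` is an orientation of `G`: it is obtained from `G` by replacing each edge `{u, v}` with
exactly one of the arcs `(u, v)`, `(v, u)`. -/
def IsOrientation {V : Type*} (G : SimpleGraph V) (D : Digraph V) : Prop :=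
  (∀ u v : V, G.Adj u v ↔ (D.Adj u v ∨ D.Adj v u)) ∧
    ∀ u v : V, ¬ (D.Adj u v ∧ D.Adj v u)

/-- The in-degree of `v`: the number of arcs with head `v`. -/
noncomputable def inDegree {V : Type*} (D : Digraph V) (v : V) : ℕ∞ :=
  {u : V | D.Adj u v}.encard

/-- `G` is `d`-orientable: it has an orientation with all in-degrees at most `d`. -/
def IsOrientable {V : Type*} (G : SimpleGraph V) (d : ℕ) : Prop :=
  ∃ D : Digraph V, IsOrientation G D ∧ ∀ v : V, inDegree D v ≤ (d : ℕ∞)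

/-- `K` is a deletion set: `G[V ∖ K]` is `d`-orientable. -/
def IsDeletionSet {V : Type*} (G : SimpleGraph V) (d : ℕ) (K : Finset V) : Prop :=
  IsOrientable (G.induce {v : V | v ∉ K}) d

/-- `K` is a deletion set of smallest cardinality. -/
def IsMinDeletionSet {V : Type*} (G : SimpleGraph V) (d : ℕ) (K : Finset V) : Prop :=
  IsDeletionSet G d K ∧ ∀ K' : Finset V, IsDeletionSet G d K' → K.card ≤ K'.card

/-! ### The machine model

A random access machine, programmed in structured form.  It has registers `0, 1, 2, …` and
arrays `0, 1, 2, …` with cells `0, 1, 2, …`, all holding natural numbers; the index of the array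
cell that is read or written may be computed at run time.  The only arithmetic operations are
addition, truncated subtraction and comparison (no multiplication), so that charging one unit of
time per operation is polynomially equivalent to counting the steps of a Turing machine. -/

/-- Expressions: constants, registers, array cells, sum, truncated difference, comparison. -/
inductive Expr : Type
  | lit (m : ℕ)
  | reg (x : ℕ)
  | cell (a : ℕ) (i : Expr)
  | plus (e f : Expr)
  | minus (e f : Expr)
  | less (e f : Expr)

/-- Programs. -/
inductive Prog : Type
  | skip
  | setReg (x : ℕ) (e : Expr)
  | setCell (a : ℕ) (i e : Expr)
  | seq (p q : Prog)
  | ite (e : Expr) (p q : Prog)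
  | loop (e : Expr) (p : Prog)

/-- The contents `reg x` of register `x` and `arr a i` of cell `i` of array `a`. -/
structure State : Type where
  reg : ℕ → ℕ
  arr : ℕ → ℕ → ℕ

/-- The value of an expression. A comparison gives `1` if it holds and `0` if not. -/
def Expr.eval (s : State) : Expr → ℕ
  | .lit m => m
  | .reg x => s.reg x
  | .cell a i => s.arr a (i.eval s)
  | .plus e f => e.eval s + f.eval s
  | .minus e f => e.eval s - f.eval s
  | .less e f => if e.eval s < f.eval s then 1 else 0

/-- The time needed to evaluate an expression: one unit for each constant, each register or
memory access and each operation. -/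
def Expr.cost : Expr → ℕ
  | .lit _ => 1
  | .reg _ => 1
  | .cell _ i => i.cost + 1
  | .plus e f => e.cost + f.cost + 1
  | .minus e f => e.cost + f.cost + 1
  | .less e f => e.cost + f.cost + 1

/-- The state after writing `m` to register `x`. -/
def State.writeReg (s : State) (x m : ℕ) : State where
  reg := Function.update s.reg x m
  arr := s.arr

/-- The state after writing `m` to cell `i` of array `a`. -/
def State.writeCell (s : State) (a i m : ℕ) : State where
  reg := s.reg
  arr := Function.update s.arr a (Function.update (s.arr a) i m)

/-- `Runs p s t s'`: started in state `s`, the program `p` halts after exactly `t` units of time,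
in state `s'`. Conditions count as true if they are nonzero; `loop e p` is "while `e` do `p`". -/
inductive Runs : Prog → State → ℕ → State → Prop
  | skip (s : State) : Runs .skip s 1 s
  | setReg (s : State) (x : ℕ) (e : Expr) :
      Runs (.setReg x e) s (e.cost + 1) (s.writeReg x (e.eval s))
  | setCell (s : State) (a : ℕ) (i e : Expr) :
      Runs (.setCell a i e) s (i.cost + e.cost + 1) (s.writeCell a (i.eval s) (e.eval s))
  | seq {p q : Prog} {s s' s'' : State} {t t' : ℕ} :
      Runs p s t s' → Runs q s' t' s'' → Runs (.seq p q) s (t + t') s''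
  | ite_true {e : Expr} {p q : Prog} {s s' : State} {t : ℕ} :
      e.eval s ≠ 0 → Runs p s t s' → Runs (.ite e p q) s (e.cost + t + 1) s'
  | ite_false {e : Expr} {p q : Prog} {s s' : State} {t : ℕ} :
      e.eval s = 0 → Runs q s t s' → Runs (.ite e p q) s (e.cost + t + 1) s'
  | loop_true {e : Expr} {p : Prog} {s s' s'' : State} {t t' : ℕ} :
      e.eval s ≠ 0 → Runs p s t s' → Runs (.loop e p) s' t' s'' →
        Runs (.loop e p) s (e.cost + t + t' + 1) s''
  | loop_false {e : Expr} {p : Prog} {s : State} :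
      e.eval s = 0 → Runs (.loop e p) s (e.cost + 1) s

/-! ### The computational problem -/

open Classical in
/-- The initial state for the input `(G, d, k)`, where `G` is a graph with vertices `0, …, n - 1`:
registers `0, 1, 2` hold `n`, `d`, `k`, array `0` holds the adjacency matrix of `G` in row-major
order, and everything else is `0`. -/
noncomputable def inputState {n : ℕ} (G : SimpleGraph (Fin n)) (d k : ℕ) : State where
  reg := fun x => if x = 0 then n else if x = 1 then d else if x = 2 then k else 0
  arr := fun a i =>
    if a = 0 ∧ ∃ u v : Fin n, G.Adj u v ∧ i = (u : ℕ) * n + (v : ℕ) then 1 else 0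

/-- The program `P` decides in time `T n d k`, for chordal graphs `G` on `n` vertices and numbers
`d`, `k`, whether `G` has a deletion set of at most `k` vertices; the answer, `1` for yes and `0`
for no, is left in register `0`. -/
def DecidesOnChordal (P : Prog) (T : ℕ → ℕ → ℕ → ℕ) : Prop :=
  ∀ (n : ℕ) (G : SimpleGraph (Fin n)), IsChordal G → ∀ d k : ℕ,
    ∃ (t : ℕ) (s : State), Runs P (inputState G d k) t s ∧ t ≤ T n d k ∧
      ((∃ K : Finset (Fin n), IsDeletionSet G d K ∧ K.card ≤ k) → s.reg 0 = 1) ∧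
      ((¬ ∃ K : Finset (Fin n), IsDeletionSet G d K ∧ K.card ≤ k) → s.reg 0 = 0)

/-- The program `P` finds, for a chordal graph `G` on `n` vertices and a number `d` (register `2`
initially holds `0`), a smallest deletion set `K`, in time `T n d k` where `k` is the size of `K`.
The characteristic vector of `K` is left in array `1`, and `k` in register `0`. -/
def SolvesOnChordal (P : Prog) (T : ℕ → ℕ → ℕ → ℕ) : Prop :=
  ∀ (n : ℕ) (G : SimpleGraph (Fin n)), IsChordal G → ∀ d : ℕ,
    ∃ (t : ℕ) (s : State) (K : Finset (Fin n)), Runs P (inputState G d 0) t s ∧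
      IsMinDeletionSet G d K ∧ t ≤ T n d K.card ∧
      s.reg 0 = K.card ∧ ∀ v : Fin n, s.arr 1 (v : ℕ) = if v ∈ K then 1 else 0

/-- `d^{O(d+k)} n^{O(1)}` with implied constant `c`. As usual, the base of the exponential and the
size of the input are not allowed to degenerate for `d ≤ 1` and `n ≤ 1`. -/
def timeBound (c n d k : ℕ) : ℕ :=
  c * (max d 2) ^ (c * (d + k)) * (n + 1) ^ c

/-- The decision problem on chordal graphs is fixed-parameter tractable in `d + k`: one algorithm
solves it in time `f (d + k) * n^{O(1)}` for some computable `f`. -/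
def IsFPTOnChordal : Prop :=
  ∃ (P : Prog) (f : ℕ → ℕ) (c : ℕ), Computable f ∧
    DecidesOnChordal P (fun n d k => f (d + k) * (n + 1) ^ c)

end OrientableDeletion

/-!
Orient all edges of `G` arbitrarily. The vertices of in-degree more than `d` form a deletion set
(`isDeletionSet_of_mem_degSet`), and conversely, if `K` is a deletion set, then directing all edges
that meet `K` towards `K` extends an orientation of `G[V ∖ K]` to one of `G` in which all in-degrees
more than `d` occur in `K` (`exists_mem_degSet_of_isDeletionSet`). So a smallest deletion set is
found by minimizing, over all orientations of `G`, the number of vertices of in-degree more than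
`d`. For this it suffices to know the in-degrees up to the cap `d + 1`.

A chordal graph has a perfect elimination order (Dirac's theorem,
`IsChordal.exists_simplicial_not_adj`), found by repeatedly removing a simplicial vertex. The bag of
a vertex, which consists of the vertex and its later neighbours, is a clique. Since a clique that is
`d`-orientable has at most `2 d + 1` vertices, a bag has at most `2 d + 1 + k` vertices if there is a
deletion set of size `k` (`card_clique_le`). Greedy colouring in the reverse order uses no more
colours than the largest bag has vertices, and it is injective on each bag, so that the capped
in-degrees on a bag can be stored as the digits of a number in base `2 d + 3`, the colours being the
places (`code`). There are `(2 d + 3) ^ q` such codes for `q` colours; with `q ≤ 2 d + 1 + k` this is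
`d ^ O(d + k)`. The base is large enough for two codes to be added without carries.

The dynamic program eliminates the vertices in order (`Elim.Inv`). For each bag it keeps a table
that gives, for each code, the least weight of the vertices of in-degree more than `d` among those
eliminated below the bag. To eliminate `v`, the edges from `v` to its later neighbours are added one
at a time, `v` is removed from the bag, its weight being charged if its digit exceeds `d`, and the
table is joined to that of the first later neighbour of `v`, whose bag contains the rest of the bag
of `v` (`Elim.Inv.step`). Vertex `v` has weight `2 ^ n + 2 ^ v`; a set of least weight has least
cardinality, and its weight determines it (`isMinDeletionSet_of_weight`, `decode_spec`), so no
back-pointers are needed.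

The running time is read off the program text: `Prog.time B` bounds it if all loops have at most `B`
rounds, `Ensures` combines this bound with a postcondition, and for a fixed program `Prog.time B` is
polynomial in `B` (`Prog.exists_time_le`). Here all loops have at most `n + 1`, `2 d + 3` or
`2 (2 d + 3) ^ q` rounds. The optimization algorithm needs no bound for `k`, as the smallest
deletion set bounds `q`; the decision algorithm answers no at once if `q > 2 d + 1 + k`.
-/

namespace OrientableDeletion

/-! ### Reasoning about programs -/

/-- A bound for the running time of `p` that can be read off the program, provided that every
execution of every loop in `p` has at most `B` rounds. -/
def Prog.time (B : ℕ) : Prog → ℕ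
  | .skip => 1
  | .setReg _ e => e.cost + 1
  | .setCell _ i e => i.cost + e.cost + 1
  | .seq p q => p.time B + q.time B
  | .ite e p q => e.cost + p.time B + q.time B + 1
  | .loop e p => B * (e.cost + p.time B + 1) + (e.cost + 1)

/-- Whether register `x` is written somewhere in the program. -/
def Prog.writesReg : Prog → ℕ → Bool
  | .skip, _ => false
  | .setReg y _, x => x == y
  | .setCell _ _ _, _ => false
  | .seq p q, x => p.writesReg x || q.writesReg x
  | .ite _ p q, x => p.writesReg x || q.writesReg x
  | .loop _ p, x => p.writesReg x

/-- Whether array `a` is written somewhere in the program. -/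
def Prog.writesArr : Prog → ℕ → Bool
  | .skip, _ => false
  | .setReg _ _, _ => false
  | .setCell b _ _, a => a == b
  | .seq p q, a => p.writesArr a || q.writesArr a
  | .ite _ p q, a => p.writesArr a || q.writesArr a
  | .loop _ p, a => p.writesArr a

/-- `s` and `s'` agree on the registers and arrays that `p` does not write. -/
structure Frame (p : Prog) (s s' : State) : Prop where
  reg : ∀ x, p.writesReg x = false → s'.reg x = s.reg x
  arr : ∀ a, p.writesArr a = false → s'.arr a = s.arr a

theorem Frame.refl (p : Prog) (s : State) : Frame p s s := ⟨fun _ _ => rfl, fun _ _ => rfl⟩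

theorem Frame.trans {p : Prog} {s s' s'' : State} (h : Frame p s s') (h' : Frame p s' s'') :
    Frame p s s'' :=
  ⟨fun x hx => (h'.reg x hx).trans (h.reg x hx), fun a ha => (h'.arr a ha).trans (h.arr a ha)⟩

theorem Frame.mono {p q : Prog} {s s' : State} (h : Frame p s s')
    (hr : ∀ x, q.writesReg x = false → p.writesReg x = false)
    (ha : ∀ a, q.writesArr a = false → p.writesArr a = false) : Frame q s s' :=
  ⟨fun x hx => h.reg x (hr x hx), fun a hx => h.arr a (ha a hx)⟩

@[simp] theorem writeReg_reg (s : State) (x m y : ℕ) :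
    (s.writeReg x m).reg y = if y = x then m else s.reg y := by
  simp [State.writeReg, Function.update_apply]

@[simp] theorem writeReg_arr (s : State) (x m : ℕ) : (s.writeReg x m).arr = s.arr := rfl

@[simp] theorem writeCell_reg (s : State) (a i m : ℕ) : (s.writeCell a i m).reg = s.reg := rfl

theorem writeCell_arr (s : State) (a i m b : ℕ) :
    (s.writeCell a i m).arr b = if b = a then Function.update (s.arr a) i m else s.arr b := by
  simp only [State.writeCell, Function.update_apply]

theorem Runs.frame {p : Prog} {s s' : State} {t : ℕ} (h : Runs p s t s') : Frame p s s' := by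
  induction h with
  | skip s => exact Frame.refl _ _
  | setReg s x e =>
    refine ⟨fun y hy => ?_, fun _ _ => rfl⟩
    simp only [Prog.writesReg, beq_eq_false_iff_ne] at hy
    simp [hy]
  | setCell s a i e =>
    refine ⟨fun _ _ => rfl, fun b hb => ?_⟩
    simp only [Prog.writesArr, beq_eq_false_iff_ne] at hb
    simp [writeCell_arr, hb]
  | seq _ _ ih₁ ih₂ =>
    refine (ih₁.mono ?_ ?_).trans (ih₂.mono ?_ ?_) <;>
      simp +contextual [Prog.writesReg, Prog.writesArr]
  | ite_true _ _ ih => refine ih.mono ?_ ?_ <;> simp +contextual [Prog.writesReg, Prog.writesArr]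
  | ite_false _ _ ih => refine ih.mono ?_ ?_ <;> simp +contextual [Prog.writesReg, Prog.writesArr]
  | loop_true _ _ _ ih₁ ih₂ =>
    exact Frame.trans (p := .loop _ _) (ih₁.mono (fun _ h => h) fun _ h => h) ih₂
  | loop_false _ => exact Frame.refl _ _

/-- Started in state `s`, the program `p` halts in a state satisfying `Q`, within the time that
`Prog.time` predicts when every loop has at most `B` rounds. -/
def Ensures (B : ℕ) (p : Prog) (s : State) (Q : State → Prop) : Prop :=
  ∃ t s', Runs p s t s' ∧ t ≤ p.time B ∧ Q s'

namespace Ensures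

variable {B : ℕ} {p q : Prog} {s : State} {Q R : State → Prop}

/-- The rule of consequence; the frame condition comes for free. -/
theorem mono (h : Ensures B p s Q) (hQ : ∀ s', Frame p s s' → Q s' → R s') : Ensures B p s R := by
  obtain ⟨t, s', hr, ht, hq⟩ := h
  exact ⟨t, s', hr, ht, hQ s' hr.frame hq⟩

theorem skip (h : Q s) : Ensures B .skip s Q := ⟨1, s, .skip s, le_rfl, h⟩

theorem setReg {x : ℕ} {e : Expr} (h : Q (s.writeReg x (e.eval s))) :
    Ensures B (.setReg x e) s Q := ⟨_, _, .setReg s x e, le_rfl, h⟩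

theorem setCell {a : ℕ} {i e : Expr} (h : Q (s.writeCell a (i.eval s) (e.eval s))) :
    Ensures B (.setCell a i e) s Q := ⟨_, _, .setCell s a i e, le_rfl, h⟩

theorem seq (h : Ensures B p s fun s' => Ensures B q s' Q) : Ensures B (.seq p q) s Q := by
  obtain ⟨t, s', hr, ht, t', s'', hr', ht', hq⟩ := h
  exact ⟨_, _, .seq hr hr', add_le_add ht ht', hq⟩

theorem ite {e : Expr} (h₁ : e.eval s ≠ 0 → Ensures B p s Q) (h₂ : e.eval s = 0 → Ensures B q s Q) :
    Ensures B (.ite e p q) s Q := by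
  by_cases h : e.eval s = 0
  · obtain ⟨t, s', hr, ht, hq⟩ := h₂ h
    exact ⟨_, _, .ite_false h hr, by simp only [Prog.time]; omega, hq⟩
  · obtain ⟨t, s', hr, ht, hq⟩ := h₁ h
    exact ⟨_, _, .ite_true h hr, by simp only [Prog.time]; omega, hq⟩

end Ensures

/-- `for x := 0, …, (reg r) - 1 do p` -/
def Prog.forUp (x r : ℕ) (p : Prog) : Prog :=
  .seq (.setReg x (.lit 0))
    (.loop (.less (.reg x) (.reg r)) (.seq p (.setReg x (.plus (.reg x) (.lit 1)))))

/-- The rule for counting loops: `I i` is the invariant after `i` rounds. -/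
theorem Ensures.forUp {B M x r : ℕ} {p : Prog} {s : State} {Q : State → Prop}
    (I : ℕ → State → Prop) (hM : s.reg r = M) (hB : M ≤ B)
    (hx : p.writesReg x = false) (hr : (Prog.forUp x r p).writesReg r = false)
    (h0 : I 0 (s.writeReg x 0))
    (hstep : ∀ i s', i < M → Frame (Prog.forUp x r p) s s' → s'.reg x = i → I i s' →
      Ensures B p s' fun s'' => I (i + 1) (s''.writeReg x (i + 1)))
    (hQ : ∀ s', Frame (Prog.forUp x r p) s s' → I M s' → Q s') :
    Ensures B (Prog.forUp x r p) s Q := by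
  set P := Prog.forUp x r p with hP
  have key : ∀ j i s', i + j = M → Frame P s s' → s'.reg x = i → I i s' →
      ∃ t s'', Runs (.loop (.less (.reg x) (.reg r))
          (.seq p (.setReg x (.plus (.reg x) (.lit 1))))) s' t s'' ∧
        t ≤ j * (3 + (p.time B + 4) + 1) + 4 ∧ Frame P s s'' ∧ I M s'' := by
    intro j
    induction j with
    | zero =>
      intro i s' hi hF hx' hI
      refine ⟨_, s', .loop_false ?_, ?_, hF, ?_⟩
      · simp only [Expr.eval, hx', hF.reg r hr, hM]
        simp; omega
      · simp [Expr.cost]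
      · have : i = M := by omega
        exact this ▸ hI
    | succ j ih =>
      intro i s' hi hF hx' hI
      obtain ⟨t, s₁, hrun, ht, hI₁⟩ := hstep i s' (by omega) hF hx' hI
      have hF₁ : Frame P s s₁ := by
        refine hF.trans (hrun.frame.mono ?_ ?_) <;>
          simp +contextual [hP, Prog.forUp, Prog.writesReg, Prog.writesArr]
      have hx₁ : s₁.reg x = i := (hrun.frame.reg x hx).trans hx'
      have hF₂ : Frame P s (s₁.writeReg x (i + 1)) := by
        refine hF₁.trans ⟨fun y hy => ?_, fun _ _ => rfl⟩
        have : y ≠ x := by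
          rintro rfl; simp [hP, Prog.forUp, Prog.writesReg] at hy
        simp [this]
      obtain ⟨t', s₂, hrun', ht', hF', hI'⟩ := ih (i + 1) _ (by omega) hF₂ (by simp) hI₁
      have hset := Runs.setReg s₁ x (.plus (.reg x) (.lit 1))
      simp only [Expr.eval, hx₁] at hset
      refine ⟨_, s₂, .loop_true ?_ (.seq hrun hset) hrun', ?_, hF', hI'⟩
      · simp only [Expr.eval, hx', hF.reg r hr, hM]
        simp; omega
      · simp only [Expr.cost]
        rw [Nat.succ_mul]; omega
  have hF₀ : Frame P s (s.writeReg x 0) := by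
    refine ⟨fun y hy => ?_, fun _ _ => rfl⟩
    have : y ≠ x := by rintro rfl; simp [hP, Prog.forUp, Prog.writesReg] at hy
    simp [this]
  obtain ⟨t, s', hrun, ht, hF, hI⟩ := key M 0 _ (by omega) hF₀ (by simp) h0
  have hset := Runs.setReg s x (.lit 0)
  refine ⟨_, s', .seq hset hrun, ?_, hQ s' hF hI⟩
  simp only [hP, Prog.forUp, Prog.time, Expr.cost]
  have : M * (3 + (p.time B + 4) + 1) ≤ B * (3 + (p.time B + 4) + 1) :=
    Nat.mul_le_mul_right _ hB
  have e : B * (1 + 1 + 1 + (p.time B + (1 + 1 + 1 + 1)) + 1) = B * (3 + (p.time B + 4) + 1) := by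
    norm_num
  omega

/-- For a fixed program, the time bound is polynomial in the bound for the number of rounds. -/
theorem Prog.exists_time_le (p : Prog) :
    ∃ C e : ℕ, ∀ B : ℕ, 1 ≤ B → p.time B ≤ C * B ^ e := by
  have hconst : ∀ {m C e B : ℕ}, 1 ≤ B → m ≤ C → m ≤ C * B ^ e := fun hB h =>
    h.trans (Nat.le_mul_of_pos_right _ (Nat.pow_pos hB))
  have hmono : ∀ {m C e e' B : ℕ}, 1 ≤ B → e ≤ e' → m ≤ C * B ^ e → m ≤ C * B ^ e' :=
    fun hB he h => h.trans (Nat.mul_le_mul_left _ (Nat.pow_le_pow_right hB he))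
  induction p with
  | skip => exact ⟨1, 0, fun B _ => by simp [Prog.time]⟩
  | setReg x e => exact ⟨e.cost + 1, 0, fun B _ => by simp [Prog.time]⟩
  | setCell a i e => exact ⟨i.cost + e.cost + 1, 0, fun B _ => by simp [Prog.time]⟩
  | seq p q ihp ihq =>
    obtain ⟨C₁, e₁, h₁⟩ := ihp
    obtain ⟨C₂, e₂, h₂⟩ := ihq
    refine ⟨C₁ + C₂, e₁ + e₂, fun B hB => ?_⟩
    have := hmono hB (Nat.le_add_right e₁ e₂) (h₁ B hB)
    have := hmono hB (Nat.le_add_left e₂ e₁) (h₂ B hB)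
    simp only [Prog.time, add_mul]
    omega
  | ite e p q ihp ihq =>
    obtain ⟨C₁, e₁, h₁⟩ := ihp
    obtain ⟨C₂, e₂, h₂⟩ := ihq
    refine ⟨C₁ + C₂ + (e.cost + 1), e₁ + e₂, fun B hB => ?_⟩
    have := hmono hB (Nat.le_add_right e₁ e₂) (h₁ B hB)
    have := hmono hB (Nat.le_add_left e₂ e₁) (h₂ B hB)
    have := hconst (m := e.cost + 1) (e := e₁ + e₂) hB le_rfl
    simp only [Prog.time, add_mul] at *
    omega
  | loop e p ih =>
    obtain ⟨C₁, e₁, h₁⟩ := ih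
    refine ⟨C₁ + (e.cost + 1) + (e.cost + 1), e₁ + 1, fun B hB => ?_⟩
    have h₂ := hconst (m := e.cost + 1) (e := e₁) hB le_rfl
    have h₃ := hconst (m := e.cost + 1) (e := e₁ + 1) hB le_rfl
    have h₄ : B * (e.cost + p.time B + 1) ≤ B * (C₁ * B ^ e₁ + (e.cost + 1) * B ^ e₁) :=
      Nat.mul_le_mul_left _ (by have := h₁ B hB; omega)
    have h₅ : B * (C₁ * B ^ e₁ + (e.cost + 1) * B ^ e₁) =
        C₁ * B ^ (e₁ + 1) + (e.cost + 1) * B ^ (e₁ + 1) := by ring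
    simp only [Prog.time]
    rw [add_mul, add_mul]
    omega

/-! ### Chordal graphs have perfect elimination orders -/

theorem cycleGraph_adj_iff_val {m : ℕ} (hm : 3 ≤ m) (u v : Fin m) :
    (SimpleGraph.cycleGraph m).Adj u v ↔ (u : ℕ) + 1 = v ∨ (v : ℕ) + 1 = u ∨
      ((u : ℕ) = 0 ∧ (v : ℕ) + 1 = m) ∨ ((v : ℕ) = 0 ∧ (u : ℕ) + 1 = m) := by
  have key : ∀ a b : Fin m, (a - b).val = if (b : ℕ) ≤ a then (a : ℕ) - b else m - b + a := by
    intro a b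
    rw [Fin.val_sub]
    have := a.2; have := b.2
    split_ifs with h
    · rw [show m - (b : ℕ) + a = m + (a - b) by omega, Nat.add_mod_left,
        Nat.mod_eq_of_lt (by omega)]
    · exact Nat.mod_eq_of_lt (by omega)
  rw [SimpleGraph.cycleGraph_adj', key, key]
  have := u.2; have := v.2
  split_ifs <;> omega

/-- Two nonadjacent neighbours `s`, `t` of `x` cannot be joined by a walk in `G` that avoids the
closed neighbourhood of `x`, because a shortest such walk would close up to an induced cycle. Here
`H` is the part of `G` in which the walk may run. -/
theorem IsChordal.adj_of_reachable {V : Type*} {G H : SimpleGraph V} (hG : IsChordal G)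
    {x s t : V} (hs : G.Adj x s) (ht : G.Adj x t) (hst : s ≠ t)
    (hHG : H ≤ G) (hind : ∀ a b c e, H.Adj a c → H.Adj b e → G.Adj a b → H.Adj a b)
    (havoid : ∀ a c, H.Adj a c → a ≠ s → a ≠ t → a ≠ x ∧ ¬ G.Adj x a)
    (hreach : H.Reachable s t) : G.Adj s t := by
  by_contra hna
  obtain ⟨p, hp⟩ := hreach.exists_walk_length_eq_dist
  set r := p.length with hr
  have hr2 : 2 ≤ r := by
    rw [hp]
    exact hreach.one_lt_dist_of_ne_of_not_adj hst fun h => hna (hHG h)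
  have hstep : ∀ i < r, H.Adj (p.getVert i) (p.getVert (i + 1)) := fun i hi =>
    p.adj_getVert_succ hi
  have hdist : ∀ i ≤ r, H.dist s (p.getVert i) = i := by
    intro i hi
    have h1 : H.dist s (p.getVert i) ≤ (p.take i).length := SimpleGraph.dist_le _
    have h2 : H.dist (p.getVert i) t ≤ (p.drop i).length := SimpleGraph.dist_le _
    have h3 : H.dist s t ≤ H.dist s (p.getVert i) + H.dist (p.getVert i) t :=
      SimpleGraph.Reachable.dist_triangle_left ⟨p.take i⟩ _
    simp only [SimpleGraph.Walk.take_length, SimpleGraph.Walk.drop_length] at h1 h2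
    rw [← hr] at h1 h2
    omega
  have hnb : ∀ i ≤ r, ∃ c, H.Adj (p.getVert i) c := by
    intro i hi
    rcases Nat.lt_or_ge i r with h | h
    · exact ⟨_, hstep i h⟩
    · obtain rfl : i = r := by omega
      obtain ⟨j, hj⟩ : ∃ j, r = j + 1 := ⟨r - 1, by omega⟩
      have := hstep j (by omega)
      rw [← hj] at this
      exact ⟨_, this.symm⟩
  have h0 : p.getVert 0 = s := p.getVert_zero
  have hrt : p.getVert r = t := p.getVert_length
  have hclose : ∀ i ≤ r, ∀ j ≤ r, G.Adj (p.getVert i) (p.getVert j) → i ≤ j + 1 := by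
    intro i hi j hj hadj
    obtain ⟨c, hc⟩ := hnb i hi
    obtain ⟨e, he⟩ := hnb j hj
    have hH := hind _ _ _ _ hc he hadj
    have h := SimpleGraph.Reachable.dist_triangle_left (G := H) (u := s) (v := p.getVert j)
      ⟨p.take j⟩ (p.getVert i)
    rw [hdist i hi, hdist j hj, SimpleGraph.dist_eq_one_iff_adj.2 hH.symm] at h
    exact h
  have hinner : ∀ i, 0 < i → i < r → p.getVert i ≠ x ∧ ¬ G.Adj x (p.getVert i) := by
    intro i h1 h2
    obtain ⟨c, hc⟩ := hnb i h2.le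
    refine havoid _ c hc ?_ ?_
    · intro h
      have := hdist i h2.le
      rw [h, SimpleGraph.dist_self] at this
      omega
    · intro h
      have := hdist i h2.le
      rw [h, ← hp] at this
      omega
  have hne : ∀ i ≤ r, p.getVert i ≠ x := by
    intro i hi
    rcases Nat.eq_zero_or_pos i with rfl | h
    · rw [h0]; exact hs.ne'
    · rcases Nat.lt_or_ge i r with h' | h'
      · exact (hinner i h h').1
      · obtain rfl : i = r := by omega
        rw [hrt]; exact ht.ne'
  have hxadj : ∀ i ≤ r, G.Adj x (p.getVert i) ↔ i = 0 ∨ i = r := by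
    intro i hi
    constructor
    · intro h
      by_contra hcon
      exact (hinner i (by omega) (by omega)).2 h
    · rintro (rfl | rfl)
      · rw [h0]; exact hs
      · rw [hrt]; exact ht
  set f : Fin (r + 2) → V := fun i => if (i : ℕ) ≤ r then p.getVert i else x with hf
  have hinj : Function.Injective f := by
    intro i j hij
    have := i.2; have := j.2
    simp only [hf] at hij
    apply Fin.ext
    split_ifs at hij with hi hj hj
    · rw [← hdist _ hi, ← hdist _ hj, hij]
    · exact absurd hij (hne _ hi)
    · exact absurd hij.symm (hne _ hj)
    · omega
  have hadj : ∀ i j, G.Adj (f i) (f j) ↔ (SimpleGraph.cycleGraph (r + 2)).Adj i j := by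
    intro i j
    have := i.2; have := j.2
    rw [cycleGraph_adj_iff_val (by omega)]
    simp only [hf]
    split_ifs with hi hj hj
    · constructor
      · intro h
        have h1 := hclose _ hi _ hj h
        have h2 := hclose _ hj _ hi h.symm
        have h3 : (i : ℕ) ≠ j := fun h' => by rw [h'] at h; exact G.irrefl h
        omega
      · rintro (h | h | h | h)
        · rw [← h]; exact hHG (hstep _ (by omega))
        · rw [← h]; exact (hHG (hstep _ (by omega))).symm
        · omega
        · omega
    · rw [G.adj_comm, hxadj _ hi]; omega
    · rw [hxadj _ hj]; omega
    · simp only [G.irrefl, false_iff]; omega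
  exact hG (r + 2) (by omega) ⟨⟨⟨f, hinj⟩, hadj _ _⟩⟩

/-- Dirac's theorem, in the form in which it is proved by induction: inside any finite set `W` of
vertices of a chordal graph, a vertex `x` that is not adjacent to all others has a non-neighbour
that is simplicial in `W`. -/
theorem IsChordal.exists_simplicial_not_adj {V : Type*} {G : SimpleGraph V} (hG : IsChordal G) :
    ∀ (W : Finset V) (x : V), x ∈ W → (∃ y ∈ W, y ≠ x ∧ ¬ G.Adj x y) →
      ∃ v ∈ W, v ≠ x ∧ ¬ G.Adj x v ∧
        ∀ a ∈ W, ∀ b ∈ W, G.Adj v a → G.Adj v b → a ≠ b → G.Adj a b := by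
  classical
  intro W
  induction W using Finset.strongInduction with
  | H W ih =>
    rintro x hxW ⟨y, hyW, hyx, hxy⟩
    -- `C` is the component of `y` in `W` minus the closed neighbourhood of `x`.
    set far : V → Prop := fun a => a ∈ W ∧ a ≠ x ∧ ¬ G.Adj x a with hfar
    set step : V → V → Prop := fun a b => G.Adj a b ∧ far a ∧ far b with hstepd
    set C := W.filter fun c => Relation.ReflTransGen step y c with hC
    have hCfar : ∀ c ∈ C, far c := by
      intro c hc
      rw [hC, Finset.mem_filter] at hc
      rcases Relation.ReflTransGen.cases_tail hc.2 with h | ⟨b, _, h⟩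
      · exact h ▸ ⟨hyW, hyx, hxy⟩
      · exact h.2.2
    have hyC : y ∈ C := by
      rw [hC, Finset.mem_filter]; exact ⟨hyW, .refl⟩
    have hCstep : ∀ c ∈ C, ∀ b ∈ W, G.Adj c b → far b → b ∈ C := by
      intro c hc b hb hcb hfb
      have hfc := hCfar c hc
      rw [hC, Finset.mem_filter] at hc ⊢
      exact ⟨hb, hc.2.tail ⟨hcb, hfc, hfb⟩⟩
    set S := W.filter fun a => G.Adj x a ∧ ∃ c ∈ C, G.Adj a c with hS
    have hclique : ∀ a ∈ S, ∀ b ∈ S, a ≠ b → G.Adj a b := by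
      intro a ha b hb hab
      rw [hS, Finset.mem_filter] at ha hb
      obtain ⟨haW, hxa, ca, hca, haca⟩ := ha
      obtain ⟨hbW, hxb, cb, hcb, hbcb⟩ := hb
      set U : V → Prop := fun c => c ∈ C ∨ c = a ∨ c = b with hU
      set H : SimpleGraph V :=
        { Adj := fun c e => G.Adj c e ∧ U c ∧ U e
          symm := ⟨fun c e h => ⟨h.1.symm, h.2.2, h.2.1⟩⟩
          loopless := ⟨fun c h => G.irrefl h.1⟩ } with hH
      have hyc : ∀ c, Relation.ReflTransGen step y c → c ∈ C ∧ H.Reachable y c := by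
        intro c hc
        induction hc with
        | refl => exact ⟨hyC, .refl _⟩
        | tail _ hbc ih =>
          have hm := hCstep _ ih.1 _ hbc.2.2.1 hbc.1 hbc.2.2
          exact ⟨hm, ih.2.trans (SimpleGraph.Adj.reachable (G := H) ⟨hbc.1, .inl ih.1, .inl hm⟩)⟩
      have hra : H.Reachable y ca :=
        (hyc ca (Finset.mem_filter.1 hca).2).2
      have hrb : H.Reachable y cb := (hyc cb (Finset.mem_filter.1 hcb).2).2
      have h1 : H.Reachable a ca :=
        SimpleGraph.Adj.reachable (G := H) ⟨haca, .inr (.inl rfl), .inl hca⟩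
      have h2 : H.Reachable b cb :=
        SimpleGraph.Adj.reachable (G := H) ⟨hbcb, .inr (.inr rfl), .inl hcb⟩
      refine hG.adj_of_reachable hxa hxb hab (H := H) (fun _ _ h => h.1) ?_ ?_
        ((h1.trans hra.symm).trans (hrb.trans h2.symm))
      · exact fun u v c e hc he huv => ⟨huv, hc.2.1, he.2.1⟩
      · intro u c hc hua hub
        rcases hc.2.1 with h | h | h
        · exact (hCfar u h).2
        · exact absurd h hua
        · exact absurd h hub
    -- Neighbours in `W` of vertices of `C` lie in `C ∪ S`.
    have hnbC : ∀ c ∈ C, ∀ b ∈ W, G.Adj c b → b ∈ C ∪ S := by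
      intro c hc b hb hcb
      rw [Finset.mem_union]
      by_cases hxb : G.Adj x b
      · right
        rw [hS, Finset.mem_filter]
        exact ⟨hb, hxb, c, hc, hcb.symm⟩
      · left
        refine hCstep c hc b hb hcb ⟨hb, ?_, hxb⟩
        rintro rfl
        exact (hCfar c hc).2.2 hcb.symm
    have hsub : C ∪ S ⊂ W := by
      refine (Finset.ssubset_iff_of_subset ?_).2 ⟨x, hxW, ?_⟩
      · exact Finset.union_subset (Finset.filter_subset _ _) (Finset.filter_subset _ _)
      · rw [Finset.mem_union]
        rintro (h | h)
        · exact (hCfar x h).2.1 rfl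
        · rw [hS, Finset.mem_filter] at h
          exact G.irrefl h.2.1
    -- A vertex of `C` that is simplicial in `C ∪ S` is simplicial in `W`.
    have hfin : (∃ v ∈ C, ∀ a ∈ C ∪ S, ∀ b ∈ C ∪ S, G.Adj v a → G.Adj v b → a ≠ b → G.Adj a b) →
        ∃ v ∈ W, v ≠ x ∧ ¬ G.Adj x v ∧
          ∀ a ∈ W, ∀ b ∈ W, G.Adj v a → G.Adj v b → a ≠ b → G.Adj a b := by
      rintro ⟨v, hv, hsim⟩
      refine ⟨v, (hCfar v hv).1, (hCfar v hv).2.1, (hCfar v hv).2.2, fun a ha b hb hva hvb => ?_⟩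
      exact hsim a (hnbC v hv a ha hva) b (hnbC v hv b hb hvb) hva hvb
    apply hfin
    by_cases hSdom : ∃ a ∈ S, ∃ b ∈ C ∪ S, b ≠ a ∧ ¬ G.Adj a b
    · obtain ⟨a, ha, hb⟩ := hSdom
      obtain ⟨v, hv, hva, hav, hsim⟩ := ih _ hsub a (Finset.mem_union_right _ ha) hb
      rcases Finset.mem_union.1 hv with h | h
      · exact ⟨v, h, hsim⟩
      · exact absurd (hclique a ha v h hva.symm) hav
    · push Not at hSdom
      by_cases hCdom : ∃ a ∈ C, ∃ b ∈ C ∪ S, b ≠ a ∧ ¬ G.Adj a b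
      · obtain ⟨a, ha, hb⟩ := hCdom
        obtain ⟨v, hv, hva, hav, hsim⟩ := ih _ hsub a (Finset.mem_union_left _ ha) hb
        rcases Finset.mem_union.1 hv with h | h
        · exact ⟨v, h, hsim⟩
        · exact absurd (hSdom v h a (Finset.mem_union_left _ ha) hva.symm).symm hav
      · push Not at hCdom
        refine ⟨y, hyC, fun a ha b hb _ _ hab => ?_⟩
        rcases Finset.mem_union.1 ha with h | h
        · exact hCdom a h b hb hab.symm
        · exact hSdom a h b hb hab.symm

theorem IsChordal.exists_simplicial {V : Type*} {G : SimpleGraph V} (hG : IsChordal G)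
    (W : Finset V) (hW : W.Nonempty) :
    ∃ v ∈ W, ∀ a ∈ W, ∀ b ∈ W, G.Adj v a → G.Adj v b → a ≠ b → G.Adj a b := by
  obtain ⟨x, hx⟩ := hW
  by_cases h : ∃ x ∈ W, ∃ y ∈ W, y ≠ x ∧ ¬ G.Adj x y
  · obtain ⟨x, hx, hy⟩ := h
    obtain ⟨v, hv, _, _, hsim⟩ := hG.exists_simplicial_not_adj W x hx hy
    exact ⟨v, hv, hsim⟩
  · push Not at h
    exact ⟨x, hx, fun a ha b hb _ _ hab => h a ha b hb hab.symm⟩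

/-! ### In-degree vectors -/

open scoped Pointwise

section InDegreeVectors

variable {V : Type*} [Fintype V]

/-- The in-degree vectors of all orientations of the edges `{a, u}`, `(a, u) ∈ E`: each edge
contributes one unit to one of its ends. -/
def degSet [DecidableEq V] (E : Finset (V × V)) : Set (V → ℕ) :=
  ∑ e ∈ E, {Pi.single e.1 1, Pi.single e.2 1}

open Classical in
/-- The edges of `G`, each represented by its pair of ends in the order given by `pos`. -/
noncomputable def arcs (G : SimpleGraph V) (pos : V → ℕ) : Finset (V × V) :=
  Finset.univ.filter fun e => G.Adj e.1 e.2 ∧ pos e.1 < pos e.2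

theorem mem_arcs {G : SimpleGraph V} {pos : V → ℕ} {a u : V} :
    (a, u) ∈ arcs G pos ↔ G.Adj a u ∧ pos a < pos u := by simp [arcs]

open Classical in
/-- The neighbours of `v` at later positions. -/
noncomputable def laterNbs (G : SimpleGraph V) (pos : V → ℕ) (v : V) : Finset V :=
  Finset.univ.filter fun u => G.Adj v u ∧ pos v < pos u

theorem mem_laterNbs {G : SimpleGraph V} {pos : V → ℕ} {u v : V} :
    u ∈ laterNbs G pos v ↔ G.Adj v u ∧ pos v < pos u := by simp [laterNbs]

variable [DecidableEq V]

/-- In an orientation of the whole graph, the vertices of in-degree more than `d` form a deletion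
set. -/
theorem isDeletionSet_of_mem_degSet {G : SimpleGraph V} {pos : V → ℕ}
    (hpos : Function.Injective pos) {d : ℕ} {x : V → ℕ} (hx : x ∈ degSet (arcs G pos)) :
    IsDeletionSet G d (Finset.univ.filter fun v => d < x v) := by
  obtain ⟨g, hg, hgx⟩ := Set.mem_finsetSum _ _ _ |>.1 hx
  have hg' : ∀ a u, G.Adj a u → pos a < pos u →
      g (a, u) = Pi.single a 1 ∨ g (a, u) = Pi.single u 1 := fun a u h h' => by
    simpa using hg (mem_arcs.2 ⟨h, h'⟩)
  have hsingle : ∀ {a b : V}, (Pi.single a 1 : V → ℕ) = Pi.single b 1 → a = b := by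
    intro a b h
    by_contra hab
    have := congrFun h a
    simp [hab] at this
  set K := Finset.univ.filter fun v => d < x v with hK
  set D : Digraph {v : V | v ∉ K} :=
    { Adj := fun a b => G.Adj a b ∧ ((pos a < pos b ∧ g (a, b) = Pi.single b.1 1) ∨
        (pos b < pos a ∧ g (b, a) = Pi.single b.1 1)) } with hD
  refine ⟨D, ⟨?_, ?_⟩, ?_⟩
  · rintro ⟨a, ha⟩ ⟨b, hb⟩
    simp only [SimpleGraph.comap_adj, Function.Embedding.subtype_apply, hD]
    constructor
    · intro hab
      rcases lt_trichotomy (pos a) (pos b) with h | h | h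
      · rcases hg' a b hab h with h' | h'
        · exact .inr ⟨hab.symm, .inr ⟨h, h'⟩⟩
        · exact .inl ⟨hab, .inl ⟨h, h'⟩⟩
      · exact absurd (hpos h) hab.ne
      · rcases hg' b a hab.symm h with h' | h'
        · exact .inl ⟨hab, .inr ⟨h, h'⟩⟩
        · exact .inr ⟨hab.symm, .inl ⟨h, h'⟩⟩
    · rintro (h | h)
      · exact h.1
      · exact h.1.symm
  · rintro ⟨a, ha⟩ ⟨b, hb⟩ ⟨⟨h, h1⟩, _, h2⟩
    simp only at h h1 h2
    rcases h1 with ⟨h1, e1⟩ | ⟨h1, e1⟩ <;> rcases h2 with ⟨h2, e2⟩ | ⟨h2, e2⟩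
    · omega
    · exact h.ne (hsingle (e2.symm.trans e1))
    · exact h.ne (hsingle (e2.symm.trans e1))
    · omega
  · rintro ⟨b, hb⟩
    have hxb : x b ≤ d := by
      simpa [hK] using hb
    set Eb := (arcs G pos).filter fun e => g e = Pi.single b 1 with hEb
    have hcard : Eb.card ≤ x b := by
      rw [← hgx, Finset.sum_apply, Finset.card_eq_sum_ones]
      refine (Finset.sum_le_sum fun e he => ?_).trans
        (Finset.sum_le_sum_of_subset (Finset.filter_subset _ _))
      rw [(Finset.mem_filter.1 he).2]; simp
    have hle : inDegree D ⟨b, hb⟩ ≤ (Eb : Set (V × V)).encard := by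
      refine Set.encard_le_encard_of_injOn
        (f := fun u => if pos u.1 < pos b then (u.1, b) else (b, u.1)) ?_ ?_
      · rintro ⟨u, hu⟩ ⟨h, h'⟩
        simp only at h h'
        simp only [Finset.mem_coe, hEb, Finset.mem_filter]
        rcases h' with h' | h'
        · rw [if_pos h'.1]
          exact ⟨mem_arcs.2 ⟨h, h'.1⟩, h'.2⟩
        · rw [if_neg (by omega)]
          exact ⟨mem_arcs.2 ⟨h.symm, h'.1⟩, h'.2⟩
      · rintro ⟨u, hu⟩ ⟨h, -⟩ ⟨v, hv⟩ ⟨h', -⟩ huv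
        simp only at huv h h'
        apply Subtype.ext
        simp only
        split_ifs at huv <;> simp only [Prod.mk.injEq] at huv
        · exact huv.1
        · exact absurd huv.1 h.ne
        · exact absurd huv.2 h.ne
        · exact huv.2
    refine hle.trans ?_
    rw [Set.encard_coe_eq_coe_finsetCard]
    exact_mod_cast hcard.trans hxb

/-- An orientation of `G[V ∖ K]` extends to an orientation of `G` that has the same in-degrees
outside `K`, because all edges that meet `K` can be directed towards `K`. -/
theorem exists_mem_degSet_of_isDeletionSet {G : SimpleGraph V} (pos : V → ℕ) {d : ℕ}
    {K : Finset V} (hK : IsDeletionSet G d K) :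
    ∃ x ∈ degSet (arcs G pos), ∀ v ∉ K, x v ≤ d := by
  classical
  obtain ⟨D, ⟨hD, hD'⟩, hdeg⟩ := hK
  set R : V → V → Prop := fun a b => ∃ (ha : a ∉ K) (hb : b ∉ K), D.Adj ⟨a, ha⟩ ⟨b, hb⟩ with hR
  set g : V × V → V → ℕ := fun e =>
    if e.1 ∈ K then Pi.single e.1 1 else if e.2 ∈ K then Pi.single e.2 1 else
      if R e.2 e.1 then Pi.single e.1 1 else Pi.single e.2 1 with hg
  refine ⟨∑ e ∈ arcs G pos, g e, ?_, ?_⟩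
  · refine (Set.mem_finsetSum _ _ _).2 ⟨g, fun {e} _ => ?_, rfl⟩
    simp only [hg]
    split_ifs <;> simp
  · intro v hv
    have hone : ∀ e, g e v ≤ 1 := by
      intro e
      simp only [hg]
      split_ifs <;> simp only [Pi.single_apply] <;> split_ifs <;> simp
    set Ev := (arcs G pos).filter fun e => g e v ≠ 0 with hEv
    have h1 : (∑ e ∈ arcs G pos, g e) v ≤ Ev.card := by
      rw [Finset.sum_apply, Finset.card_eq_sum_ones, hEv, Finset.sum_filter]
      refine Finset.sum_le_sum fun e _ => ?_
      split_ifs with h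
      · exact hone e
      · simp only [ne_eq, not_not] at h
        exact h.le
    have hmem : ∀ e ∈ Ev, ((e.1 = v ∧ R e.2 v) ∨ (e.2 = v ∧ R e.1 v)) ∧ e.1 ≠ e.2 := by
      rintro ⟨a, u⟩ he
      simp only [hEv, Finset.mem_filter, mem_arcs, hg] at he
      obtain ⟨⟨hau, hlt⟩, he⟩ := he
      refine ⟨?_, hau.ne⟩
      simp only
      by_cases haK : a ∈ K
      · rw [if_pos haK] at he
        have : v = a := by by_contra h; simp [h] at he
        exact absurd (this ▸ haK) hv
      · rw [if_neg haK] at he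
        by_cases huK : u ∈ K
        · rw [if_pos huK] at he
          have : v = u := by by_contra h; simp [h] at he
          exact absurd (this ▸ huK) hv
        · rw [if_neg huK] at he
          by_cases hr : R u a
          · rw [if_pos hr] at he
            have : v = a := by by_contra h; simp [h] at he
            exact .inl ⟨this.symm, this ▸ hr⟩
          · rw [if_neg hr] at he
            have hvu : v = u := by by_contra h; simp [h] at he
            refine .inr ⟨hvu.symm, hvu ▸ ⟨haK, huK, ?_⟩⟩
            rcases (hD ⟨a, haK⟩ ⟨u, huK⟩).1 hau with h | h
            · exact h
            · exact absurd ⟨huK, haK, h⟩ hr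
    have h2 : (Ev : Set (V × V)).encard ≤
        (Subtype.val '' {u : {v : V | v ∉ K} | D.Adj u ⟨v, hv⟩}).encard := by
      refine Set.encard_le_encard_of_injOn (f := fun e => if e.1 = v then e.2 else e.1) ?_ ?_
      · intro e he
        have hm := hmem e he
        simp only
        split_ifs with h
        · rcases hm.1 with ⟨_, hu, _, hR⟩ | ⟨h', _⟩
          · exact ⟨⟨e.2, hu⟩, hR, rfl⟩
          · exact absurd (h.trans h'.symm) hm.2
        · rcases hm.1 with ⟨h', _⟩ | ⟨_, hu, _, hR⟩
          · exact absurd h' h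
          · exact ⟨⟨e.1, hu⟩, hR, rfl⟩
      · intro e he e' he' hee
        have hp : ∀ e ∈ Ev, pos e.1 < pos e.2 := fun e he => by
          simp only [hEv, Finset.mem_filter] at he
          exact (mem_arcs.1 he.1).2
        have hm := hmem e he
        have hm' := hmem e' he'
        have hpe := hp e he
        have hpe' := hp e' he'
        simp only at hee
        split_ifs at hee with h h' h'
        · exact Prod.ext (h.trans h'.symm) hee
        · have : e'.2 = v := by rcases hm'.1 with h0 | h0; exacts [absurd h0.1 h', h0.1]
          rw [h, hee] at hpe; rw [this] at hpe'; omega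
        · have : e.2 = v := by rcases hm.1 with h0 | h0; exacts [absurd h0.1 h, h0.1]
          rw [h', ← hee] at hpe'; rw [this] at hpe; omega
        · have h1 : e.2 = v := by rcases hm.1 with h0 | h0; exacts [absurd h0.1 h, h0.1]
          have h2 : e'.2 = v := by rcases hm'.1 with h0 | h0; exacts [absurd h0.1 h', h0.1]
          exact Prod.ext hee (h1.trans h2.symm)
    rw [Subtype.val_injective.encard_image, Set.encard_coe_eq_coe_finsetCard] at h2
    have h3 := h2.trans (hdeg ⟨v, hv⟩)
    exact h1.trans (by exact_mod_cast h3)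

/-- A clique minus a deletion set has at most `2 d + 1` vertices, because a clique on `r` vertices
has `r (r - 1) / 2` edges and hence a vertex of in-degree at least `(r - 1) / 2`. -/
theorem card_clique_le {G : SimpleGraph V} {d : ℕ} {K Q : Finset V} (hK : IsDeletionSet G d K)
    (hQ : ∀ a ∈ Q, ∀ b ∈ Q, a ≠ b → G.Adj a b) : Q.card ≤ 2 * d + 1 + K.card := by
  classical
  obtain ⟨D, ⟨hD, hD'⟩, hdeg⟩ := hK
  set C : Finset {v : V | v ∉ K} := Finset.univ.filter fun v => v.1 ∈ Q with hC
  have hcard : Q.card ≤ C.card + K.card := by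
    have h1 : Q ⊆ C.map ⟨Subtype.val, Subtype.val_injective⟩ ∪ K := by
      intro v hv
      by_cases h : v ∈ K <;> simp [hC, h, hv]
    refine (Finset.card_le_card h1).trans ((Finset.card_union_le _ _).trans ?_)
    rw [Finset.card_map]
  have hin : ∀ v, ∑ u ∈ C, (if D.Adj u v then 1 else 0) ≤ d := by
    intro v
    have h : ((C.filter fun u => D.Adj u v : Finset _) : Set {v : V | v ∉ K}).encard ≤ d := by
      refine (Set.encard_le_encard ?_).trans (hdeg v)
      intro u hu
      simp only [Finset.coe_filter, Set.mem_ofPred_eq] at hu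
      exact hu.2
    rw [Set.encard_coe_eq_coe_finsetCard] at h
    rw [← Finset.card_filter]
    exact_mod_cast h
  have hpair : ∀ v ∈ C, C.card ≤ (∑ u ∈ C, (if D.Adj u v then 1 else 0)) +
      (∑ u ∈ C, (if D.Adj v u then 1 else 0)) + 1 := by
    intro v hv
    have h1 : (C.erase v).card ≤ ∑ u ∈ C.erase v,
        ((if D.Adj u v then 1 else 0) + (if D.Adj v u then 1 else 0)) := by
      rw [Finset.card_eq_sum_ones]
      refine Finset.sum_le_sum fun u hu => ?_
      have huv := Finset.ne_of_mem_erase hu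
      have huC := Finset.mem_of_mem_erase hu
      simp only [hC, Finset.mem_filter] at huC hv
      have := (hD u v).1 (hQ _ huC.2 _ hv.2 fun h => huv (Subtype.ext h))
      rcases this with h | h <;> simp [h]
    rw [Finset.card_erase_of_mem hv] at h1
    have h2 := Finset.sum_le_sum_of_subset (f := fun u =>
      (if D.Adj u v then 1 else 0) + (if D.Adj v u then 1 else 0)) (Finset.erase_subset v C)
    have h3 := (h1.trans h2).trans_eq Finset.sum_add_distrib
    omega
  have hsum := Finset.sum_le_sum hpair
  rw [Finset.sum_add_distrib, Finset.sum_add_distrib,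
    Finset.sum_comm (f := fun v u => if D.Adj v u then 1 else 0)] at hsum
  have h3 := Finset.sum_le_sum fun v (_ : v ∈ C) => hin v
  simp only [Finset.sum_const, smul_eq_mul] at hsum h3
  rcases Nat.eq_zero_or_pos C.card with h0 | h0
  · omega
  · have : C.card * C.card ≤ C.card * (2 * d + 1) := by nlinarith
    have := Nat.le_of_mul_le_mul_left this h0
    omega

end InDegreeVectors

/-! ### Capped vectors as numbers -/

theorem digit_sum_lt {D : ℕ} (f : ℕ → ℕ) (hf : ∀ i, f i < D) (q : ℕ) :
    ∑ i ∈ Finset.range q, f i * D ^ i < D ^ q := by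
  induction q with
  | zero => simp
  | succ q ih =>
    rw [Finset.sum_range_succ, pow_succ]
    have h := hf q
    have : f q * D ^ q + D ^ q ≤ D ^ q * D := by
      rw [← Nat.succ_mul, mul_comm]
      exact Nat.mul_le_mul_left _ h
    omega

theorem digit_sum_div_mod {D : ℕ} (f : ℕ → ℕ) (hf : ∀ i, f i < D) (q j : ℕ) (hj : j < q) :
    (∑ i ∈ Finset.range q, f i * D ^ i) / D ^ j % D = f j := by
  have hD : 0 < D := (Nat.zero_le _).trans_lt (hf 0)
  induction q generalizing f j with
  | zero => omega
  | succ q ih =>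
    have h : ∑ i ∈ Finset.range (q + 1), f i * D ^ i =
        f 0 + D * ∑ i ∈ Finset.range q, f (i + 1) * D ^ i := by
      rw [Finset.sum_range_succ', Finset.mul_sum, add_comm]
      congr 1
      · simp
      · exact Finset.sum_congr rfl fun i _ => by ring
    rw [h]
    cases j with
    | zero => rw [pow_zero, Nat.div_one, Nat.add_mul_mod_self_left, Nat.mod_eq_of_lt (hf 0)]
    | succ j =>
      rw [pow_succ', ← Nat.div_div_eq_div_mul, Nat.add_mul_div_left _ _ hD,
        Nat.div_eq_of_lt (hf 0), zero_add]
      exact ih (fun i => f (i + 1)) (fun i => hf _) j (by omega)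

/-- The number `m` with each of its `q` digits in base `2 d + 3` replaced by its minimum with
`d + 1`. -/
def capDigits (d q m : ℕ) : ℕ :=
  ∑ i ∈ Finset.range q, min (m / (2 * d + 3) ^ i % (2 * d + 3)) (d + 1) * (2 * d + 3) ^ i

section Code

variable {V : Type*}

/-- The restriction of a vector to `B`, with entries capped at `d + 1`, as a number: the entry at
`u` becomes digit `col u` in base `2 d + 3`. With this base two capped vectors can be added without
carries. -/
def code (d : ℕ) (col : V → ℕ) (B : Finset V) (x : V → ℕ) : ℕ :=
  ∑ u ∈ B, min (x u) (d + 1) * (2 * d + 3) ^ col u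

/-- The digits of `code`. -/
def codeDigit (d : ℕ) (col : V → ℕ) (B : Finset V) (x : V → ℕ) (i : ℕ) : ℕ :=
  ∑ u ∈ B with col u = i, min (x u) (d + 1)

variable {d q : ℕ} {col : V → ℕ} {B : Finset V}

theorem code_eq_sum_codeDigit (hq : ∀ u ∈ B, col u < q) (x : V → ℕ) :
    code d col B x = ∑ i ∈ Finset.range q, codeDigit d col B x i * (2 * d + 3) ^ i := by
  rw [code, ← Finset.sum_fiberwise_of_maps_to (t := Finset.range q) (g := col)
    (fun u hu => Finset.mem_range.2 (hq u hu))]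
  refine Finset.sum_congr rfl fun i _ => ?_
  rw [codeDigit, Finset.sum_mul]
  exact Finset.sum_congr rfl fun u hu => by rw [(Finset.mem_filter.1 hu).2]

theorem codeDigit_of_mem (hcol : Set.InjOn col B) (x : V → ℕ) {u : V} (hu : u ∈ B) :
    codeDigit d col B x (col u) = min (x u) (d + 1) := by
  have : B.filter (fun v => col v = col u) = {u} := by
    ext v
    simp only [Finset.mem_filter, Finset.mem_singleton]
    exact ⟨fun h => hcol h.1 hu h.2, by rintro rfl; exact ⟨hu, rfl⟩⟩
  rw [codeDigit, this, Finset.sum_singleton]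

theorem codeDigit_eq_or (hcol : Set.InjOn col B) (i : ℕ) :
    (∃ u ∈ B, ∀ x, codeDigit d col B x i = min (x u) (d + 1)) ∨
      ∀ x, codeDigit d col B x i = 0 := by
  by_cases h : ∃ u ∈ B, col u = i
  · obtain ⟨u, hu, rfl⟩ := h
    exact .inl ⟨u, hu, fun x => codeDigit_of_mem hcol x hu⟩
  · right
    intro x
    rw [codeDigit, Finset.filter_eq_empty_iff.2, Finset.sum_empty]
    exact fun u hu h' => h ⟨u, hu, h'⟩

theorem codeDigit_le (hcol : Set.InjOn col B) (x : V → ℕ) (i : ℕ) :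
    codeDigit d col B x i ≤ d + 1 := by
  rcases codeDigit_eq_or (d := d) hcol i with ⟨u, _, h⟩ | h
  · rw [h]; exact min_le_right _ _
  · rw [h]; omega

theorem code_lt (hcol : Set.InjOn col B) (hq : ∀ u ∈ B, col u < q) (x : V → ℕ) :
    code d col B x < (2 * d + 3) ^ q := by
  rw [code_eq_sum_codeDigit hq]
  refine digit_sum_lt _ (fun i => ?_) q
  have := codeDigit_le (d := d) hcol x i
  omega

theorem code_div_mod (hcol : Set.InjOn col B) (hq : ∀ u ∈ B, col u < q) (x : V → ℕ) {u : V}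
    (hu : u ∈ B) : code d col B x / (2 * d + 3) ^ col u % (2 * d + 3) = min (x u) (d + 1) := by
  rw [code_eq_sum_codeDigit hq, digit_sum_div_mod _ _ _ _ (hq u hu), codeDigit_of_mem hcol x hu]
  intro i
  have := codeDigit_le (d := d) hcol x i
  omega

theorem capDigits_code_add (hcol : Set.InjOn col B) (hq : ∀ u ∈ B, col u < q) (x y : V → ℕ) :
    capDigits d q (code d col B x + code d col B y) = code d col B (x + y) := by
  rw [code_eq_sum_codeDigit hq (x + y), capDigits]
  refine Finset.sum_congr rfl fun i hi => ?_
  congr 1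
  rw [code_eq_sum_codeDigit hq, code_eq_sum_codeDigit hq, ← Finset.sum_add_distrib]
  simp only [← add_mul]
  rw [digit_sum_div_mod (fun i => codeDigit d col B x i + codeDigit d col B y i) _ _ _
    (Finset.mem_range.1 hi)]
  · rcases codeDigit_eq_or (d := d) hcol i with ⟨u, _, h⟩ | h
    · simp only [h, Pi.add_apply]; omega
    · simp only [h]; omega
  · intro i
    have := codeDigit_le (d := d) hcol x i
    have := codeDigit_le (d := d) hcol y i
    omega

theorem code_congr {B' : Finset V} {x : V → ℕ} (h : B' ⊆ B) (hx : ∀ u ∈ B, u ∉ B' → x u = 0) :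
    code d col B' x = code d col B x := by
  refine Finset.sum_subset h fun u hu hu' => ?_
  simp [hx u hu hu']

end Code

/-! ### Tables -/

/-- The first `N` entries of `T` are the lower envelope of the set `C` of pairs (index, cost), cut
off at `I`. -/
structure IsTable (N I : ℕ) (T : ℕ → ℕ) (C : Set (ℕ × ℕ)) : Prop where
  le_top : ∀ ρ < N, T ρ ≤ I
  sound : ∀ ρ < N, T ρ < I → ∃ c ≤ T ρ, (ρ, c) ∈ C
  le_cost : ∀ ρ c, ρ < N → (ρ, c) ∈ C → T ρ ≤ c

namespace IsTable

variable {N I : ℕ} {T T' A F : ℕ → ℕ} {C C₁ C₂ : Set (ℕ × ℕ)}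

theorem congr (h : IsTable N I T C) (hT : ∀ ρ < N, T' ρ = T ρ) : IsTable N I T' C where
  le_top ρ hρ := hT ρ hρ ▸ h.le_top ρ hρ
  sound ρ hρ := hT ρ hρ ▸ h.sound ρ hρ
  le_cost ρ c hρ := hT ρ hρ ▸ h.le_cost ρ c hρ

theorem empty (hT : ∀ ρ < N, T ρ = I) : IsTable N I T ∅ where
  le_top ρ hρ := (hT ρ hρ).le
  sound ρ hρ h := absurd (hT ρ hρ) h.ne
  le_cost _ _ _ h := h.elim

theorem relax (h : IsTable N I T C) (ρ v : ℕ) :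
    IsTable N I (Function.update T ρ (min (T ρ) v)) (insert (ρ, v) C) where
  le_top σ hσ := by
    rw [Function.update_apply]
    split_ifs with e
    · exact (min_le_left _ _).trans (h.le_top ρ (e ▸ hσ))
    · exact h.le_top σ hσ
  sound σ hσ := by
    rw [Function.update_apply]
    split_ifs with e
    · subst e
      intro hlt
      rcases le_total v (T σ) with hv | hv
      · exact ⟨v, by simp [hv], by simp⟩
      · rw [min_eq_left hv] at hlt ⊢
        obtain ⟨c, hc, hC⟩ := h.sound σ hσ hlt
        exact ⟨c, hc, Set.mem_insert_of_mem _ hC⟩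
    · intro hlt
      obtain ⟨c, hc, hC⟩ := h.sound σ hσ hlt
      exact ⟨c, hc, Set.mem_insert_of_mem _ hC⟩
  le_cost σ c hσ hm := by
    rw [Function.update_apply]
    rcases Set.mem_insert_iff.1 hm with e | hm'
    · simp only [Prod.mk.injEq] at e
      rw [if_pos e.1, e.2]
      exact min_le_right _ _
    · split_ifs with e
      · subst e
        exact (min_le_left _ _).trans (h.le_cost σ c hσ hm')
      · exact h.le_cost σ c hσ hm'

/-- Replacing the inputs of a combination step by the sets whose envelopes they are. -/
theorem combine {f : ℕ → ℕ → ℕ} (hA : IsTable N I A C₁) (hF : IsTable N I F C₂)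
    (hT : IsTable N I T {z | ∃ a < N, ∃ b < N, z = (f a b, A a + F b)})
    (h₁ : ∀ z ∈ C₁, z.1 < N) (h₂ : ∀ z ∈ C₂, z.1 < N) :
    IsTable N I T {z | ∃ z₁ ∈ C₁, ∃ z₂ ∈ C₂, z = (f z₁.1 z₂.1, z₁.2 + z₂.2)} where
  le_top := hT.le_top
  sound ρ hρ hlt := by
    obtain ⟨c, hc, a, ha, b, hb, hz⟩ := hT.sound ρ hρ hlt
    simp only [Prod.mk.injEq] at hz
    obtain ⟨c₁, hc₁, hm₁⟩ := hA.sound a ha (by omega)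
    obtain ⟨c₂, hc₂, hm₂⟩ := hF.sound b hb (by omega)
    exact ⟨c₁ + c₂, by omega, _, hm₁, _, hm₂, by simp [hz.1]⟩
  le_cost ρ c hρ := by
    rintro ⟨z₁, hz₁, z₂, hz₂, hz⟩
    simp only [Prod.mk.injEq] at hz
    have e := hT.le_cost ρ (A z₁.1 + F z₂.1) hρ
      ⟨z₁.1, h₁ _ hz₁, z₂.1, h₂ _ hz₂, by simp [hz.1]⟩
    have e₁ := hA.le_cost z₁.1 z₁.2 (h₁ _ hz₁) hz₁
    have e₂ := hF.le_cost z₂.1 z₂.2 (h₂ _ hz₂) hz₂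
    omega

/-- Replacing the input of a transformation step by the set whose envelope it is. -/
theorem transform {f g : ℕ → ℕ} (hA : IsTable N I A C)
    (hT : IsTable N I T {z | ∃ a < N, z = (f a, A a + g a)}) (h₁ : ∀ z ∈ C, z.1 < N) :
    IsTable N I T {z | ∃ y ∈ C, z = (f y.1, y.2 + g y.1)} where
  le_top := hT.le_top
  sound ρ hρ hlt := by
    obtain ⟨c, hc, a, ha, hz⟩ := hT.sound ρ hρ hlt
    simp only [Prod.mk.injEq] at hz
    obtain ⟨c₁, hc₁, hm₁⟩ := hA.sound a ha (by omega)
    exact ⟨c₁ + g a, by omega, _, hm₁, by simp [hz.1]⟩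
  le_cost ρ c hρ := by
    rintro ⟨y, hy, hz⟩
    simp only [Prod.mk.injEq] at hz
    have e := hT.le_cost ρ (A y.1 + g y.1) hρ ⟨y.1, h₁ _ hy, by simp [hz.1]⟩
    have e₁ := hA.le_cost y.1 y.2 (h₁ _ hy) hy
    omega

end IsTable

section States

open scoped Pointwise

variable {V : Type*}

/-- The pairs (code on the bag `B`, total weight of the vertices of `S` with in-degree more than
`d`) for the in-degree vectors in `R`. -/
def stateSet (d : ℕ) (col w : V → ℕ) (S B : Finset V) (R : Set (V → ℕ)) : Set (ℕ × ℕ) :=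
  (fun x => (code d col B x, ∑ v ∈ S, if d < x v then w v else 0)) '' R

variable {d q I : ℕ} {col w : V → ℕ} {S S' B B' : Finset V} {R R' : Set (V → ℕ)}
  {A F T : ℕ → ℕ}

theorem stateSet_fst_lt (hcol : Set.InjOn col B) (hq : ∀ u ∈ B, col u < q) :
    ∀ z ∈ stateSet d col w S B R, z.1 < (2 * d + 3) ^ q := by
  rintro _ ⟨x, _, rfl⟩
  exact code_lt hcol hq x

theorem IsTable.bag_zero {N : ℕ} (hT : IsTable N I T {(0, 0)}) :
    IsTable N I T (stateSet d col w ∅ B 0) := by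
  convert hT using 1
  simp [stateSet, code]

variable [DecidableEq V]

/-- Joining two parts of the graph that meet only in the bag `B`. -/
theorem IsTable.join (hcol : Set.InjOn col B) (hq : ∀ u ∈ B, col u < q)
    (hA : IsTable ((2 * d + 3) ^ q) I A (stateSet d col w S B R))
    (hF : IsTable ((2 * d + 3) ^ q) I F (stateSet d col w S' B' R'))
    (hT : IsTable ((2 * d + 3) ^ q) I T {z | ∃ a < (2 * d + 3) ^ q, ∃ b < (2 * d + 3) ^ q,
      z = (capDigits d q (a + b), A a + F b)})
    (hB : B' ⊆ B) (hS : Disjoint S S')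
    (hR : ∀ x ∈ R, ∀ v ∈ S', x v = 0)
    (hR' : ∀ x ∈ R', (∀ v ∈ S, x v = 0) ∧ ∀ v ∈ B, v ∉ B' → x v = 0) :
    IsTable ((2 * d + 3) ^ q) I T (stateSet d col w (S ∪ S') B (R + R')) := by
  have h := IsTable.combine (f := fun a b => capDigits d q (a + b)) hA hF hT
    (stateSet_fst_lt hcol hq)
    (stateSet_fst_lt (hcol.mono (by exact_mod_cast hB)) fun u hu => hq u (hB hu))
  have key : ∀ x ∈ R, ∀ y ∈ R',
      (capDigits d q (code d col B x + code d col B' y),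
        (∑ v ∈ S, if d < x v then w v else 0) + ∑ v ∈ S', if d < y v then w v else 0) =
      (code d col B (x + y), ∑ v ∈ S ∪ S', if d < (x + y) v then w v else 0) := by
    intro x hx y hy
    rw [code_congr hB (hR' y hy).2, capDigits_code_add hcol hq, Finset.sum_union hS]
    congr 2
    · exact Finset.sum_congr rfl fun v hv => by simp [(hR' y hy).1 v hv]
    · exact Finset.sum_congr rfl fun v hv => by simp [hR x hx v hv]
  convert h using 1
  ext z
  constructor
  · rintro ⟨_, ⟨x, hx, y, hy, rfl⟩, rfl⟩
    exact ⟨_, ⟨x, hx, rfl⟩, _, ⟨y, hy, rfl⟩, (key x hx y hy).symm⟩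
  · rintro ⟨_, ⟨x, hx, rfl⟩, _, ⟨y, hy, rfl⟩, rfl⟩
    exact ⟨x + y, Set.add_mem_add hx hy, (key x hx y hy).symm⟩

/-- Removing `v` from the bag once all its edges are oriented: its weight is due if its in-degree
exceeds `d`. -/
theorem IsTable.forget (hcol : Set.InjOn col B) (hq : ∀ u ∈ B, col u < q) {v : V} (hv : v ∈ B)
    (hvS : v ∉ S)
    (hA : IsTable ((2 * d + 3) ^ q) I A (stateSet d col w S B R))
    (hT : IsTable ((2 * d + 3) ^ q) I T {z | ∃ a < (2 * d + 3) ^ q,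
      z = (a - min (a / (2 * d + 3) ^ col v % (2 * d + 3)) (d + 1) * (2 * d + 3) ^ col v,
        A a + if d < a / (2 * d + 3) ^ col v % (2 * d + 3) then w v else 0)}) :
    IsTable ((2 * d + 3) ^ q) I T (stateSet d col w (insert v S) (B.erase v) R) := by
  have h := IsTable.transform
    (f := fun a => a - min (a / (2 * d + 3) ^ col v % (2 * d + 3)) (d + 1) * (2 * d + 3) ^ col v)
    (g := fun a => if d < a / (2 * d + 3) ^ col v % (2 * d + 3) then w v else 0)
    hA hT (stateSet_fst_lt hcol hq)
  have key : ∀ x ∈ R,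
      (code d col B x - min (code d col B x / (2 * d + 3) ^ col v % (2 * d + 3)) (d + 1) *
          (2 * d + 3) ^ col v,
        (∑ v ∈ S, if d < x v then w v else 0) +
          if d < code d col B x / (2 * d + 3) ^ col v % (2 * d + 3) then w v else 0) =
      (code d col (B.erase v) x, ∑ v ∈ insert v S, if d < x v then w v else 0) := by
    intro x _
    rw [code_div_mod hcol hq x hv, Finset.sum_insert hvS,
      add_comm (∑ v ∈ S, if d < x v then w v else 0)]
    congr 1
    · rw [code, ← Finset.add_sum_erase _ _ hv, ← code, min_eq_left (min_le_right _ _),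
        Nat.add_sub_cancel_left]
    · congr 1
      have : d < min (x v) (d + 1) ↔ d < x v := by omega
      simp only [this]
  convert h using 1
  ext z
  constructor
  · rintro ⟨x, hx, rfl⟩
    exact ⟨_, ⟨x, hx, rfl⟩, (key x hx).symm⟩
  · rintro ⟨_, ⟨x, hx, rfl⟩, rfl⟩
    exact ⟨x, hx, (key x hx).symm⟩

/-- The table of a single edge. -/
theorem IsTable.edge {N : ℕ} {u v : V} (huv : v ≠ u)
    (hT : IsTable N I T {((2 * d + 3) ^ col v, 0), ((2 * d + 3) ^ col u, 0)}) :
    IsTable N I T (stateSet d col w ∅ {v, u} {Pi.single v 1, Pi.single u 1}) := by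
  convert hT using 1
  rw [stateSet, Set.image_pair]
  simp [code, Finset.sum_pair huv, huv, huv.symm]

end States

/-! ### The elimination tree -/


/-- A graph with a perfect elimination order `pos`, a proper colouring `col` with `q` colours and
vertex weights `w`; the number `top` plays the role of infinity in tables. -/
structure Elim (n : ℕ) where
  G : SimpleGraph (Fin n)
  d : ℕ
  q : ℕ
  top : ℕ
  pos : Fin n → ℕ
  col : Fin n → ℕ
  w : Fin n → ℕ
  pos_inj : Function.Injective pos
  peo : ∀ v a b, G.Adj v a → G.Adj v b → pos v < pos a → pos v < pos b → a ≠ b → G.Adj a b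
  col_lt : ∀ v, col v < q
  col_ne : ∀ v u, G.Adj v u → pos v < pos u → col v ≠ col u

theorem degSet_eq_zero {V : Type*} [DecidableEq V] {E : Finset (V × V)} {x : V → ℕ}
    (hx : x ∈ degSet E) {a : V} (ha : ∀ e ∈ E, a ≠ e.1 ∧ a ≠ e.2) : x a = 0 := by
  obtain ⟨g, hg, rfl⟩ := (Set.mem_finsetSum _ _ _).1 hx
  rw [Finset.sum_apply]
  refine Finset.sum_eq_zero fun e he => ?_
  rcases hg he with h | h
  · rw [h]; simp [(ha e he).1]
  · rw [Set.mem_singleton_iff] at h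
    rw [h]; simp [(ha e he).2]

namespace Elim

variable {n : ℕ} (Γ : Elim n)

/-- The number of states of a bag. -/
def N : ℕ := (2 * Γ.d + 3) ^ Γ.q

/-- The neighbours of `v` that are eliminated after `v`. They form a clique. -/
noncomputable def later (v : Fin n) : Finset (Fin n) := laterNbs Γ.G Γ.pos v

open Classical in
/-- The bag with number `p`: vertex `p` and its later neighbours. Bag `n` is empty; it serves as
the root of the elimination tree. -/
noncomputable def bag (p : ℕ) : Finset (Fin n) :=
  Finset.univ.filter fun u => (u : ℕ) = p ∨ ∃ h : p < n, u ∈ Γ.later ⟨p, h⟩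

/-- The row of `p` is still in use when the first `i` vertices have been eliminated. -/
def Alive (i p : ℕ) : Prop := p = n ∨ ∃ u : Fin n, p = u ∧ i ≤ Γ.pos u

/-- The vertices among the first `i` whose contribution has been collected in row `p`. -/
def subtree (owner : Fin n → ℕ) (i p : ℕ) : Finset (Fin n) :=
  Finset.univ.filter fun a => Γ.pos a < i ∧ owner a = p

/-- The edges whose first eliminated end lies in `subtree`. -/
noncomputable def subArcs (owner : Fin n → ℕ) (i p : ℕ) : Finset (Fin n × Fin n) :=
  (arcs Γ.G Γ.pos).filter fun e => e.1 ∈ Γ.subtree owner i p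

/-- `T` is the table of the best weights for the eliminated vertices `S`, the in-degree vectors
`R` and the bag `B`. -/
def Table (T : ℕ → ℕ) (S B : Finset (Fin n)) (R : Set (Fin n → ℕ)) : Prop :=
  IsTable Γ.N Γ.top T (stateSet Γ.d Γ.col Γ.w S B R)

/-- The table `T` arises from `A` and `F` by adding costs and adding codes with capped digits. -/
def IsConv (A F T : ℕ → ℕ) : Prop :=
  IsTable Γ.N Γ.top T {z | ∃ a < Γ.N, ∃ b < Γ.N, z = (capDigits Γ.d Γ.q (a + b), A a + F b)}

/-- The in-degree vectors of the two orientations of the edge `{v, u}`. -/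
def edgeSet (v u : Fin n) : Set (Fin n → ℕ) := {Pi.single v 1, Pi.single u 1}

variable {Γ}

@[simp] theorem mem_later {v u : Fin n} : u ∈ Γ.later v ↔ Γ.G.Adj v u ∧ Γ.pos v < Γ.pos u :=
  mem_laterNbs

theorem bag_coe (v : Fin n) : Γ.bag v = insert v (Γ.later v) := by
  ext u
  simp [bag, Fin.ext_iff]

theorem bag_self : Γ.bag n = ∅ := by
  ext u
  have := u.2
  simp [bag]
  omega

theorem mem_subtree {owner : Fin n → ℕ} {i p : ℕ} {a : Fin n} :
    a ∈ Γ.subtree owner i p ↔ Γ.pos a < i ∧ owner a = p := by simp [subtree]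

theorem mem_subArcs {owner : Fin n → ℕ} {i p : ℕ} {a u : Fin n} :
    (a, u) ∈ Γ.subArcs owner i p ↔ u ∈ Γ.later a ∧ Γ.pos a < i ∧ owner a = p := by
  simp [subArcs, mem_arcs, mem_subtree]

theorem bag_injOn {i p : ℕ} (hp : Γ.Alive i p) : Set.InjOn Γ.col (Γ.bag p) := by
  rcases hp with rfl | ⟨v, rfl, -⟩
  · rw [bag_self]; simp
  · rw [bag_coe]
    have key : ∀ a ∈ insert v (Γ.later v), ∀ b ∈ insert v (Γ.later v), a ≠ b → Γ.G.Adj a b := by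
      intro a ha b hb hab
      rw [Finset.mem_insert, mem_later] at ha hb
      rcases ha with rfl | ha <;> rcases hb with rfl | hb
      · exact absurd rfl hab
      · exact hb.1
      · exact ha.1.symm
      · exact Γ.peo v a b ha.1 hb.1 ha.2 hb.2 hab
    intro a ha b hb hab
    by_contra hne
    have hadj := key a (by exact_mod_cast ha) b (by exact_mod_cast hb) hne
    rcases lt_trichotomy (Γ.pos a) (Γ.pos b) with h | h | h
    · exact Γ.col_ne a b hadj h hab
    · exact hne (Γ.pos_inj h)
    · exact Γ.col_ne b a hadj.symm h hab.symm

variable (Γ) in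
/-- The state of the elimination when the first `i` vertices have been eliminated. The row that
holds the contribution of an eliminated vertex `a` is `owner a`, its first ancestor in the
elimination tree that has not been eliminated. -/
structure Inv (i : ℕ) (row : ℕ → ℕ → ℕ) (owner : Fin n → ℕ) : Prop where
  alive : ∀ a, Γ.pos a < i → Γ.Alive i (owner a)
  mem_bag : ∀ a u, Γ.pos a < i → u ∈ Γ.later a → i ≤ Γ.pos u → u ∈ Γ.bag (owner a)
  owner_eq : ∀ a u, Γ.pos a < i → u ∈ Γ.later a → Γ.pos u < i → owner u = owner a
  table : ∀ p, Γ.Alive i p →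
    Γ.Table (row p) (Γ.subtree owner i p) (Γ.bag p) (degSet (Γ.subArcs owner i p))

theorem Inv.init {row : ℕ → ℕ → ℕ} (h : ∀ p ≤ n, IsTable Γ.N Γ.top (row p) {(0, 0)}) :
    Γ.Inv 0 row (fun _ => 0) where
  alive a ha := absurd ha (Nat.not_lt_zero _)
  mem_bag a u ha := absurd ha (Nat.not_lt_zero _)
  owner_eq a u ha := absurd ha (Nat.not_lt_zero _)
  table p hp := by
    have hpn : p ≤ n := by
      rcases hp with rfl | ⟨u, rfl, -⟩
      · exact le_rfl
      · exact u.2.le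
    have h1 : Γ.subtree (fun _ => 0) 0 p = ∅ := by ext; simp [mem_subtree]
    have h2 : Γ.subArcs (fun _ => 0) 0 p = ∅ := by ext ⟨a, u⟩; simp [mem_subArcs]
    rw [Table, h1, h2]
    simpa [degSet] using (h p hpn).bag_zero

/-- At the end, entry `0` of the root table is the minimum weight over all orientations. -/
theorem Inv.final {row : ℕ → ℕ → ℕ} {owner : Fin n → ℕ} (h : Γ.Inv n row owner)
    (hpos : ∀ v, Γ.pos v < n) (htop : ∑ v, Γ.w v < Γ.top) :
    (∃ x ∈ degSet (arcs Γ.G Γ.pos), row n 0 = ∑ v, if Γ.d < x v then Γ.w v else 0) ∧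
      ∀ x ∈ degSet (arcs Γ.G Γ.pos), row n 0 ≤ ∑ v, if Γ.d < x v then Γ.w v else 0 := by
  have hown : ∀ a, owner a = n := by
    intro a
    rcases h.alive a (hpos a) with h | ⟨u, _, hu⟩
    · exact h
    · have := hpos u; omega
  have h1 : Γ.subtree owner n n = Finset.univ := by ext a; simp [mem_subtree, hown, hpos]
  have h2 : Γ.subArcs owner n n = arcs Γ.G Γ.pos := by
    ext ⟨a, u⟩; simp [mem_subArcs, hown, hpos, mem_arcs]
  have hT := h.table n (.inl rfl)
  rw [Table, h1, h2, bag_self] at hT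
  have hN : 0 < Γ.N := Nat.pow_pos (by omega)
  have hle : ∀ x ∈ degSet (arcs Γ.G Γ.pos), row n 0 ≤ ∑ v, if Γ.d < x v then Γ.w v else 0 :=
    fun x hx => hT.le_cost 0 _ hN ⟨x, hx, by simp [code]⟩
  refine ⟨?_, hle⟩
  have hne : ∃ x, x ∈ degSet (arcs Γ.G Γ.pos) :=
    ⟨_, (Set.mem_finsetSum _ _ _).2 ⟨fun e => Pi.single e.1 1, fun {e} _ => by simp, rfl⟩⟩
  obtain ⟨x, hx⟩ := hne
  have hlt : row n 0 < Γ.top := by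
    refine ((hle x hx).trans (Finset.sum_le_sum fun v _ => ?_)).trans_lt htop
    split_ifs <;> simp
  obtain ⟨c, hc, y, hy, hyc⟩ := hT.sound 0 hN hlt
  simp only [Prod.mk.injEq] at hyc
  refine ⟨y, hy, le_antisymm (hle y hy) ?_⟩
  rw [hyc.2]; exact hc

theorem Inv.eq_of_mem_bag {i p : ℕ} {v : Fin n} (hv : Γ.pos v = i) (hp : Γ.Alive i p)
    (h : v ∈ Γ.bag p) : p = v := by
  rcases hp with rfl | ⟨u, rfl, hu⟩
  · simp [bag_self] at h
  · rw [bag_coe, Finset.mem_insert, mem_later] at h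
    rcases h with rfl | h
    · rfl
    · omega

/-- Adding one edge from the current vertex `v` to a later neighbour. -/
theorem Inv.edge {i : ℕ} {owner : Fin n → ℕ} {v u : Fin n} (hv : Γ.pos v = i)
    (hu : u ∈ Γ.later v) {A F T : ℕ → ℕ} {R : Set (Fin n → ℕ)}
    (hA : Γ.Table A (Γ.subtree owner i v) (Γ.bag v) R)
    (hF : IsTable Γ.N Γ.top F {((2 * Γ.d + 3) ^ Γ.col v, 0), ((2 * Γ.d + 3) ^ Γ.col u, 0)})
    (hT : Γ.IsConv A F T) :
    Γ.Table T (Γ.subtree owner i v) (Γ.bag v) (R + edgeSet v u) := by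
  have huv := mem_later.1 hu
  have h := IsTable.join (S' := ∅) (B' := {v, u}) (R' := edgeSet v u)
    (bag_injOn (i := i) (.inr ⟨v, rfl, hv.ge⟩)) (fun u _ => Γ.col_lt u) hA
    (IsTable.edge huv.1.ne hF) hT ?_ (by simp) (by simp) ?_
  · simpa [Table, N] using h
  · rw [bag_coe]
    intro a ha
    simp only [Finset.mem_insert, Finset.mem_singleton] at ha ⊢
    rcases ha with rfl | rfl
    · exact .inl rfl
    · exact .inr hu
  · have hz : ∀ x ∈ edgeSet v u, ∀ a, a ≠ v → a ≠ u → x a = 0 := by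
      intro x hx a hav hau
      rcases hx with rfl | hx
      · simp [hav]
      · rw [Set.mem_singleton_iff] at hx
        simp [hx, hau]
    refine fun x hx => ⟨fun a ha => hz x hx a ?_ ?_, fun a _ ha => hz x hx a ?_ ?_⟩
    · rintro rfl; rw [mem_subtree] at ha; omega
    · rintro rfl; rw [mem_subtree] at ha; omega
    · rintro rfl; simp at ha
    · rintro rfl; simp at ha

/-- Eliminating `v`: its table, with `v` removed from the bag, is joined to the table of its
parent `p`, which is its first later neighbour, or the root `n` if there is none. -/
theorem Inv.step {i p : ℕ} {row row' : ℕ → ℕ → ℕ} {owner : Fin n → ℕ} (h : Γ.Inv i row owner)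
    {v : Fin n} (hv : Γ.pos v = i) {F : ℕ → ℕ}
    (hF : Γ.Table F (insert v (Γ.subtree owner i v)) ((Γ.bag v).erase v)
      (degSet (Γ.subArcs owner i v) + ∑ u ∈ Γ.later v, edgeSet v u))
    (hp : (p = n ∧ Γ.later v = ∅) ∨ ∃ u ∈ Γ.later v, p = u ∧ ∀ u' ∈ Γ.later v, Γ.pos u ≤ Γ.pos u')
    (hT : Γ.IsConv (row p) F (row' p))
    (hrow : ∀ p', p' ≠ p → Γ.Alive (i + 1) p' → ∀ m < Γ.N, row' p' m = row p' m) :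
    ∃ owner', Γ.Inv (i + 1) row' owner' := by
  classical
  have hpA : Γ.Alive (i + 1) p := by
    rcases hp with hp | ⟨u, hu, rfl, _⟩
    · exact .inl hp.1
    · exact .inr ⟨u, rfl, by rw [mem_later] at hu; omega⟩
  have hsucc : ∀ p', Γ.Alive (i + 1) p' → p' ≠ v ∧ Γ.Alive i p' := by
    rintro p' (rfl | ⟨u, rfl, hu⟩)
    · exact ⟨v.2.ne', .inl rfl⟩
    · refine ⟨fun h => ?_, .inr ⟨u, rfl, by omega⟩⟩
      rw [Fin.ext h] at hu; omega
  have hpv : p ≠ v := (hsucc p hpA).1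
  -- The parent's bag contains all later neighbours of `v`.
  have hlater : ∀ u ∈ Γ.later v, u ∈ Γ.bag p := by
    intro u hu
    rcases hp with ⟨_, hp⟩ | ⟨u₀, hu₀, rfl, hmin⟩
    · simp [hp] at hu
    · rw [bag_coe, Finset.mem_insert, mem_later]
      by_cases huu : u = u₀
      · exact .inl huu
      · have hle := hmin u hu
        have hne : Γ.pos u₀ ≠ Γ.pos u := fun h => huu (Γ.pos_inj h).symm
        rw [mem_later] at hu hu₀
        exact .inr ⟨Γ.peo v u₀ u hu₀.1 hu.1 hu₀.2 hu.2 (Ne.symm huu), by omega⟩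
  have hbagpos : ∀ a ∈ Γ.bag p, i < Γ.pos a := by
    intro a ha
    rcases hpA with rfl | ⟨u, rfl, hu⟩
    · simp [bag_self] at ha
    · rw [bag_coe, Finset.mem_insert, mem_later] at ha
      rcases ha with rfl | ha <;> omega
  have hposv : ∀ a, Γ.pos a = i → a = v := fun a ha => Γ.pos_inj (ha.trans hv.symm)
  set owner' : Fin n → ℕ := fun a => if owner a = v ∨ a = v then p else owner a with hown
  have hownv : owner' v = p := by simp [hown]
  have hown_of : ∀ a, owner a = v → owner' a = p := fun a ha => by simp [hown, ha]
  have hown_ne : ∀ a, owner a ≠ v → a ≠ v → owner' a = owner a := fun a h1 h2 => by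
    simp [hown, h1, h2]
  have hne_v : ∀ a, Γ.pos a < i → a ≠ v := by rintro a ha rfl; omega
  -- `v` lies above `a` in the elimination tree if it is a later neighbour of `a`.
  have hown_later : ∀ a, v ∈ Γ.later a → owner a = v := by
    intro a ha
    have hlt : Γ.pos a < i := by rw [mem_later] at ha; omega
    exact Inv.eq_of_mem_bag hv (h.alive a hlt) (h.mem_bag a v hlt ha hv.ge)
  refine ⟨owner', ?_, ?_, ?_, ?_⟩
  · intro a ha
    by_cases hav : owner a = v ∨ a = v
    · simpa [hown, hav] using hpA
    · push Not at hav
      have hlt : Γ.pos a < i := by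
        have : Γ.pos a ≠ i := fun h => hav.2 (hposv a h)
        omega
      rw [hown_ne a hav.1 hav.2]
      rcases h.alive a hlt with h' | ⟨u, hu, hu'⟩
      · exact .inl h'
      · refine .inr ⟨u, hu, ?_⟩
        have : Γ.pos u ≠ i := fun h => hav.1 (hu.trans (by rw [hposv u h]))
        omega
  · intro a u ha hu hiu
    by_cases hav : a = v
    · rw [hav, hownv]; exact hlater u (hav ▸ hu)
    · have hlt : Γ.pos a < i := by
        have : Γ.pos a ≠ i := fun h => hav (hposv a h)
        omega
      have hb := h.mem_bag a u hlt hu (by omega)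
      by_cases ho : owner a = v
      · rw [hown_of a ho]
        rw [ho, bag_coe, Finset.mem_insert] at hb
        rcases hb with rfl | hb
        · omega
        · exact hlater u hb
      · rwa [hown_ne a ho hav]
  · intro a u ha hu hui
    have hlt : Γ.pos a < i := by rw [mem_later] at hu; omega
    by_cases huv : u = v
    · subst huv
      rw [hownv, hown_of a (hown_later a hu)]
    · have hlt' : Γ.pos u < i := by
        have : Γ.pos u ≠ i := fun h => huv (hposv u h)
        omega
      have := h.owner_eq a u hlt hu hlt'
      simp [hown, this, huv, hne_v a hlt]
  · intro p' hp'
    obtain ⟨hp'v, hp'A⟩ := hsucc p' hp'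
    by_cases hpp : p' = p
    · subst hpp
      have hS : Γ.subtree owner' (i + 1) p' =
          Γ.subtree owner i p' ∪ insert v (Γ.subtree owner i v) := by
        ext a
        simp only [Finset.mem_union, Finset.mem_insert, mem_subtree]
        by_cases hav : a = v
        · subst hav; simp [hownv, hv]
        · have : Γ.pos a < i + 1 ↔ Γ.pos a < i := by
            have : Γ.pos a ≠ i := fun h => hav (hposv a h)
            omega
          by_cases ho : owner a = v
          · simp [hown_of a ho, this, ho, hav]
            tauto
          · simp [hown_ne a ho hav, this, ho, hav]
      set Ev := (Γ.later v).map ⟨fun u => (v, u), fun _ _ h => (Prod.ext_iff.1 h).2⟩ with hEv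
      have hmemEv : ∀ a u, (a, u) ∈ Ev ↔ a = v ∧ u ∈ Γ.later v := by
        intro a u
        rw [hEv, Finset.mem_map]
        constructor
        · rintro ⟨u', hu', h⟩
          obtain ⟨rfl, rfl⟩ := Prod.mk.inj h
          exact ⟨rfl, hu'⟩
        · rintro ⟨rfl, hu⟩; exact ⟨u, hu, rfl⟩
      have hE : Γ.subArcs owner' (i + 1) p' =
          Γ.subArcs owner i p' ∪ (Γ.subArcs owner i v ∪ Ev) := by
        ext ⟨a, u⟩
        have := congrArg (a ∈ ·) hS
        simp only [Finset.mem_union, Finset.mem_insert, mem_subtree, eq_iff_iff] at this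
        simp only [Finset.mem_union, mem_subArcs, hmemEv, this]
        constructor
        · rintro ⟨hu, h | rfl | h⟩
          · exact .inl ⟨hu, h⟩
          · exact .inr (.inr ⟨rfl, hu⟩)
          · exact .inr (.inl ⟨hu, h⟩)
        · rintro (⟨hu, h⟩ | ⟨hu, h⟩ | ⟨rfl, hu⟩)
          · exact ⟨hu, .inl h⟩
          · exact ⟨hu, .inr (.inr h)⟩
          · exact ⟨hu, .inr (.inl rfl)⟩
      have hdisj₁ : Disjoint (Γ.subArcs owner i v) Ev := by
        rw [Finset.disjoint_left]
        rintro ⟨a, u⟩ h1 h2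
        rw [mem_subArcs] at h1
        exact hne_v a h1.2.1 ((hmemEv a u).1 h2).1
      have hdisj₂ : Disjoint (Γ.subArcs owner i p') (Γ.subArcs owner i v ∪ Ev) := by
        rw [Finset.disjoint_left]
        rintro ⟨a, u⟩ h1 h2
        rw [mem_subArcs] at h1
        rcases Finset.mem_union.1 h2 with h2 | h2
        · rw [mem_subArcs] at h2
          exact hp'v (h1.2.2.symm.trans h2.2.2)
        · exact hne_v a h1.2.1 ((hmemEv a u).1 h2).1
      have hR' : degSet (Γ.subArcs owner i v) + ∑ u ∈ Γ.later v, edgeSet v u =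
          degSet (Γ.subArcs owner i v ∪ Ev) := by
        rw [degSet, degSet, Finset.sum_union hdisj₁, hEv, Finset.sum_map]
        rfl
      have hR : degSet (Γ.subArcs owner' (i + 1) p') =
          degSet (Γ.subArcs owner i p') + degSet (Γ.subArcs owner i v ∪ Ev) := by
        rw [hE, degSet, Finset.sum_union hdisj₂]
        rfl
      rw [hR'] at hF
      rw [Table, hS, hR]
      refine IsTable.join (bag_injOn hp'A) (fun u _ => Γ.col_lt u) (h.table p' hp'A) hF hT ?_ ?_ ?_ ?_
      · intro a ha
        rw [bag_coe, Finset.mem_erase, Finset.mem_insert] at ha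
        exact hlater a (ha.2.resolve_left ha.1)
      · rw [Finset.disjoint_left]
        intro a h1 h2
        rw [mem_subtree] at h1
        rw [Finset.mem_insert, mem_subtree] at h2
        rcases h2 with rfl | h2
        · exact absurd rfl (hne_v _ h1.1)
        · exact hp'v (h1.2.symm.trans h2.2)
      · intro x hx a ha
        refine degSet_eq_zero hx ?_
        rintro ⟨b, u⟩ he
        rw [mem_subArcs] at he
        rw [Finset.mem_insert, mem_subtree] at ha
        constructor
        · rintro rfl
          rcases ha with ha | ha
          · exact hne_v _ he.2.1 ha
          · exact hp'v (he.2.2.symm.trans ha.2)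
        · rintro rfl
          rcases ha with rfl | ha
          · exact hp'v (he.2.2.symm.trans (hown_later b he.1))
          · exact hp'v (he.2.2.symm.trans ((h.owner_eq b a he.2.1 he.1 ha.1).symm.trans ha.2))
      · refine fun x hx => ⟨fun a ha => degSet_eq_zero hx ?_, fun a ha hb => degSet_eq_zero hx ?_⟩
        · rintro ⟨b, u⟩ he
          rw [mem_subtree] at ha
          rcases Finset.mem_union.1 he with he | he
          · rw [mem_subArcs] at he
            constructor
            · rintro rfl
              exact hp'v (ha.2.symm.trans he.2.2)
            · rintro rfl
              exact hp'v (ha.2.symm.trans ((h.owner_eq b a he.2.1 he.1 ha.1).trans he.2.2))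
          · obtain ⟨rfl, hu⟩ := (hmemEv b u).1 he
            rw [mem_later] at hu
            constructor
            · rintro rfl; omega
            · rintro rfl; omega
        · have hia := hbagpos a ha
          rw [bag_coe, Finset.mem_erase, Finset.mem_insert] at hb
          have hav : a ≠ v := by rintro rfl; omega
          rintro ⟨b, u⟩ he
          rcases Finset.mem_union.1 he with he | he
          · rw [mem_subArcs] at he
            constructor
            · rintro rfl; omega
            · rintro rfl
              have := h.mem_bag b a he.2.1 he.1 hia.le
              rw [he.2.2, bag_coe, Finset.mem_insert] at this
              exact hb ⟨hav, this⟩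
          · obtain ⟨rfl, hu⟩ := (hmemEv b u).1 he
            constructor
            · rintro rfl; omega
            · rintro rfl
              exact hb ⟨hav, .inr hu⟩
    · have hS : Γ.subtree owner' (i + 1) p' = Γ.subtree owner i p' := by
        ext a
        simp only [mem_subtree]
        by_cases hav : a = v
        · subst hav; simp [hownv, hv, Ne.symm hpp]
        · have : Γ.pos a < i + 1 ↔ Γ.pos a < i := by
            have : Γ.pos a ≠ i := fun h => hav (hposv a h)
            omega
          by_cases ho : owner a = v
          · simp [hown_of a ho, ho, Ne.symm hpp, Ne.symm hp'v]
          · simp [hown_ne a ho hav, this]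
      have hE : Γ.subArcs owner' (i + 1) p' = Γ.subArcs owner i p' := by
        rw [subArcs, hS, subArcs]
      rw [Table, hS, hE]
      exact (h.table p' hp'A).congr (hrow p' hpp hp')

end Elim

/-! ### Registers, arrays and logical expressions

Registers `R_n`, `R_d`, `R_k` and the arrays `A_adj`, `A_out` are the ones prescribed for input and
output. The other constants are the base `R_base = 2 d + 3` of codes, the number `R_q` of colours,
the number `R_N` of codes and its double `R_NN`, the weight `R_big = 2 ^ n`, and infinity `R_top`;
the remaining registers are variables. The arrays hold the multiples of `n` (`A_row`), of `2 ^ n`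
(`A_big`) and of the number of codes (`A_off`), the powers of the base (`A_pow`) and of `2`
(`A_two`), the elimination order (`A_ord`) and its inverse (`A_pos`), the colouring (`A_col`), the
function `capDigits` (`A_cap`), digits of codes (`A_dig`, `A_over`), the tables of all bags, one
after the other (`A_T`), and two auxiliary tables (`A_F`, `A_tmp`). -/

notation "R_n" => (0 : ℕ)
notation "R_d" => (1 : ℕ)
notation "R_k" => (2 : ℕ)
notation "R_base" => (3 : ℕ)
notation "R_two" => (4 : ℕ)
notation "R_rows" => (5 : ℕ)
notation "R_q" => (6 : ℕ)
notation "R_N" => (7 : ℕ)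
notation "R_top" => (8 : ℕ)
notation "R_big" => (9 : ℕ)
notation "R_i" => (10 : ℕ)
notation "R_v" => (11 : ℕ)
notation "R_j" => (12 : ℕ)
notation "R_u" => (13 : ℕ)
notation "R_p" => (14 : ℕ)
notation "R_flag" => (15 : ℕ)
notation "R_a" => (16 : ℕ)
notation "R_b" => (17 : ℕ)
notation "R_off" => (18 : ℕ)
notation "R_idx" => (19 : ℕ)
notation "R_val" => (20 : ℕ)
notation "R_P" => (21 : ℕ)
notation "R_lo" => (22 : ℕ)
notation "R_x" => (23 : ℕ)
notation "R_y" => (24 : ℕ)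
notation "R_m" => (25 : ℕ)
notation "R_acc" => (26 : ℕ)
notation "R_cnt" => (27 : ℕ)
notation "R_NN" => (28 : ℕ)
notation "A_adj" => (0 : ℕ)
notation "A_out" => (1 : ℕ)
notation "A_row" => (2 : ℕ)
notation "A_ord" => (3 : ℕ)
notation "A_pos" => (4 : ℕ)
notation "A_col" => (5 : ℕ)
notation "A_pow" => (6 : ℕ)
notation "A_two" => (7 : ℕ)
notation "A_cap" => (8 : ℕ)
notation "A_dig" => (9 : ℕ)
notation "A_over" => (10 : ℕ)
notation "A_off" => (11 : ℕ)
notation "A_T" => (12 : ℕ)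
notation "A_F" => (13 : ℕ)
notation "A_tmp" => (14 : ℕ)
notation "A_big" => (15 : ℕ)

namespace Expr

/-- The truth value of an expression used as a condition. -/
def Holds (e : Expr) (s : State) : Prop := e.eval s ≠ 0

/-- Logical negation, with value `0` or `1`. -/
def not (e : Expr) : Expr := .less e (.lit 1)

/-- Logical conjunction, with value `0` or `1`. -/
def and (e f : Expr) : Expr := not (.plus e.not f.not)

/-- Equality of two values, with value `0` or `1`. -/
def eq (e f : Expr) : Expr := not (.plus (.less e f) (.less f e))

@[simp] theorem holds_less {e f : Expr} {s : State} :
    (Expr.less e f).Holds s ↔ e.eval s < f.eval s := by simp [Holds, eval]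

@[simp] theorem holds_not {e : Expr} {s : State} : e.not.Holds s ↔ ¬ e.Holds s := by
  simp [Holds, eval, Expr.not]

@[simp] theorem holds_and {e f : Expr} {s : State} :
    (e.and f).Holds s ↔ e.Holds s ∧ f.Holds s := by
  simp [Holds, eval, Expr.not, Expr.and]

@[simp] theorem holds_eq {e f : Expr} {s : State} :
    (e.eq f).Holds s ↔ e.eval s = f.eval s := by
  simp [Holds, eval, Expr.not, Expr.eq]; omega

@[simp] theorem holds_reg {x : ℕ} {s : State} : (reg x).Holds s ↔ s.reg x ≠ 0 := Iff.rfl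

@[simp] theorem holds_cell {a : ℕ} {i : Expr} {s : State} :
    (cell a i).Holds s ↔ s.arr a (i.eval s) ≠ 0 := Iff.rfl

attribute [simp] eval

end Expr

attribute [simp] writeCell_arr

theorem Ensures.cond {B : ℕ} {p q : Prog} {s : State} {Q : State → Prop} {e : Expr}
    (h₁ : e.Holds s → Ensures B p s Q) (h₂ : ¬ e.Holds s → Ensures B q s Q) :
    Ensures B (.ite e p q) s Q :=
  Ensures.ite h₁ fun h => h₂ (not_not_intro h)

open OrientableDeletion.Prog OrientableDeletion.Expr

/-! ### Multiples and powers -/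

/-- Fills array `a` with the multiples `0, …, n` of the number in register `r`. -/
def multiples (a r : ℕ) : Prog :=
  .forUp R_i R_n (.setCell a (.plus (.reg R_i) (.lit 1)) (.plus (.cell a (.reg R_i)) (.reg r)))

theorem multiples_spec {B a r : ℕ} {s : State} (hr : r ≠ R_i) (h0 : s.arr a 0 = 0)
    (hB : s.reg R_n ≤ B) :
    Ensures B (multiples a r) s fun s' => ∀ i ≤ s.reg R_n, s'.arr a i = i * s.reg r := by
  refine Ensures.forUp (fun i s' => ∀ j ≤ i, s'.arr a j = j * s.reg r) rfl hB rfl rfl ?_ ?_ ?_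
  · intro j hj
    obtain rfl : j = 0 := by omega
    simpa using h0
  · intro i s' _ hF hi hI
    refine Ensures.setCell fun j hj => ?_
    have hfr : s'.reg r = s.reg r := hF.reg r (by simp [forUp, writesReg, hr])
    simp only [Expr.eval, hi, writeReg_arr, writeCell_arr, if_true, hfr, Function.update_apply]
    split_ifs with h
    · rw [h, hI i le_rfl, Nat.succ_mul]
    · exact hI j (by omega)
  · exact fun s' _ h => h

/-- Fills array `a` with the powers `0, …, n` of the number in register `r`. -/
def powers (a r : ℕ) : Prog :=
  .seq (.setCell a (.lit 0) (.lit 1)) <|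
  .forUp R_i R_n <|
    .seq (.setReg R_acc (.lit 0)) <|
    .seq (.forUp R_x r (.setReg R_acc (.plus (.reg R_acc) (.cell a (.reg R_i)))))
      (.setCell a (.plus (.reg R_i) (.lit 1)) (.reg R_acc))

theorem powers_spec {B a r : ℕ} {s : State} (h1 : r ≠ R_i) (h2 : r ≠ R_acc) (h3 : r ≠ R_x)
    (hB : s.reg R_n ≤ B) (hB' : s.reg r ≤ B) :
    Ensures B (powers a r) s fun s' => ∀ i ≤ s.reg R_n, s'.arr a i = s.reg r ^ i := by
  refine Ensures.seq (Ensures.setCell ?_)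
  refine Ensures.forUp (fun i s' => ∀ j ≤ i, s'.arr a j = s.reg r ^ j) rfl hB rfl rfl ?_ ?_ ?_
  · intro j hj
    obtain rfl : j = 0 := by omega
    simp
  · intro i s' _ hF hi hI
    have hfr : s'.reg r = s.reg r := hF.reg r (by simp [forUp, writesReg, h1, h2, h3])
    refine Ensures.seq (Ensures.setReg (Ensures.seq ?_))
    refine Ensures.forUp (M := s.reg r) (fun x s'' => s''.reg R_acc = x * s.reg r ^ i)
      (by simp [hfr, h2]) hB' rfl (by simp [forUp, writesReg, h2, h3]) (by simp) ?_ ?_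
    · intro x s'' _ hF' _ hI'
      refine Ensures.setReg ?_
      have e1 : s''.reg R_i = i := (hF'.reg R_i rfl).trans (by simp [hi])
      have e2 : s''.arr a = s'.arr a := hF'.arr a rfl
      simp [e1, e2, hI', hI i le_rfl, Nat.succ_mul]
    · intro s'' hF' hI'
      refine Ensures.setCell fun j hj => ?_
      have e1 : s''.reg R_i = i := (hF'.reg R_i rfl).trans (by simp [hi])
      have e2 : s''.arr a = s'.arr a := hF'.arr a rfl
      simp only [Expr.eval, e1, writeReg_arr, writeCell_arr, if_true, e2, hI',
        Function.update_apply]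
      split_ifs with h
      · rw [h, pow_succ, mul_comm]
      · exact hI j (by omega)
  · exact fun s' _ h => h

/-! ### Computing a perfect elimination order -/

/-- The state holds the number of vertices, the adjacency matrix of `G` and the offsets of its
rows. -/
structure HasGraph {n : ℕ} (G : SimpleGraph (Fin n)) (s : State) : Prop where
  reg_n : s.reg R_n = n
  row : ∀ u : Fin n, s.arr A_row u = u * n
  adj : ∀ u v : Fin n, s.arr A_adj (u * n + v) ≠ 0 ↔ G.Adj u v

theorem HasGraph.congr {n : ℕ} {G : SimpleGraph (Fin n)} {s s' : State} (h : HasGraph G s)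
    (h1 : s'.reg R_n = s.reg R_n) (h2 : s'.arr A_adj = s.arr A_adj)
    (h3 : s'.arr A_row = s.arr A_row) : HasGraph G s' :=
  ⟨h1 ▸ h.reg_n, h3 ▸ h.row, h2 ▸ h.adj⟩

theorem HasGraph.frame {n : ℕ} {G : SimpleGraph (Fin n)} {s s' : State} (h : HasGraph G s)
    {p : Prog} (hF : Frame p s s') (h1 : p.writesReg R_n = false) (h2 : p.writesArr A_adj = false)
    (h3 : p.writesArr A_row = false) : HasGraph G s' :=
  h.congr (hF.reg _ h1) (hF.arr _ h2) (hF.arr _ h3)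

/-- Adjacency of the vertices in registers `x` and `y`. -/
def adjE (x y : ℕ) : Expr := .cell A_adj (.plus (.cell A_row (.reg x)) (.reg y))

theorem HasGraph.holds_adjE {n : ℕ} {G : SimpleGraph (Fin n)} {s : State} (h : HasGraph G s)
    {x y : ℕ} {u v : Fin n} (hu : s.reg x = u) (hv : s.reg y = v) :
    (adjE x y).Holds s ↔ G.Adj u v := by
  rw [← h.adj, ← h.row, adjE]
  simp [hu, hv]

/-- The first `i` entries of a perfect elimination order. Vertices that are not yet ordered have
rank `0`, the others have rank one more than their position. -/
structure PartialPeo {n : ℕ} (G : SimpleGraph (Fin n)) (i : ℕ) (ord rank : ℕ → ℕ) : Prop where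
  rank_le : ∀ v : Fin n, rank v ≤ i
  ord : ∀ j < i, ∃ v : Fin n, ord j = v ∧ rank v = j + 1
  inj : ∀ v v' : Fin n, rank v = rank v' → rank v ≠ 0 → v = v'
  simplicial : ∀ v a b : Fin n, rank v ≠ 0 → G.Adj v a → G.Adj v b →
    (rank a = 0 ∨ rank v < rank a) → (rank b = 0 ∨ rank v < rank b) → a ≠ b → G.Adj a b

/-- `v` can be eliminated next. -/
def IsNext {n : ℕ} (G : SimpleGraph (Fin n)) (rank : ℕ → ℕ) (v : Fin n) : Prop :=
  rank v = 0 ∧ ∀ a b : Fin n, rank a = 0 → rank b = 0 → G.Adj v a → G.Adj v b → a ≠ b → G.Adj a b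

theorem PartialPeo.exists_next {n : ℕ} {G : SimpleGraph (Fin n)} (hG : IsChordal G) {i : ℕ}
    {ord rank : ℕ → ℕ} (h : PartialPeo G i ord rank) (hi : i < n) : ∃ v, IsNext G rank v := by
  have hne : (Finset.univ.filter fun v : Fin n => rank v = 0).Nonempty := by
    by_contra hcon
    rw [Finset.not_nonempty_iff_eq_empty, Finset.filter_eq_empty_iff] at hcon
    have hcard : (Finset.univ : Finset (Fin n)).card ≤ (Finset.Icc 1 i).card := by
      refine Finset.card_le_card_of_injOn (fun v => rank v) (fun v _ => ?_) fun v _ v' _ hv => ?_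
      · have := h.rank_le v
        have := hcon (Finset.mem_univ v)
        simp only [Finset.coe_Icc, Set.mem_Icc]; omega
      · exact h.inj v v' hv (hcon (Finset.mem_univ v))
    simp at hcard
    omega
  obtain ⟨v, hv, hs⟩ := hG.exists_simplicial _ hne
  simp only [Finset.mem_filter, Finset.mem_univ, true_and] at hv hs
  exact ⟨v, hv, fun a b ha hb hva hvb hab => hs a ha b hb hva hvb hab⟩

theorem PartialPeo.extend {n : ℕ} {G : SimpleGraph (Fin n)} {i : ℕ} {ord rank : ℕ → ℕ}
    (h : PartialPeo G i ord rank) {v : Fin n} (hv : IsNext G rank v) :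
    PartialPeo G (i + 1) (Function.update ord i v) (Function.update rank v (i + 1)) := by
  have hup : ∀ a : Fin n, Function.update rank v (i + 1) a = if a = v then i + 1 else rank a := by
    intro a
    rw [Function.update_apply]
    simp only [Fin.ext_iff]
  refine ⟨fun a => ?_, fun j hj => ?_, fun a b hab ha => ?_, fun c a b hc hca hcb ha hb hab => ?_⟩
  · rw [hup]; split_ifs
    · exact le_rfl
    · exact (h.rank_le a).trans (Nat.le_succ i)
  · by_cases hji : j = i
    · exact ⟨v, by simp [hji], by simp [hji]⟩
    · obtain ⟨a, ha, ha'⟩ := h.ord j (by omega)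
      refine ⟨a, by rw [Function.update_of_ne hji, ha], ?_⟩
      rw [hup, if_neg, ha']
      rintro rfl
      rw [hv.1] at ha'; omega
  · rw [hup, hup] at hab
    rw [hup] at ha
    have := h.rank_le a
    have := h.rank_le b
    split_ifs at hab ha with h1 h2 h2
    · exact h1.trans h2.symm
    · omega
    · omega
    · exact h.inj a b hab ha
  · rw [hup] at hc ha hb
    rw [hup] at ha hb
    have hai := h.rank_le a
    have hbi := h.rank_le b
    by_cases hcv : c = v
    · subst hcv
      have hac : a ≠ c := hca.ne'
      have hbc : b ≠ c := hcb.ne'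
      rw [if_neg hac, if_pos rfl] at ha
      rw [if_neg hbc, if_pos rfl] at hb
      exact hv.2 a b (by omega) (by omega) hca hcb hab
    · rw [if_neg hcv] at hc ha hb
      refine h.simplicial c a b hc hca hcb ?_ ?_ hab
      · by_cases hav : a = v
        · exact .inl (hav ▸ hv.1)
        · simpa [hav] using ha
      · by_cases hbv : b = v
        · exact .inl (hbv ▸ hv.1)
        · simpa [hbv] using hb

/-- Clears the flag if two neighbours of `v` that are not yet ordered are not adjacent. -/
def testSimplicial : Prog :=
  .seq (.setReg R_flag (.lit 1)) <|
  .forUp R_a R_n <| .forUp R_b R_n <|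
    .ite ((Expr.cell A_pos (.reg R_a)).not.and <| (Expr.cell A_pos (.reg R_b)).not.and <|
        (adjE R_v R_a).and <| (adjE R_v R_b).and <|
        ((Expr.reg R_a).eq (.reg R_b)).not.and (adjE R_a R_b).not)
      (.setReg R_flag (.lit 0)) .skip

theorem testSimplicial_spec {n B : ℕ} {G : SimpleGraph (Fin n)} {s : State} (hs : HasGraph G s)
    (hB : n ≤ B) {v : Fin n} (hv : s.reg R_v = v) (hr : s.arr A_pos v = 0) :
    Ensures B testSimplicial s fun s' => s'.reg R_flag ≠ 0 ↔ IsNext G (s.arr A_pos) v := by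
  set bad : Fin n → Fin n → Prop := fun a b => s.arr A_pos a = 0 ∧ s.arr A_pos b = 0 ∧
    G.Adj v a ∧ G.Adj v b ∧ a ≠ b ∧ ¬ G.Adj a b with hbad
  refine Ensures.seq (Ensures.setReg ?_)
  refine Ensures.forUp (M := n)
    (fun i s' => s'.reg R_flag ≠ 0 ↔ ∀ a b : Fin n, (a : ℕ) < i → ¬ bad a b)
    (by simp [hs.reg_n]) hB rfl rfl (by simp) ?_ ?_
  · intro i s₁ hi hF hia hI
    refine Ensures.forUp (M := n) (fun j s' => s'.reg R_flag ≠ 0 ↔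
        (∀ a b : Fin n, (a : ℕ) < i → ¬ bad a b) ∧ ∀ b : Fin n, (b : ℕ) < j → ¬ bad ⟨i, hi⟩ b)
      ((hF.reg R_n rfl).trans (by simp [hs.reg_n])) hB rfl rfl (by simpa using hI) ?_ ?_
    · intro j s₂ hj hF' hjb hI'
      have hs₂ : HasGraph G s₂ :=
        ((hs.congr (s' := s.writeReg R_flag 1) (by simp) rfl rfl).frame hF rfl rfl rfl).frame hF'
          rfl rfl rfl
      have e1 : s₂.reg R_v = v := (hF'.reg R_v rfl).trans ((hF.reg R_v rfl).trans (by simp [hv]))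
      have e2 : s₂.reg R_a = (⟨i, hi⟩ : Fin n) := (hF'.reg R_a rfl).trans hia
      have e3 : s₂.reg R_b = (⟨j, hj⟩ : Fin n) := hjb
      have e4 : s₂.arr A_pos = s.arr A_pos := (hF'.arr _ rfl).trans (hF.arr _ rfl)
      have hsplit : (∀ b : Fin n, (b : ℕ) < j + 1 → ¬ bad ⟨i, hi⟩ b) ↔
          (∀ b : Fin n, (b : ℕ) < j → ¬ bad ⟨i, hi⟩ b) ∧ ¬ bad ⟨i, hi⟩ ⟨j, hj⟩ := by
        constructor
        · exact fun h => ⟨fun b hb => h b (by omega), h ⟨j, hj⟩ (Nat.lt_succ_self j)⟩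
        · rintro ⟨h1, h2⟩ b hb
          by_cases hbj : (b : ℕ) = j
          · rwa [show b = ⟨j, hj⟩ from Fin.ext hbj]
          · exact h1 b (by omega)
      have hcond : ∀ (e : Expr), e = ((Expr.cell A_pos (.reg R_a)).not.and <|
            (Expr.cell A_pos (.reg R_b)).not.and <|
            (adjE R_v R_a).and <| (adjE R_v R_b).and <|
            ((Expr.reg R_a).eq (.reg R_b)).not.and (adjE R_a R_b).not) →
          (e.Holds s₂ ↔ bad ⟨i, hi⟩ ⟨j, hj⟩) := by
        rintro e rfl
        simp [hs₂.holds_adjE e1 e2, hs₂.holds_adjE e1 e3, hs₂.holds_adjE e2 e3, e2, e3, e4, hbad]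
      refine Ensures.cond (fun h => Ensures.setReg ?_) (fun h => Ensures.skip ?_)
      · rw [hcond _ rfl] at h
        simp only [writeReg_reg]
        rw [hsplit]
        simp [h]
      · rw [hcond _ rfl] at h
        simp only [writeReg_reg]
        rw [hsplit]
        simpa [h] using hI'
    · intro s₂ _ hI'
      simp only [writeReg_reg]
      simp only [show ¬ (R_flag = R_a) by decide, if_false]
      rw [hI']
      constructor
      · rintro ⟨h1, h2⟩ a b ha
        by_cases hai : (a : ℕ) = i
        · rw [show a = ⟨i, hi⟩ from Fin.ext hai]; exact h2 b b.2
        · exact h1 a b (by omega)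
      · exact fun h => ⟨fun a b ha => h a b (by omega), fun b _ => h _ b (Nat.lt_succ_self i)⟩
  · intro s' _ h
    rw [h, IsNext]
    simp only [hr, true_and, hbad]
    constructor
    · intro h a b ha hb hva hvb hab
      by_contra hcon
      exact h a b a.2 ⟨ha, hb, hva, hvb, hab, hcon⟩
    · rintro h a b _ ⟨ha, hb, hva, hvb, hab, hcon⟩
      exact hcon (h a b ha hb hva hvb hab)

/-- Orders the vertices by repeatedly removing a simplicial vertex. -/
def elimOrder : Prog :=
  .forUp R_i R_n <|
    .seq (.setReg R_p (.reg R_n)) <|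
    .seq (.forUp R_v R_n <|
      .ite (Expr.cell A_pos (.reg R_v)).not
        (.seq testSimplicial (.ite (.reg R_flag) (.setReg R_p (.reg R_v)) .skip)) .skip) <|
    .seq (.setCell A_pos (.reg R_p) (.plus (.reg R_i) (.lit 1)))
      (.setCell A_ord (.reg R_i) (.reg R_p))

/-- The arrays hold a perfect elimination order: position `pos v` plus one for each vertex `v`, and
the list of the vertices by position. -/
structure HasOrder {n : ℕ} (pos : Fin n → ℕ) (s : State) : Prop where
  rank_eq : ∀ v : Fin n, s.arr A_pos v = pos v + 1
  ord_eq : ∀ j < n, ∃ v : Fin n, s.arr A_ord j = v ∧ pos v = j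

theorem elimOrder_spec {n B : ℕ} {G : SimpleGraph (Fin n)} (hG : IsChordal G) {s : State}
    (hs : HasGraph G s) (hB : n ≤ B) (h0 : ∀ v : Fin n, s.arr A_pos v = 0) :
    Ensures B elimOrder s fun s' => ∃ pos : Fin n → ℕ, Function.Injective pos ∧
      (∀ v, pos v < n) ∧ HasOrder pos s' ∧
      ∀ v a b, G.Adj v a → G.Adj v b → pos v < pos a → pos v < pos b → a ≠ b → G.Adj a b := by
  refine Ensures.forUp (M := n) (fun i s' => PartialPeo G i (s'.arr A_ord) (s'.arr A_pos))
    hs.reg_n hB rfl rfl ?_ ?_ ?_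
  · exact ⟨fun v => by simp [h0], fun j hj => absurd hj (Nat.not_lt_zero j),
      fun v _ _ h => absurd (h0 v) (by simpa using h),
      fun v _ _ h => absurd (h0 v) (by simpa using h)⟩
  · intro i s₁ hi hF hri hI
    have hs₁ : HasGraph G s₁ := hs.frame hF rfl rfl rfl
    refine Ensures.seq (Ensures.setReg (Ensures.seq ?_))
    refine Ensures.forUp (M := n) (fun j s' =>
        ((∃ v : Fin n, (v : ℕ) < j ∧ IsNext G (s₁.arr A_pos) v) → s'.reg R_p ≠ n) ∧
        (s'.reg R_p ≠ n → ∃ v : Fin n, s'.reg R_p = v ∧ IsNext G (s₁.arr A_pos) v))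
      (by simp [hs₁.reg_n]) hB rfl rfl (by simp [hs₁.reg_n]) ?_ ?_
    · intro j s₂ hj hF' hrj hI'
      have hs₂ : HasGraph G s₂ :=
        (hs₁.congr (s' := s₁.writeReg R_p _) (by simp) rfl rfl).frame hF' rfl rfl rfl
      have e4 : s₂.arr A_pos = s₁.arr A_pos := hF'.arr _ rfl
      have e1 : s₂.reg R_v = (⟨j, hj⟩ : Fin n) := hrj
      have hnot : ¬ IsNext G (s₁.arr A_pos) ⟨j, hj⟩ →
          (∃ v : Fin n, (v : ℕ) < j + 1 ∧ IsNext G (s₁.arr A_pos) v) → s₂.reg R_p ≠ n := by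
        rintro h ⟨v, hv, hv'⟩
        refine hI'.1 ⟨v, ?_, hv'⟩
        have : (v : ℕ) ≠ j := fun hvj => h ((Fin.ext hvj : v = ⟨j, hj⟩) ▸ hv')
        omega
      refine Ensures.cond (fun h => Ensures.seq ?_) (fun h => Ensures.skip ?_)
      · rw [holds_not, holds_cell, not_not] at h
        refine (testSimplicial_spec hs₂ hB e1 (by simpa [hrj] using h)).mono fun s₃ hF₃ h₃ => ?_
        have e5 : s₃.reg R_v = j := (hF₃.reg _ rfl).trans hrj
        have e6 : s₃.reg R_p = s₂.reg R_p := hF₃.reg _ rfl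
        rw [e4] at h₃
        refine Ensures.cond (fun h => Ensures.setReg ?_) (fun h => Ensures.skip ?_)
        · rw [holds_reg, h₃] at h
          simp only [writeReg_reg, eval, e5]
          exact ⟨fun _ => hj.ne, fun _ => ⟨⟨j, hj⟩, rfl, h⟩⟩
        · rw [holds_reg, h₃] at h
          simpa [e6] using ⟨by simpa using hnot h, hI'.2⟩
      · have h' : ¬ IsNext G (s₁.arr A_pos) ⟨j, hj⟩ := by
          intro h''
          have := h''.1
          rw [holds_not, not_not, holds_cell, e4] at h
          simp only [eval, hrj] at h
          exact h this
        simpa using ⟨by simpa using hnot h', hI'.2⟩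
    · intro s₂ hF' hI'
      obtain ⟨v, hv⟩ := hI.exists_next hG hi
      obtain ⟨v, hv, hv'⟩ := hI'.2 (hI'.1 ⟨v, v.2, hv⟩)
      refine Ensures.seq (Ensures.setCell (Ensures.setCell ?_))
      have e1 : s₂.arr A_pos = s₁.arr A_pos := hF'.arr _ rfl
      have e2 : s₂.arr A_ord = s₁.arr A_ord := hF'.arr _ rfl
      have e3 : s₂.reg R_i = i := (hF'.reg _ rfl).trans (by simp [hri])
      have := hI.extend hv'
      simpa [e1, e2, e3, hv] using this
  · intro s' _ h
    -- Every position is taken by a vertex, so every vertex has a position.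
    choose f hf using fun j : Fin n => h.ord j j.2
    have hinj : Function.Injective f := by
      intro j j' hjj
      have h1 := (hf j).2
      have h2 := (hf j').2
      rw [hjj] at h1
      exact Fin.ext (by omega)
    have hne : ∀ v : Fin n, s'.arr A_pos v ≠ 0 := by
      intro v
      obtain ⟨j, rfl⟩ := (Finite.injective_iff_surjective.1 hinj) v
      rw [(hf j).2]; omega
    refine ⟨fun v => s'.arr A_pos v - 1, ?_, ?_, ⟨?_, ?_⟩, ?_⟩
    · intro v v' hvv
      have := hne v
      have := hne v'
      exact h.inj v v' (by simp only at hvv; omega) (hne v)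
    · intro v
      have := hne v
      have := h.rank_le v
      simp only; omega
    · intro v
      have := hne v
      omega
    · intro j hj
      obtain ⟨v, h1, h2⟩ := h.ord j hj
      exact ⟨v, h1, by omega⟩
    · intro v a b hva hvb h1 h2 hab
      have := hne v
      have := hne a
      have := hne b
      dsimp only at h1 h2
      exact h.simplicial v a b (hne v) hva hvb (by omega) (by omega) hab

/-! ### Greedy colouring -/

/-- The vertex in register `u` is a later neighbour of the vertex in register `v`. -/
def laterE : Expr :=
  (adjE R_v R_u).and (.less (.cell A_pos (.reg R_v)) (.cell A_pos (.reg R_u)))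

theorem holds_laterE {n : ℕ} {G : SimpleGraph (Fin n)} {pos : Fin n → ℕ} {s : State}
    (h : HasGraph G s) (h' : ∀ v : Fin n, s.arr A_pos v = pos v + 1) {u v : Fin n}
    (hv : s.reg R_v = v) (hu : s.reg R_u = u) : laterE.Holds s ↔ u ∈ laterNbs G pos v := by
  simp [laterE, h.holds_adjE hv hu, hu, hv, h', mem_laterNbs]

/-- Clears the flag if colour `j` occurs among the later neighbours of `v`. -/
def testColour : Prog :=
  .seq (.setReg R_flag (.lit 1)) <|
  .forUp R_u R_n <|
    .ite (laterE.and ((Expr.cell A_col (.reg R_u)).eq (.reg R_j))) (.setReg R_flag (.lit 0)) .skip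

theorem testColour_spec {n B : ℕ} {G : SimpleGraph (Fin n)} {pos : Fin n → ℕ} {s : State}
    (hs : HasGraph G s) (hpos : ∀ v : Fin n, s.arr A_pos v = pos v + 1) (hB : n ≤ B) {v : Fin n}
    (hv : s.reg R_v = v) :
    Ensures B testColour s fun s' =>
      s'.reg R_flag ≠ 0 ↔ ∀ u ∈ laterNbs G pos v, s.arr A_col u ≠ s.reg R_j := by
  refine Ensures.seq (Ensures.setReg ?_)
  refine Ensures.forUp (M := n) (fun i s' => s'.reg R_flag ≠ 0 ↔
      ∀ u ∈ laterNbs G pos v, (u : ℕ) < i → s.arr A_col u ≠ s.reg R_j)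
    (by simp [hs.reg_n]) hB rfl rfl (by simp) ?_ ?_
  · intro i s₁ hi hF hri hI
    have hs₁ : HasGraph G s₁ := (hs.congr (s' := s.writeReg R_flag 1) (by simp) rfl rfl).frame hF
      rfl rfl rfl
    have e1 : s₁.reg R_v = v := (hF.reg _ rfl).trans (by simp [hv])
    have e2 : s₁.reg R_u = (⟨i, hi⟩ : Fin n) := hri
    have e3 : s₁.arr A_pos = s.arr A_pos := hF.arr _ rfl
    have e4 : s₁.arr A_col = s.arr A_col := hF.arr _ rfl
    have e5 : s₁.reg R_j = s.reg R_j := (hF.reg _ rfl).trans (by simp)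
    have hsplit : (∀ u ∈ laterNbs G pos v, (u : ℕ) < i + 1 → s.arr A_col u ≠ s.reg R_j) ↔
        (∀ u ∈ laterNbs G pos v, (u : ℕ) < i → s.arr A_col u ≠ s.reg R_j) ∧
        ¬ (⟨i, hi⟩ ∈ laterNbs G pos v ∧ s.arr A_col i = s.reg R_j) := by
      constructor
      · exact fun h => ⟨fun u hu hui => h u hu (by omega),
          fun h' => h ⟨i, hi⟩ h'.1 (Nat.lt_succ_self i) h'.2⟩
      · rintro ⟨h1, h2⟩ u hu hui
        by_cases h : (u : ℕ) = i
        · obtain rfl : u = ⟨i, hi⟩ := Fin.ext h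
          exact fun h' => h2 ⟨hu, h'⟩
        · exact h1 u hu (by omega)
    have hcond : (laterE.and ((Expr.cell A_col (.reg R_u)).eq (.reg R_j))).Holds s₁ ↔
        ⟨i, hi⟩ ∈ laterNbs G pos v ∧ s.arr A_col i = s.reg R_j := by
      rw [holds_and, holds_laterE hs₁ (by rw [e3]; exact hpos) e1 e2]
      simp [hri, e4, e5]
    refine Ensures.cond (fun h => Ensures.setReg ?_) (fun h => Ensures.skip ?_)
    · rw [hcond] at h
      rw [hsplit]
      simp [h]
    · rw [hcond] at h
      rw [hsplit]
      simpa [h] using hI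
  · intro s' _ h
    rw [h]
    exact forall₂_congr fun u _ => by simp

/-- Colours the vertices in the reverse of the elimination order, each with the least colour that
does not occur among its later neighbours, and counts the colours. -/
def colouring : Prog :=
  .seq (.setReg R_q (.lit 0)) <|
  .forUp R_i R_n <|
    .seq (.setReg R_v (.cell A_ord (.minus (.minus (.reg R_n) (.lit 1)) (.reg R_i)))) <|
    .seq (.setReg R_p (.reg R_n)) <|
    .seq (.forUp R_j R_n <|
      .ite ((Expr.reg R_p).eq (.reg R_n))
        (.seq testColour (.ite (.reg R_flag) (.setReg R_p (.reg R_j)) .skip)) .skip) <|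
    .seq (.setCell A_col (.reg R_v) (.reg R_p)) <|
    .ite (.less (.reg R_q) (.plus (.reg R_p) (.lit 1)))
      (.setReg R_q (.plus (.reg R_p) (.lit 1))) .skip

/-- `col` is a proper colouring with `q` colours of the last `i` vertices of the order. No more
colours are used than necessary: some vertex has at least `q - 1` later neighbours, with which it
forms a clique. -/
structure PartialColouring {n : ℕ} (G : SimpleGraph (Fin n)) (pos : Fin n → ℕ) (i q : ℕ)
    (col : ℕ → ℕ) : Prop where
  lt : ∀ v : Fin n, n ≤ pos v + i → col v < q
  ne : ∀ v : Fin n, n ≤ pos v + i → ∀ u ∈ laterNbs G pos v, col v ≠ col u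
  q_le : q = 0 ∨ ∃ v : Fin n, q ≤ (laterNbs G pos v).card + 1

theorem PartialColouring.extend {n : ℕ} {G : SimpleGraph (Fin n)} {pos : Fin n → ℕ} {i q q' c : ℕ}
    {col : ℕ → ℕ} (hpos : Function.Injective pos) (h : PartialColouring G pos i q col) {v : Fin n}
    (hv : pos v + i + 1 = n) (hc : ∀ u ∈ laterNbs G pos v, col u ≠ c)
    (hc' : ∀ c' < c, ∃ u ∈ laterNbs G pos v, col u = c') (hq : q' = max q (c + 1)) :
    PartialColouring G pos (i + 1) q' (Function.update col v c) := by
  have hup : ∀ a : Fin n, Function.update col v c a = if a = v then c else col a := by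
    intro a
    rw [Function.update_apply]
    simp only [Fin.ext_iff]
  have hne : ∀ a : Fin n, a ≠ v → n ≤ pos a + (i + 1) → n ≤ pos a + i := by
    intro a hav ha
    have : pos a ≠ pos v := fun h => hav (hpos h)
    omega
  refine ⟨fun a ha => ?_, fun a ha u hu => ?_, ?_⟩
  · rw [hup]
    split_ifs with hav
    · omega
    · have := h.lt a (hne a hav ha); omega
  · have hlt := (mem_laterNbs.1 hu).2
    have huv : u ≠ v := by rintro rfl; omega
    rw [hup, hup, if_neg huv]
    split_ifs with hav
    · exact (hc u (hav ▸ hu)).symm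
    · exact h.ne a (hne a hav ha) u hu
  · rcases le_total q (c + 1) with hle | hle
    · right
      refine ⟨v, ?_⟩
      rw [hq, max_eq_right hle, Nat.add_le_add_iff_right, ← Finset.card_range c]
      refine (Finset.card_le_card fun c' hc₁ => ?_).trans
        (Finset.card_image_le (s := laterNbs G pos v) (f := fun u => col u))
      obtain ⟨u, hu, hu'⟩ := hc' c' (Finset.mem_range.1 hc₁)
      exact Finset.mem_image.2 ⟨u, hu, hu'⟩
    · rw [hq, max_eq_left hle]; exact h.q_le

/-- Fewer than `n` colours occur among the later neighbours of a vertex. -/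
theorem exists_unused_colour {n : ℕ} {G : SimpleGraph (Fin n)} {pos : Fin n → ℕ} (col : ℕ → ℕ)
    (v : Fin n) : ¬ ∀ c < n, ∃ u ∈ laterNbs G pos v, col u = c := by
  intro h
  have h1 : (Finset.range n).card ≤ (laterNbs G pos v).card := by
    refine (Finset.card_le_card fun c hc => ?_).trans
      (Finset.card_image_le (s := laterNbs G pos v) (f := fun u => col u))
    obtain ⟨u, hu, hu'⟩ := h c (Finset.mem_range.1 hc)
    exact Finset.mem_image.2 ⟨u, hu, hu'⟩
  have h2 : (laterNbs G pos v).card < (Finset.univ : Finset (Fin n)).card := by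
    refine Finset.card_lt_card ((Finset.ssubset_univ_iff).2 fun h => ?_)
    have := mem_laterNbs.1 (h ▸ Finset.mem_univ v)
    omega
  simp at h1 h2
  omega

theorem colouring_spec {n B : ℕ} {G : SimpleGraph (Fin n)} {pos : Fin n → ℕ} {s : State}
    (hs : HasGraph G s) (hord : HasOrder pos s) (hpos : Function.Injective pos)
    (hB : n ≤ B) :
    Ensures B colouring s fun s' => PartialColouring G pos n (s'.reg R_q) (s'.arr A_col) := by
  refine Ensures.seq (Ensures.setReg ?_)
  refine Ensures.forUp (M := n)
    (fun i s' => PartialColouring G pos i (s'.reg R_q) (s'.arr A_col))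
    (by simp [hs.reg_n]) hB rfl rfl ?_ ?_ fun _ _ h => h
  · have : ∀ v, pos v < n := by
      choose f hf using fun j : Fin n => hord.ord_eq j j.2
      have hinj : Function.Injective f := fun j j' h => Fin.ext <| by
        rw [← (hf j).2, ← (hf j').2, h]
      intro v
      obtain ⟨j, rfl⟩ := (Finite.injective_iff_surjective.1 hinj) v
      rw [(hf j).2]; exact j.2
    refine ⟨fun v hv => ?_, fun v hv => ?_, .inl (by simp)⟩ <;>
    · have := this v
      omega
  · intro i s₁ hi hF hri hI
    have hs₁ : HasGraph G s₁ := (hs.congr (s' := s.writeReg R_q _) (by simp) rfl rfl).frame hF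
      rfl rfl rfl
    have hpos₁ : s₁.arr A_pos = s.arr A_pos := hF.arr _ rfl
    have hord₁ : s₁.arr A_ord = s.arr A_ord := hF.arr _ rfl
    obtain ⟨v, hv, hvi⟩ := hord.ord_eq (n - 1 - i) (by omega)
    refine Ensures.seq (Ensures.setReg (Ensures.seq (Ensures.setReg (Ensures.seq ?_))))
    set s₂ := (s₁.writeReg R_v _).writeReg R_p _ with hs₂d
    have hs₂ : HasGraph G s₂ := hs₁.congr (by simp [hs₂d]) rfl rfl
    have hv₂ : s₂.reg R_v = v := by simp [hs₂d, hs₁.reg_n, hri, hord₁, hv]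
    have harr₂ : s₂.arr = s₁.arr := rfl
    refine Ensures.forUp (M := n) (fun j s' =>
        (s'.reg R_p = n ∧ ∀ c < j, ∃ u ∈ laterNbs G pos v, s₁.arr A_col u = c) ∨
        (s'.reg R_p < n ∧ (∀ c < s'.reg R_p, ∃ u ∈ laterNbs G pos v, s₁.arr A_col u = c) ∧
          ∀ u ∈ laterNbs G pos v, s₁.arr A_col u ≠ s'.reg R_p))
      hs₂.reg_n hB rfl rfl (by simp [hs₂d, hs₁.reg_n]) ?_ ?_
    · intro j s₃ hj hF' hrj hI'
      have hs₃ : HasGraph G s₃ := hs₂.frame hF' rfl rfl rfl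
      refine Ensures.cond (fun h => Ensures.seq ?_) (fun h => Ensures.skip ?_)
      · simp only [holds_eq, eval, hs₃.reg_n] at h
        have hI'' := (hI'.resolve_right (by omega)).2
        have e1 : s₃.reg R_v = v := (hF'.reg _ rfl).trans hv₂
        have e2 : s₃.arr A_col = s₁.arr A_col := hF'.arr _ rfl
        have e3 : s₃.arr A_pos = s.arr A_pos := (hF'.arr _ rfl).trans hpos₁
        refine (testColour_spec hs₃ (by rw [e3]; exact hord.rank_eq) hB e1).mono
          fun s₄ hF₄ h₄ => ?_
        have e4 : s₄.reg R_j = j := (hF₄.reg _ rfl).trans hrj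
        have e5 : s₄.reg R_p = n := (hF₄.reg _ rfl).trans h
        rw [e2, hrj] at h₄
        refine Ensures.cond (fun h' => Ensures.setReg ?_) (fun h' => Ensures.skip ?_)
        · rw [holds_reg, h₄] at h'
          right
          simpa [e4, hj] using ⟨hI'', h'⟩
        · rw [holds_reg, h₄] at h'
          push Not at h'
          left
          simp only [writeReg_reg]
          refine ⟨by simp [e5], fun c hc => ?_⟩
          by_cases hcj : c = j
          · exact hcj ▸ h'
          · exact hI'' c (by omega)
      · simp only [holds_eq, eval, hs₃.reg_n] at h
        right
        simpa using hI'.resolve_left fun h' => h h'.1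
    · intro s₃ hF' hI'
      have hI'' := hI'.resolve_left fun h => exists_unused_colour _ v h.2
      refine Ensures.seq (Ensures.setCell ?_)
      have e1 : s₃.reg R_v = v := (hF'.reg _ rfl).trans hv₂
      have e2 : s₃.arr A_col = s₁.arr A_col := hF'.arr _ rfl
      have e3 : s₃.reg R_q = s₁.reg R_q := (hF'.reg _ rfl).trans (by simp [hs₂d])
      have hext := fun {q'} => hI.extend (q' := q') hpos (v := v) (by omega) hI''.2.2 hI''.2.1
      refine Ensures.cond (fun h => Ensures.setReg ?_) (fun h => Ensures.skip ?_)
      · simp only [holds_less, eval, writeCell_reg, e3] at h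
        have := hext (q' := s₃.reg R_p + 1) (by omega)
        simpa [e1, e2] using this
      · simp only [holds_less, eval, writeCell_reg, e3] at h
        have := hext (q' := s₁.reg R_q) (by omega)
        simpa [e1, e2, e3] using this

/-- The number of colours is at most `2 d + 1` plus the size of any deletion set. -/
theorem PartialColouring.q_le_of_isDeletionSet {n i q : ℕ} {G : SimpleGraph (Fin n)}
    {pos : Fin n → ℕ} {col : ℕ → ℕ} (h : PartialColouring G pos i q col)
    (hpeo : ∀ v a b, G.Adj v a → G.Adj v b → pos v < pos a → pos v < pos b → a ≠ b → G.Adj a b)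
    {d : ℕ} {K : Finset (Fin n)} (hK : IsDeletionSet G d K) : q ≤ 2 * d + 1 + K.card := by
  rcases h.q_le with h | ⟨v, hv⟩
  · omega
  · have hvn : v ∉ laterNbs G pos v := by simp [mem_laterNbs]
    refine (hv.trans (Finset.card_insert_of_notMem hvn).ge).trans (card_clique_le hK ?_)
    intro a ha b hb hab
    rw [Finset.mem_insert, mem_laterNbs] at ha hb
    rcases ha with rfl | ha <;> rcases hb with rfl | hb
    · exact absurd rfl hab
    · exact hb.1
    · exact ha.1.symm
    · exact hpeo v a b ha.1 hb.1 ha.2 hb.2 hab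

/-! ### Digit tables -/

theorem succ_div_mod {P m : ℕ} (hP : 0 < P) :
    (m % P + 1 < P → (m + 1) / P = m / P ∧ (m + 1) % P = m % P + 1) ∧
      (¬ m % P + 1 < P → (m + 1) / P = m / P + 1 ∧ (m + 1) % P = 0) := by
  have h := Nat.mod_add_div m P
  have hlt := Nat.mod_lt m hP
  constructor
  · intro h'
    rw [Nat.div_mod_unique hP]
    exact ⟨by omega, h'⟩
  · intro h'
    rw [Nat.div_mod_unique hP, mul_add]
    exact ⟨by omega, hP⟩

/-- For each `m`, computes the digit of `m` in the place with value `P`, capped at `d + 1` and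
multiplied by `P`, and whether this digit exceeds `d`. There being no division, the numbers `m` are
traversed in increasing order, with `lo` the part of `m` below this place and `x` the digit. -/
def digits : Prog :=
  .seq (.setReg R_lo (.lit 0)) <|
  .seq (.setReg R_x (.lit 0)) <|
  .seq (.setReg R_y (.lit 0)) <|
  .forUp R_m R_NN <|
    .seq (.setCell A_dig (.reg R_m) (.reg R_y)) <|
    .seq (.setCell A_over (.reg R_m) (.less (.reg R_d) (.reg R_x))) <|
    .seq (.setReg R_lo (.plus (.reg R_lo) (.lit 1))) <|
    .ite (.less (.reg R_lo) (.reg R_P)) .skip <|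
      .seq (.setReg R_lo (.lit 0)) <|
      .seq (.setReg R_x (.plus (.reg R_x) (.lit 1))) <|
      .ite (.less (.reg R_x) (.reg R_base))
        (.ite (.less (.reg R_x) (.plus (.reg R_d) (.lit 2)))
          (.setReg R_y (.plus (.reg R_y) (.reg R_P))) .skip)
        (.seq (.setReg R_x (.lit 0)) (.setReg R_y (.lit 0)))

theorem digits_spec {B d P M : ℕ} {s : State} (hd : s.reg R_d = d) (hD : s.reg R_base = 2 * d + 3)
    (hP : s.reg R_P = P) (hP0 : 0 < P) (hM : s.reg R_NN = M) (hB : M ≤ B) :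
    Ensures B digits s fun s' => ∀ m < M,
      s'.arr A_dig m = min (m / P % (2 * d + 3)) (d + 1) * P ∧
        (s'.arr A_over m ≠ 0 ↔ d < m / P % (2 * d + 3)) := by
  refine Ensures.seq (Ensures.setReg (Ensures.seq (Ensures.setReg (Ensures.seq
    (Ensures.setReg ?_)))))
  refine Ensures.forUp (M := M) (fun i s' => s'.reg R_lo = i % P ∧
      s'.reg R_x = i / P % (2 * d + 3) ∧ s'.reg R_y = min (i / P % (2 * d + 3)) (d + 1) * P ∧
      ∀ m < i, s'.arr A_dig m = min (m / P % (2 * d + 3)) (d + 1) * P ∧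
        (s'.arr A_over m ≠ 0 ↔ d < m / P % (2 * d + 3)))
    (by simp [hM]) hB rfl rfl (by simp) ?_ fun _ _ h => h.2.2.2
  intro i s₁ hi hF hri ⟨hlo, hx, hy, hI⟩
  have e1 : s₁.reg R_d = d := (hF.reg _ rfl).trans (by simp [hd])
  have e2 : s₁.reg R_base = 2 * d + 3 := (hF.reg _ rfl).trans (by simp [hD])
  have e3 : s₁.reg R_P = P := (hF.reg _ rfl).trans (by simp [hP])
  have hI' : ∀ m < i + 1,
      Function.update (s₁.arr A_dig) i (s₁.reg R_y) m = min (m / P % (2 * d + 3)) (d + 1) * P ∧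
      (Function.update (s₁.arr A_over) i (if d < s₁.reg R_x then 1 else 0) m ≠ 0 ↔
        d < m / P % (2 * d + 3)) := by
    intro m hm
    by_cases hmi : m = i
    · subst hmi
      simp [hy, hx]
    · simpa [hmi] using hI m (by omega)
  have hmod := Nat.mod_lt (i / P) (show 0 < 2 * d + 3 by omega)
  refine Ensures.seq (Ensures.setCell (Ensures.seq (Ensures.setCell (Ensures.seq
    (Ensures.setReg ?_)))))
  refine Ensures.cond (fun h => Ensures.skip ?_) (fun h => Ensures.seq (Ensures.setReg
    (Ensures.seq (Ensures.setReg (Ensures.cond (fun h' => Ensures.cond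
      (fun h'' => Ensures.setReg ?_) (fun h'' => Ensures.skip ?_))
      (fun h' => Ensures.seq (Ensures.setReg (Ensures.setReg ?_))))))))
  · simp [e3, hlo] at h
    have hs := (succ_div_mod hP0).1 h
    rw [hs.1, hs.2]
    simpa [hri, e1, hlo, hx, hy] using hI'
  all_goals
    simp [e3, hlo] at h
    have hs := (succ_div_mod (m := i) hP0).2 (by omega)
    rw [hs.1, hs.2]
    simp [e2, hx] at h'
  · have hs' := (succ_div_mod (m := i / P) (show 0 < 2 * d + 3 by omega)).1 (by omega)
    simp [e1, hx] at h''
    rw [hs'.2]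
    refine ⟨by simp, by simp [hx], ?_, by simpa [hri, e1] using hI'⟩
    simp only [writeReg_reg, eval, writeCell_reg]
    simp [hy, e3]
    rw [min_eq_left (by omega), min_eq_left (by omega)]
    exact (Nat.succ_mul _ _).symm
  · have hs' := (succ_div_mod (m := i / P) (show 0 < 2 * d + 3 by omega)).1 (by omega)
    simp [e1, hx] at h''
    rw [hs'.2]
    refine ⟨by simp, by simp [hx], ?_, by simpa [hri, e1] using hI'⟩
    simp [hy]
    left; omega
  · have hs' := (succ_div_mod (m := i / P) (show 0 < 2 * d + 3 by omega)).2 (by omega)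
    rw [hs'.2]
    exact ⟨by simp, by simp, by simp, by simpa [hri, e1] using hI'⟩

/-- Fills the table of `capDigits`. -/
def capTable : Prog :=
  .forUp R_j R_q <|
    .seq (.setReg R_P (.cell A_pow (.reg R_j))) <|
    .seq digits <|
    .forUp R_a R_NN <|
      .setCell A_cap (.reg R_a) (.plus (.cell A_cap (.reg R_a)) (.cell A_dig (.reg R_a)))

theorem capTable_spec {B d q M : ℕ} {s : State} (hd : s.reg R_d = d)
    (hD : s.reg R_base = 2 * d + 3) (hq : s.reg R_q = q) (hM : s.reg R_NN = M) (hB : M ≤ B)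
    (hB' : q ≤ B) (hpow : ∀ c < q, s.arr A_pow c = (2 * d + 3) ^ c) (h0 : ∀ m, s.arr A_cap m = 0) :
    Ensures B capTable s fun s' => ∀ m < M, s'.arr A_cap m = capDigits d q m := by
  refine Ensures.forUp (fun i s' => ∀ m < M, s'.arr A_cap m = capDigits d i m) hq hB' rfl rfl
    (by simp [capDigits, h0]) ?_ fun _ _ h => h
  intro i s₁ hi hF hri hI
  refine Ensures.seq (Ensures.setReg (Ensures.seq ?_))
  refine (digits_spec (s := s₁.writeReg R_P _) (d := d) (P := (2 * d + 3) ^ i) (M := M)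
    ?_ ?_ ?_ (Nat.pow_pos (by omega)) ?_ hB).mono fun s₂ hF₂ h₂ => ?_
  · simp only [writeReg_reg]; exact (hF.reg _ rfl).trans hd
  · simp only [writeReg_reg]; exact (hF.reg _ rfl).trans hD
  · have e : s₁.arr A_pow = s.arr A_pow := hF.arr _ rfl
    simp [hri, e, hpow i hi]
  · simp only [writeReg_reg]; exact (hF.reg _ rfl).trans hM
  have eM : s₂.reg R_NN = M :=
    (hF₂.reg _ rfl).trans ((show _ = s₁.reg R_NN by simp).trans ((hF.reg _ rfl).trans hM))
  refine Ensures.forUp (fun k s' => ∀ m < M, s'.arr A_cap m =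
    if m < k then capDigits d (i + 1) m else capDigits d i m) eM hB rfl rfl ?_ ?_ ?_
  · intro m hm
    have e : s₂.arr A_cap = s₁.arr A_cap := hF₂.arr _ rfl
    simp [e, hI m hm]
  · intro k s₃ hk hF₃ hrk hI₃
    refine Ensures.setCell fun m hm => ?_
    have e : s₃.arr A_dig = s₂.arr A_dig := hF₃.arr _ rfl
    by_cases hmk : m = k
    · subst hmk
      simp [hrk, hI₃ m hm, e, (h₂ m hm).1, capDigits, Finset.sum_range_succ]
    · have : m < k + 1 ↔ m < k := by omega
      simp only [eval, writeReg_arr, writeCell_arr, if_true, hrk, Function.update_of_ne hmk, this]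
      exact hI₃ m hm
  · intro s₃ _ hI₃ m hm
    have := hI₃ m hm
    rw [if_pos hm] at this
    simpa using this

/-! ### Operations on tables -/

/-- Registers and arrays that are constant during the main part of the algorithm. -/
def keepsSetup (p : Prog) : Bool :=
  [R_n, R_d, R_base, R_q, R_N, R_NN, R_top, R_big].all (fun x => !p.writesReg x) &&
    [A_adj, A_row, A_ord, A_pos, A_col, A_pow, A_two, A_cap, A_off].all fun a => !p.writesArr a

/-- The constants that describe an elimination. -/
structure HasSetup {n : ℕ} (Γ : Elim n) (s : State) : Prop where
  graph : HasGraph Γ.G s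
  order : HasOrder Γ.pos s
  col : ∀ v : Fin n, s.arr A_col v = Γ.col v
  reg_d : s.reg R_d = Γ.d
  reg_base : s.reg R_base = 2 * Γ.d + 3
  reg_N : s.reg R_N = Γ.N
  reg_NN : s.reg R_NN = Γ.N + Γ.N
  reg_top : s.reg R_top = Γ.top
  pow : ∀ c < Γ.q, s.arr A_pow c = (2 * Γ.d + 3) ^ c
  weight : ∀ v : Fin n, s.reg R_big + s.arr A_two v = Γ.w v
  cap : ∀ m < Γ.N + Γ.N, s.arr A_cap m = capDigits Γ.d Γ.q m
  off : ∀ p ≤ n, s.arr A_off p = p * Γ.N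

theorem HasSetup.frame {n : ℕ} {Γ : Elim n} {s s' : State} (h : HasSetup Γ s) {p : Prog}
    (hF : Frame p s s') (hp : keepsSetup p = true) : HasSetup Γ s' := by
  simp only [keepsSetup, List.all_cons, List.all_nil, Bool.and_true, Bool.and_eq_true,
    Bool.not_eq_true'] at hp
  obtain ⟨⟨r0, r1, r3, r6, r7, r28, r8, r9⟩, a0, a2, a3, a4, a5, a6, a7, a8, a11⟩ := hp
  exact
    { graph := h.graph.frame hF r0 a0 a2
      order := ⟨hF.arr _ a4 ▸ h.order.rank_eq, hF.arr _ a3 ▸ h.order.ord_eq⟩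
      col := hF.arr _ a5 ▸ h.col
      reg_d := (hF.reg _ r1).trans h.reg_d
      reg_base := (hF.reg _ r3).trans h.reg_base
      reg_N := (hF.reg _ r7).trans h.reg_N
      reg_NN := (hF.reg _ r28).trans h.reg_NN
      reg_top := (hF.reg _ r8).trans h.reg_top
      pow := hF.arr _ a6 ▸ h.pow
      weight := by rw [hF.reg _ r9, hF.arr _ a7]; exact h.weight
      cap := hF.arr _ a8 ▸ h.cap
      off := hF.arr _ a11 ▸ h.off }

theorem HasSetup.writeReg {n : ℕ} {Γ : Elim n} {s : State} (h : HasSetup Γ s) (x m : ℕ)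
    (hx : keepsSetup (.setReg x (.lit 0)) = true) : HasSetup Γ (s.writeReg x m) :=
  h.frame (Runs.setReg s x (.lit m)).frame hx

theorem HasSetup.col_pow {n : ℕ} {Γ : Elim n} {s : State} (h : HasSetup Γ s) (v : Fin n) :
    s.arr A_pow (s.arr A_col v) = (2 * Γ.d + 3) ^ Γ.col v := by
  rw [h.col, h.pow _ (Γ.col_lt v)]

/-- Sets all entries of the table in array `a` to infinity. -/
def clear (a : ℕ) : Prog := .forUp R_m R_N (.setCell a (.reg R_m) (.reg R_top))

theorem clear_spec {B N a : ℕ} {s : State} (hN : s.reg R_N = N) (hB : N ≤ B) :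
    Ensures B (clear a) s fun s' => ∀ m < N, s'.arr a m = s.reg R_top := by
  refine Ensures.forUp (fun i s' => ∀ m < i, s'.arr a m = s.reg R_top) hN hB rfl rfl (by simp) ?_
    fun _ _ h => h
  intro i s₁ _ hF hri hI
  refine Ensures.setCell fun m hm => ?_
  have e : s₁.reg R_top = s.reg R_top := hF.reg _ rfl
  by_cases hmi : m = i
  · simp [hmi, hri, e]
  · simpa [hri, hmi] using hI m (by omega)

/-- Replaces the entry `idx` of the table in array `a` by `val`, if this is smaller. -/
def relax (a : ℕ) : Prog :=
  .ite (.less (.reg R_val) (.cell a (.reg R_idx))) (.setCell a (.reg R_idx) (.reg R_val)) .skip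

theorem relax_spec {B a : ℕ} {s : State} :
    Ensures B (relax a) s fun s' => s'.arr a =
      Function.update (s.arr a) (s.reg R_idx) (min (s.arr a (s.reg R_idx)) (s.reg R_val)) := by
  refine Ensures.cond (fun h => Ensures.setCell ?_) (fun h => Ensures.skip ?_)
  · simp only [holds_less, eval] at h
    simp [min_eq_right h.le]
  · simp only [holds_less, eval, not_lt] at h
    simp [min_eq_left h]

theorem setOf_exists_lt_succ {α : Type*} (Q : α → Prop) (f : ℕ → α) (j : ℕ) :
    {z | Q z ∨ ∃ b < j + 1, z = f b} = insert (f j) {z | Q z ∨ ∃ b < j, z = f b} := by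
  ext z
  simp only [Set.mem_ofPred_eq, Set.mem_insert_iff, Nat.lt_succ_iff_lt_or_eq]
  constructor
  · rintro (h | ⟨b, h | rfl, rfl⟩)
    · exact .inr (.inl h)
    · exact .inr (.inr ⟨b, h, rfl⟩)
    · exact .inl rfl
  · rintro (rfl | h | ⟨b, h, rfl⟩)
    · exact .inr ⟨j, .inr rfl, rfl⟩
    · exact .inl h
    · exact .inr ⟨b, .inl h, rfl⟩

/-- Combines the table that starts at `off` in the large array with the table in array `F`. -/
def convolve : Prog :=
  .seq (clear A_tmp) <|
  .seq (.forUp R_a R_N <| .forUp R_b R_N <|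
    .seq (.setReg R_idx (.cell A_cap (.plus (.reg R_a) (.reg R_b)))) <|
    .seq (.setReg R_val
      (.plus (.cell A_T (.plus (.reg R_off) (.reg R_a))) (.cell A_F (.reg R_b)))) <|
    relax A_tmp) <|
  .forUp R_a R_N <|
    .setCell A_T (.plus (.reg R_off) (.reg R_a)) (.cell A_tmp (.reg R_a))

theorem convolve_spec {n B : ℕ} {Γ : Elim n} {s : State} (hs : HasSetup Γ s) (hB : Γ.N ≤ B)
    {o : ℕ} (ho : s.reg R_off = o) :
    Ensures B convolve s fun s' =>
      Γ.IsConv (fun m => s.arr A_T (o + m)) (s.arr A_F) (fun m => s'.arr A_T (o + m)) ∧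
        ∀ m, m < o ∨ o + Γ.N ≤ m → s'.arr A_T m = s.arr A_T m := by
  set f : ℕ → ℕ → ℕ × ℕ := fun a b =>
    (capDigits Γ.d Γ.q (a + b), s.arr A_T (o + a) + s.arr A_F b) with hf
  refine Ensures.seq ((clear_spec hs.reg_N hB).mono fun s₁ hF₁ h₁ => Ensures.seq ?_)
  have hs₁ := hs.frame hF₁ rfl
  have ho₁ : s₁.reg R_off = o := (hF₁.reg _ rfl).trans ho
  have hT₁ : s₁.arr A_T = s.arr A_T := hF₁.arr _ rfl
  have hF₁' : s₁.arr A_F = s.arr A_F := hF₁.arr _ rfl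
  refine Ensures.forUp (M := Γ.N) (fun i s' => IsTable Γ.N Γ.top (s'.arr A_tmp)
    {z | ∃ a < i, ∃ b < Γ.N, z = f a b}) hs₁.reg_N hB rfl rfl ?_ ?_ ?_
  · simpa using IsTable.empty fun m hm => (h₁ m hm).trans hs.reg_top
  · intro i s₂ hi hF₂ hri hI
    have hs₂ := hs₁.frame hF₂ rfl
    refine Ensures.forUp (M := Γ.N) (fun j s' => IsTable Γ.N Γ.top (s'.arr A_tmp)
      {z | (∃ a < i, ∃ b < Γ.N, z = f a b) ∨ ∃ b < j, z = f i b}) hs₂.reg_N hB rfl rfl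
      (by simpa using hI) ?_ ?_
    · intro j s₃ hj hF₃ hrj hI'
      have hs₃ := hs₂.frame hF₃ rfl
      have e1 : s₃.reg R_a = i := (hF₃.reg _ rfl).trans hri
      have e2 : s₃.reg R_off = o := (hF₃.reg _ rfl).trans ((hF₂.reg _ rfl).trans ho₁)
      have e3 : s₃.arr A_T = s.arr A_T := (hF₃.arr _ rfl).trans ((hF₂.arr _ rfl).trans hT₁)
      have e4 : s₃.arr A_F = s.arr A_F := (hF₃.arr _ rfl).trans ((hF₂.arr _ rfl).trans hF₁')
      have e5 : s₃.arr A_cap (i + j) = capDigits Γ.d Γ.q (i + j) := hs₃.cap _ (by omega)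
      refine Ensures.seq (Ensures.setReg (Ensures.seq (Ensures.setReg ?_)))
      refine relax_spec.mono fun s₄ _ h₄ => ?_
      rw [setOf_exists_lt_succ]
      have := hI'.relax (f i j).1 (f i j).2
      simpa [h₄, e1, e2, e3, e4, e5, hrj, hf] using this
    · intro s₃ _ hI'
      have e : {z | ∃ a < i + 1, ∃ b < Γ.N, z = f a b} =
          {z | (∃ a < i, ∃ b < Γ.N, z = f a b) ∨ ∃ b < Γ.N, z = f i b} := by
        ext z
        simp only [Set.mem_ofPred_eq, Nat.lt_succ_iff_lt_or_eq, or_and_right, exists_or,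
          exists_eq_left]
      rw [e]
      exact hI'
  · intro s₂ hF₂ hI
    have hs₂ := hs₁.frame hF₂ rfl
    have ho₂ : s₂.reg R_off = o := (hF₂.reg _ rfl).trans ho₁
    have hT₂ : s₂.arr A_T = s.arr A_T := (hF₂.arr _ rfl).trans hT₁
    refine Ensures.forUp (M := Γ.N) (fun i s' => (∀ m < i, s'.arr A_T (o + m) = s₂.arr A_tmp m) ∧
      ∀ m, m < o ∨ o + i ≤ m → s'.arr A_T m = s.arr A_T m) hs₂.reg_N hB rfl rfl
      (by simp [hT₂]) ?_ ?_
    · intro i s₃ hi hF₃ hri hI'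
      have e1 : s₃.reg R_off = o := (hF₃.reg _ rfl).trans ho₂
      have e2 : s₃.arr A_tmp = s₂.arr A_tmp := hF₃.arr _ rfl
      refine Ensures.setCell ⟨fun m hm => ?_, fun m hm => ?_⟩
      · by_cases hmi : m = i
        · simp [hmi, hri, e1, e2]
        · simpa [hri, e1, hmi] using hI'.1 m (by omega)
      · have hmi : m ≠ o + i := by omega
        simpa [hri, e1, hmi] using hI'.2 m (by omega)
    · intro s₃ _ hI'
      exact ⟨hI.congr hI'.1, hI'.2⟩

/-- The table of the edge between the vertices in registers `v` and `u`. -/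
def edgeTable : Prog :=
  .seq (clear A_F) <|
  .seq (.setCell A_F (.cell A_pow (.cell A_col (.reg R_v))) (.lit 0))
    (.setCell A_F (.cell A_pow (.cell A_col (.reg R_u))) (.lit 0))

theorem edgeTable_spec {n B : ℕ} {Γ : Elim n} {s : State} (hs : HasSetup Γ s) (hB : Γ.N ≤ B)
    {u v : Fin n} (hv : s.reg R_v = v) (hu : s.reg R_u = u) :
    Ensures B edgeTable s fun s' => IsTable Γ.N Γ.top (s'.arr A_F)
      {((2 * Γ.d + 3) ^ Γ.col v, 0), ((2 * Γ.d + 3) ^ Γ.col u, 0)} := by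
  refine Ensures.seq ((clear_spec hs.reg_N hB).mono fun s₁ hF₁ h₁ => ?_)
  have hs₁ := hs.frame hF₁ rfl
  refine Ensures.seq (Ensures.setCell (Ensures.setCell ?_))
  have e1 : s₁.reg R_v = v := (hF₁.reg _ rfl).trans hv
  have e2 : s₁.reg R_u = u := (hF₁.reg _ rfl).trans hu
  have := ((IsTable.empty fun m hm => (h₁ m hm).trans hs.reg_top).relax
    ((2 * Γ.d + 3) ^ Γ.col v) 0).relax ((2 * Γ.d + 3) ^ Γ.col u) 0
  rw [Set.pair_comm]
  simpa [e1, e2, hs₁.col_pow] using this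

/-- Eliminates vertex `v` from the table that starts at `off`; the result is put into array `F`. -/
def forget : Prog :=
  .seq (.setReg R_P (.cell A_pow (.cell A_col (.reg R_v)))) <|
  .seq digits <|
  .seq (clear A_F) <|
  .forUp R_a R_N <|
    .seq (.setReg R_idx (.minus (.reg R_a) (.cell A_dig (.reg R_a)))) <|
    .seq (.setReg R_val (.cell A_T (.plus (.reg R_off) (.reg R_a)))) <|
    .seq (.ite (.cell A_over (.reg R_a))
      (.setReg R_val (.plus (.reg R_val) (.plus (.reg R_big) (.cell A_two (.reg R_v))))) .skip) <|
    relax A_F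

theorem forget_spec {n B : ℕ} {Γ : Elim n} {s : State} (hs : HasSetup Γ s) (hB : Γ.N + Γ.N ≤ B)
    {o : ℕ} (ho : s.reg R_off = o) {v : Fin n} (hv : s.reg R_v = v) :
    Ensures B forget s fun s' => IsTable Γ.N Γ.top (s'.arr A_F) {z | ∃ a < Γ.N,
      z = (a - min (a / (2 * Γ.d + 3) ^ Γ.col v % (2 * Γ.d + 3)) (Γ.d + 1) *
          (2 * Γ.d + 3) ^ Γ.col v,
        s.arr A_T (o + a) +
          if Γ.d < a / (2 * Γ.d + 3) ^ Γ.col v % (2 * Γ.d + 3) then Γ.w v else 0)} := by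
  refine Ensures.seq (Ensures.setReg (Ensures.seq ?_))
  have hs₁ := hs.writeReg R_P ((Expr.cell A_pow (.cell A_col (.reg R_v))).eval s) rfl
  have hP : (s.writeReg R_P ((Expr.cell A_pow (.cell A_col (.reg R_v))).eval s)).reg R_P =
      (2 * Γ.d + 3) ^ Γ.col v := by simp [hv, hs.col_pow]
  refine (digits_spec hs₁.reg_d hs₁.reg_base hP (Nat.pow_pos (by omega)) hs₁.reg_NN hB).mono
    fun s₂ hF₂ h₂ => Ensures.seq ?_
  have hs₂ := hs₁.frame hF₂ rfl
  refine (clear_spec hs₂.reg_N (by omega)).mono fun s₃ hF₃ h₃ => ?_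
  have hs₃ := hs₂.frame hF₃ rfl
  have hF : Frame forget s s₃ := by
    refine Frame.trans (s' := s.writeReg R_P _) ⟨fun x hx => ?_, fun _ _ => rfl⟩
      ((hF₂.mono ?_ ?_).trans (hF₃.mono ?_ ?_))
    · have : x ≠ R_P := by rintro rfl; exact absurd hx (by decide)
      simp [this]
    all_goals simp +contextual [forget, Prog.writesReg, Prog.writesArr]
  set f : ℕ → ℕ × ℕ := fun a =>
    (a - min (a / (2 * Γ.d + 3) ^ Γ.col v % (2 * Γ.d + 3)) (Γ.d + 1) * (2 * Γ.d + 3) ^ Γ.col v,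
      s.arr A_T (o + a) +
        if Γ.d < a / (2 * Γ.d + 3) ^ Γ.col v % (2 * Γ.d + 3) then Γ.w v else 0) with hf
  refine Ensures.forUp (M := Γ.N) (fun i s' => IsTable Γ.N Γ.top (s'.arr A_F)
    {z | False ∨ ∃ a < i, z = f a}) hs₃.reg_N (by omega) rfl rfl ?_ ?_ ?_
  · simpa using IsTable.empty fun m hm => (h₃ m hm).trans hs₂.reg_top
  · intro i s₄ hi hF₄ hri hI
    have hs₄ := hs₃.frame hF₄ rfl
    have e1 : s₄.reg R_off = o := (hF₄.reg _ rfl).trans ((hF.reg _ rfl).trans ho)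
    have e2 : s₄.reg R_v = v := (hF₄.reg _ rfl).trans ((hF.reg _ rfl).trans hv)
    have e3 : s₄.arr A_T = s.arr A_T := (hF₄.arr _ rfl).trans (hF.arr _ rfl)
    have e4 : s₄.arr A_dig = s₂.arr A_dig := (hF₄.arr _ rfl).trans (hF₃.arr _ rfl)
    have e5 : s₄.arr A_over = s₂.arr A_over := (hF₄.arr _ rfl).trans (hF₃.arr _ rfl)
    have h₂i := h₂ i (by omega)
    have hr := hI.relax (f i).1 (f i).2
    rw [Prod.mk.eta, ← setOf_exists_lt_succ] at hr
    refine Ensures.seq (Ensures.setReg (Ensures.seq (Ensures.setReg (Ensures.seq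
      (Ensures.cond (fun h => Ensures.setReg ?_) (fun h => Ensures.skip ?_))))))
    · refine relax_spec.mono fun s₅ _ h₅ => ?_
      simp [hri, e5, h₂i.2] at h
      simp only [writeReg_arr]
      rw [h₅]
      simpa [hri, e1, e2, e3, e4, h₂i.1, hs₄.weight, hf, h] using hr
    · refine relax_spec.mono fun s₅ _ h₅ => ?_
      rw [holds_cell, not_not] at h
      have h' : ¬ Γ.d < i / (2 * Γ.d + 3) ^ Γ.col v % (2 * Γ.d + 3) := by
        rw [← h₂i.2]; simpa [hri, e5] using h
      simp only [writeReg_arr]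
      rw [h₅]
      simpa [hri, e1, e2, e3, e4, h₂i.1, hf, h'] using hr
  · intro s₄ _ hI
    simpa using hI

/-! ### Dynamic programming over the elimination tree -/

/-- The row with number `p` of the large table. -/
def tableRow (N : ℕ) (s : State) (p m : ℕ) : ℕ := s.arr A_T (p * N + m)

theorem row_disjoint {N p r m : ℕ} (hm : m < N) (hpr : p ≠ r) :
    p * N + m < r * N ∨ r * N + N ≤ p * N + m := by
  rcases lt_or_gt_of_ne hpr with h | h
  · left
    have := Nat.mul_le_mul_right N (Nat.succ_le_of_lt h)
    rw [Nat.succ_mul] at this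
    omega
  · right
    have := Nat.mul_le_mul_right N (Nat.succ_le_of_lt h)
    rw [Nat.succ_mul] at this
    omega

/-- In each row of the large table, only the zero vector is attained, at no cost. -/
def initTables : Prog :=
  .forUp R_i R_rows <|
    .seq (.forUp R_m R_N <|
      .setCell A_T (.plus (.cell A_off (.reg R_i)) (.reg R_m)) (.reg R_top)) <|
    .setCell A_T (.cell A_off (.reg R_i)) (.lit 0)

theorem initTables_spec {n B : ℕ} {Γ : Elim n} {s : State} (hs : HasSetup Γ s) (hB : Γ.N ≤ B)
    (hrows : s.reg R_rows = n + 1) (hB' : n + 1 ≤ B) :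
    Ensures B initTables s fun s' => ∀ p ≤ n,
      IsTable Γ.N Γ.top (tableRow Γ.N s' p) {(0, 0)} := by
  have hN : 0 < Γ.N := Nat.pow_pos (by omega)
  refine Ensures.forUp (fun i s' => ∀ p < i, ∀ m < Γ.N,
    tableRow Γ.N s' p m = if m = 0 then 0 else Γ.top) hrows hB' rfl rfl (by simp) ?_ ?_
  · intro i s₁ hi hF hri hI
    have hs₁ := hs.frame hF rfl
    have hoff : s₁.arr A_off i = i * Γ.N := hs₁.off i (by omega)
    refine Ensures.seq ?_
    refine Ensures.forUp (fun j s' => (∀ p < i, ∀ m < Γ.N,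
        tableRow Γ.N s' p m = if m = 0 then 0 else Γ.top) ∧
      ∀ m < j, tableRow Γ.N s' i m = Γ.top) hs₁.reg_N hB rfl rfl ⟨hI, by simp⟩ ?_ ?_
    · intro j s₂ hj hF' hrj hI'
      have e1 : s₂.reg R_i = i := (hF'.reg _ rfl).trans hri
      have e2 : s₂.arr A_off = s₁.arr A_off := hF'.arr _ rfl
      have e3 : s₂.reg R_top = Γ.top := (hs₁.frame hF' rfl).reg_top
      refine Ensures.setCell ⟨fun p hp m hm => ?_, fun m hm => ?_⟩
      · have h := row_disjoint hm hp.ne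
        have hne : p * Γ.N + m ≠ i * Γ.N + j := by omega
        have := hI'.1 p hp m hm
        simp only [tableRow] at this ⊢
        simpa [e1, e2, hoff, hrj, hne] using this
      · have := hI'.2 m
        simp only [tableRow] at this ⊢
        by_cases hmj : m = j
        · simp [e1, e2, e3, hoff, hrj, hmj]
        · simpa [e1, e2, hoff, hrj, hmj] using this (by omega)
    · intro s₂ hF' hI'
      have e1 : s₂.reg R_i = i := (hF'.reg _ rfl).trans hri
      have e2 : s₂.arr A_off = s₁.arr A_off := hF'.arr _ rfl
      refine Ensures.setCell fun p hp m hm => ?_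
      simp only [tableRow, eval, e1, e2, hoff, writeReg_arr, writeCell_arr, if_true]
      by_cases hpi : p = i
      · subst hpi
        by_cases hm0 : m = 0
        · simp [hm0]
        · have := hI'.2 m hm
          simp only [tableRow] at this
          simpa [hm0] using this
      · have h := row_disjoint hm hpi
        have hne : p * Γ.N + m ≠ i * Γ.N := by omega
        have := hI'.1 p (by omega) m hm
        simp only [tableRow] at this
        simpa [hne] using this
  · intro s₁ _ hI p hp
    have h := hI p (by omega)
    refine ⟨fun ρ hρ => ?_, fun ρ hρ hlt => ?_, fun ρ c hρ hm => ?_⟩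
    · rw [h ρ hρ]; split_ifs <;> simp
    · rw [h ρ hρ] at hlt ⊢
      split_ifs at hlt with h0
      · exact ⟨0, by simp, by simp [h0]⟩
      · omega
    · simp only [Set.mem_singleton_iff, Prod.mk.injEq] at hm
      rw [h ρ hρ, if_pos hm.1]
      exact Nat.zero_le c

/-- Eliminates the vertices in order: adds the edges from `v` to its later neighbours to the table
of `v`, removes `v` from the bag and joins the result to the table of the parent. -/
def mainLoop : Prog :=
  .forUp R_i R_n <|
    .seq (.setReg R_v (.cell A_ord (.reg R_i))) <|
    .seq (.setReg R_p (.reg R_n)) <|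
    .seq (.forUp R_j R_n <|
      .seq (.setReg R_u (.cell A_ord (.minus (.minus (.reg R_n) (.lit 1)) (.reg R_j)))) <|
      .ite laterE
        (.seq (.setReg R_p (.reg R_u)) <|
          .seq (.setReg R_off (.cell A_off (.reg R_v))) <|
          .seq edgeTable convolve) .skip) <|
    .seq (.setReg R_off (.cell A_off (.reg R_v))) <|
    .seq forget <|
    .seq (.setReg R_off (.cell A_off (.reg R_p))) convolve

section

open scoped Pointwise
open Elim

/-- The inner loop adds the edges from `v` to its later neighbours. It traverses the order
backwards, so that at the end register `p` holds the first later neighbour of `v`. -/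
theorem mainLoop_inner_spec {n B i : ℕ} {Γ : Elim n} {s : State} (hs : HasSetup Γ s)
    (hB : Γ.N ≤ B) (hB' : n ≤ B) {owner : Fin n → ℕ} {v : Fin n} (hvi : Γ.pos v = i)
    (hv : s.reg R_v = v) (hp : s.reg R_p = n)
    (hT : Γ.Table (tableRow Γ.N s v) (Γ.subtree owner i v) (Γ.bag v)
      (degSet (Γ.subArcs owner i v))) :
    Ensures B (.forUp R_j R_n <|
      .seq (.setReg R_u (.cell A_ord (.minus (.minus (.reg R_n) (.lit 1)) (.reg R_j)))) <|
      .ite laterE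
        (.seq (.setReg R_p (.reg R_u)) <|
          .seq (.setReg R_off (.cell A_off (.reg R_v))) <|
          .seq edgeTable convolve) .skip) s fun s' =>
      Γ.Table (tableRow Γ.N s' v) (Γ.subtree owner i v) (Γ.bag v)
          (degSet (Γ.subArcs owner i v) + ∑ u ∈ Γ.later v, edgeSet v u) ∧
        (∀ p ≠ (v : ℕ), ∀ m < Γ.N, tableRow Γ.N s' p m = tableRow Γ.N s p m) ∧
        ((s'.reg R_p = n ∧ Γ.later v = ∅) ∨
          ∃ u ∈ Γ.later v, s'.reg R_p = u ∧ ∀ u' ∈ Γ.later v, Γ.pos u ≤ Γ.pos u') := by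
  set U : ℕ → Finset (Fin n) := fun j => (Γ.later v).filter fun u => n ≤ Γ.pos u + j with hU
  have hpos : ∀ u, Γ.pos u < n := by
    choose f hf using fun j : Fin n => hs.order.ord_eq j j.2
    have hinj : Function.Injective f := fun j j' h => Fin.ext <| by
      rw [← (hf j).2, ← (hf j').2, h]
    intro u
    obtain ⟨j, rfl⟩ := (Finite.injective_iff_surjective.1 hinj) u
    rw [(hf j).2]; exact j.2
  refine Ensures.forUp (fun j s' =>
      Γ.Table (tableRow Γ.N s' v) (Γ.subtree owner i v) (Γ.bag v)
          (degSet (Γ.subArcs owner i v) + ∑ u ∈ U j, edgeSet v u) ∧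
        (∀ p ≠ (v : ℕ), ∀ m < Γ.N, tableRow Γ.N s' p m = tableRow Γ.N s p m) ∧
        ((s'.reg R_p = n ∧ U j = ∅) ∨
          ∃ u ∈ U j, s'.reg R_p = u ∧ ∀ u' ∈ U j, Γ.pos u ≤ Γ.pos u'))
    hs.graph.reg_n hB' rfl rfl ?_ ?_ ?_
  · have : U 0 = ∅ := by
      rw [hU, Finset.filter_eq_empty_iff]
      intro u _ h
      have := hpos u
      omega
    rw [this]
    refine ⟨?_, fun _ _ _ _ => rfl, .inl ⟨by simp [hp], rfl⟩⟩
    rw [Finset.sum_empty, add_zero]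
    exact hT
  · intro j s₁ hj hF hrj hI
    have hs₁ := hs.frame hF rfl
    obtain ⟨u, hu, huj⟩ := hs₁.order.ord_eq (n - 1 - j) (by omega)
    have hv₁ : s₁.reg R_v = v := (hF.reg _ rfl).trans hv
    refine Ensures.seq (Ensures.setReg ?_)
    have hval : (Expr.cell A_ord (.minus (.minus (.reg R_n) (.lit 1)) (.reg R_j))).eval s₁ = u := by
      simp [hs₁.graph.reg_n, hrj, hu]
    rw [hval]
    have hs₂ := hs₁.writeReg R_u u rfl
    have hlater := holds_laterE (u := u) hs₂.graph hs₂.order.rank_eq (v := v) (by simp [hv₁])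
      (by simp)
    refine Ensures.cond (fun h => ?_) (fun h => Ensures.skip ?_)
    · have hul : u ∈ Γ.later v := hlater.1 h
      have hUj : U (j + 1) = insert u (U j) := by
        ext a
        simp only [hU, Finset.mem_filter, Finset.mem_insert]
        constructor
        · rintro ⟨h1, h2⟩
          by_cases ha : Γ.pos a = Γ.pos u
          · exact .inl (Γ.pos_inj ha)
          · exact .inr ⟨h1, by omega⟩
        · rintro (rfl | ⟨h1, h2⟩)
          · exact ⟨hul, by omega⟩
          · exact ⟨h1, by omega⟩
      have huU : u ∉ U j := by
        simp only [hU, Finset.mem_filter]; omega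
      refine Ensures.seq (Ensures.setReg (Ensures.seq (Ensures.setReg ?_)))
      set s₃ := ((s₁.writeReg R_u u).writeReg R_p _).writeReg R_off _ with hs₃d
      have hs₃ : HasSetup Γ s₃ := (hs₂.writeReg R_p _ rfl).writeReg R_off _ rfl
      have hoff₃ : s₃.reg R_off = v * Γ.N := by
        simp [hs₃d, hv₁, hs₁.off v v.2.le]
      have hv₃ : s₃.reg R_v = v := by simp [hs₃d, hv₁]
      have hu₃ : s₃.reg R_u = u := by simp [hs₃d]
      have hp₃ : s₃.reg R_p = u := by simp [hs₃d]
      refine Ensures.seq ((edgeTable_spec hs₃ hB hv₃ hu₃).mono fun s₄ hF₄ h₄ => ?_)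
      have hs₄ := hs₃.frame hF₄ rfl
      refine (convolve_spec hs₄ hB (o := v * Γ.N) ((hF₄.reg _ rfl).trans hoff₃)).mono
        fun s₅ hF₅ h₅ => ?_
      have hT₄ : s₄.arr A_T = s₁.arr A_T := hF₄.arr _ rfl
      refine ⟨?_, fun p hpv m hm => ?_, .inr ⟨u, ?_, ?_, ?_⟩⟩
      · have := Inv.edge hvi hul hI.1 h₄ (T := tableRow Γ.N s₅ v) (by
          have := h₅.1
          rw [hT₄] at this
          exact this)
        rw [hUj, Finset.sum_insert huU, add_comm (edgeSet v u), ← add_assoc]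
        exact this
      · rw [← hI.2.1 p hpv m hm]
        simp only [tableRow, writeReg_arr]
        rw [h₅.2 _ (row_disjoint hm hpv), hT₄]
      · rw [hUj]; exact Finset.mem_insert_self _ _
      · simp only [writeReg_reg]
        exact (hF₅.reg _ rfl).trans ((hF₄.reg _ rfl).trans hp₃)
      · intro u' hu'
        rw [hUj, Finset.mem_insert] at hu'
        rcases hu' with rfl | hu'
        · exact le_rfl
        · simp only [hU, Finset.mem_filter] at hu'
          omega
    · have hUj : U (j + 1) = U j := by
        ext a
        simp only [hU, Finset.mem_filter]
        constructor
        · rintro ⟨h1, h2⟩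
          refine ⟨h1, ?_⟩
          have : Γ.pos a ≠ Γ.pos u := fun ha => h (hlater.2 (Γ.pos_inj ha ▸ h1))
          omega
        · rintro ⟨h1, h2⟩
          exact ⟨h1, by omega⟩
      rw [hUj]
      exact ⟨hI.1, hI.2.1, by simpa using hI.2.2⟩
  · intro s₁ _ hI
    have : U n = Γ.later v := by
      simp only [hU]
      exact Finset.filter_true_of_mem fun u _ => Nat.le_add_left _ _
    rwa [this] at hI

theorem mainLoop_spec {n B : ℕ} {Γ : Elim n} {s : State} (hs : HasSetup Γ s)
    (hB : Γ.N + Γ.N ≤ B) (hB' : n ≤ B)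
    (h0 : ∀ p ≤ n, IsTable Γ.N Γ.top (tableRow Γ.N s p) {(0, 0)}) :
    Ensures B mainLoop s fun s' => ∃ owner, Γ.Inv n (tableRow Γ.N s') owner := by
  refine Ensures.forUp (fun i s' => ∃ owner, Γ.Inv i (tableRow Γ.N s') owner)
    hs.graph.reg_n hB' rfl rfl ⟨_, Inv.init h0⟩ ?_ fun _ _ h => h
  rintro i s₁ hi hF hri ⟨owner, hI⟩
  have hs₁ := hs.frame hF rfl
  obtain ⟨v, hv, hvi⟩ := hs₁.order.ord_eq i hi
  have hvA : Γ.Alive i v := .inr ⟨v, rfl, hvi.ge⟩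
  refine Ensures.seq (Ensures.setReg (Ensures.seq (Ensures.setReg (Ensures.seq ?_))))
  set s₂ := (s₁.writeReg R_v _).writeReg R_p _ with hs₂d
  have hs₂ : HasSetup Γ s₂ := (hs₁.writeReg R_v _ rfl).writeReg R_p _ rfl
  have hv₂ : s₂.reg R_v = v := by simp [hs₂d, hri, hv]
  have hp₂ : s₂.reg R_p = n := by simp [hs₂d, hs₁.graph.reg_n]
  refine (mainLoop_inner_spec hs₂ (by omega) hB' hvi hv₂ hp₂ (hI.table v hvA)).mono
    fun s₃ hF₃ ⟨hT₃, hrow₃, hp₃⟩ => ?_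
  have hs₃ := hs₂.frame hF₃ rfl
  have hv₃ : s₃.reg R_v = v := (hF₃.reg _ rfl).trans hv₂
  refine Ensures.seq (Ensures.setReg (Ensures.seq ?_))
  have hs₄ := hs₃.writeReg R_off ((Expr.cell A_off (.reg R_v)).eval s₃) rfl
  refine (forget_spec hs₄ hB (o := v * Γ.N) (v := v) ?_ (by simp [hv₃])).mono
    fun s₅ hF₅ h₅ => ?_
  · simp [hv₃, hs₃.off v v.2.le]
  have hs₅ := hs₄.frame hF₅ rfl
  have hT₅ : s₅.arr A_T = s₃.arr A_T := hF₅.arr _ rfl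
  have hp₅ : s₅.reg R_p = s₃.reg R_p := (hF₅.reg _ rfl).trans (by simp)
  have hpn : s₃.reg R_p ≤ n := by
    rcases hp₃ with h | ⟨u, _, h, _⟩
    · exact h.1.le
    · rw [h]; exact u.2.le
  have hpv : s₃.reg R_p ≠ v := by
    rcases hp₃ with h | ⟨u, hu, h, _⟩
    · rw [h.1]; exact v.2.ne'
    · rw [h]; intro huv
      rw [mem_later, Fin.ext huv] at hu
      exact lt_irrefl _ hu.2
  refine Ensures.seq (Ensures.setReg ?_)
  have hs₆ := hs₅.writeReg R_off ((Expr.cell A_off (.reg R_p)).eval s₅) rfl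
  refine (convolve_spec hs₆ (by omega) (o := s₃.reg R_p * Γ.N) ?_).mono fun s₇ hF₇ h₇ => ?_
  · simp [hp₅, hs₅.off _ hpn]
  -- Row `v` is no longer in use, and only the row of the parent changes.
  set row : ℕ → ℕ → ℕ := fun p => if p = v then tableRow Γ.N s₁ v else tableRow Γ.N s₅ p with hrow
  have hI' : Γ.Inv i row owner := by
    refine ⟨hI.alive, hI.mem_bag, hI.owner_eq, fun p hp => (hI.table p hp).congr fun m hm => ?_⟩
    by_cases hpv : p = v
    · simp [hrow, hpv]
    · simp only [hrow, if_neg hpv]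
      rw [tableRow, hT₅]
      exact hrow₃ p hpv m hm
  have hFt : Γ.Table (s₅.arr A_F) (insert v (Γ.subtree owner i v)) ((Γ.bag v).erase v)
      (degSet (Γ.subArcs owner i v) + ∑ u ∈ Γ.later v, edgeSet v u) := by
    refine IsTable.forget (bag_injOn hvA) (fun u _ => Γ.col_lt u) ?_ ?_ hT₃ h₅
    · rw [bag_coe]; exact Finset.mem_insert_self _ _
    · rw [mem_subtree]; omega
  refine hI'.step hvi hFt hp₃ ?_ ?_
  · simp only [hrow, if_neg hpv]
    exact h₇.1
  · intro p hp hpA m hm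
    have hpv' : p ≠ v := by
      rcases hpA with rfl | ⟨u, rfl, hu⟩
      · exact v.2.ne'
      · intro huv
        rw [Fin.ext huv] at hu; omega
    simp only [hrow, if_neg hpv']
    exact h₇.2 _ (row_disjoint hm hp)

end

/-! ### Reading off the solution -/

/-- The total weight of the solution `K` is `|K| 2 ^ n` plus the number with the binary digits of
`K`. Both are recovered by subtraction. -/
def decode : Prog :=
  .seq (.setReg R_val (.cell A_T (.cell A_off (.reg R_n)))) <|
  .seq (.setReg R_cnt (.lit 0)) <|
  .seq (.forUp R_j R_n <|
    .ite (.less (.reg R_val) (.reg R_big)) .skip <|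
      .seq (.setReg R_val (.minus (.reg R_val) (.reg R_big)))
        (.setReg R_cnt (.plus (.reg R_cnt) (.lit 1)))) <|
  .seq (.forUp R_j R_n <|
    .seq (.setReg R_u (.minus (.minus (.reg R_n) (.lit 1)) (.reg R_j))) <|
    .ite (.less (.reg R_val) (.cell A_two (.reg R_u))) .skip <|
      .seq (.setCell A_out (.reg R_u) (.lit 1))
        (.setReg R_val (.minus (.reg R_val) (.cell A_two (.reg R_u))))) <|
  .setReg R_n (.reg R_cnt)

theorem sum_two_pow_lt {n : ℕ} (K : Finset (Fin n)) (m : ℕ) :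
    ∑ v ∈ K.filter (fun v : Fin n => (v : ℕ) < m), 2 ^ (v : ℕ) < 2 ^ m := by
  have h := Nat.geomSum_lt (m := 2) (n := m) le_rfl
    (s := (K.filter fun v : Fin n => (v : ℕ) < m).map Fin.valEmbedding) (by
      simp only [Finset.mem_map, Finset.mem_filter]
      rintro _ ⟨v, hv, rfl⟩
      exact hv.2)
  rwa [Finset.sum_map] at h

theorem decode_spec {n B : ℕ} {s : State} (hn : s.reg R_n = n) (hB : n ≤ B)
    (hbig : s.reg R_big = 2 ^ n) (htwo : ∀ i ≤ n, s.arr A_two i = 2 ^ i)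
    (hout : ∀ i, s.arr A_out i = 0) {K : Finset (Fin n)}
    (hK : s.arr A_T (s.arr A_off n) = ∑ v ∈ K, (2 ^ n + 2 ^ (v : ℕ))) :
    Ensures B decode s fun s' => s'.reg R_n = K.card ∧
      ∀ v : Fin n, s'.arr A_out v = if v ∈ K then 1 else 0 := by
  have hsumlt := sum_two_pow_lt K n
  rw [Finset.filter_true_of_mem fun v _ => v.2] at hsumlt
  rw [Finset.sum_add_distrib, Finset.sum_const, smul_eq_mul] at hK
  have hcard : K.card ≤ n := by simpa using Finset.card_le_univ K
  refine Ensures.seq (Ensures.setReg (Ensures.seq (Ensures.setReg (Ensures.seq ?_))))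
  set s₁ := (s.writeReg R_val _).writeReg R_cnt _ with hs₁
  refine Ensures.forUp (M := n) (fun j s' => s'.reg R_cnt = min j K.card ∧
      s'.reg R_val = (K.card - min j K.card) * 2 ^ n + ∑ v ∈ K, 2 ^ (v : ℕ))
    (by simp [hs₁, hn]) hB rfl rfl (by simp [hs₁, hn, hK]) ?_ ?_
  · intro j s₂ hj hF hrj hI
    have e1 : s₂.reg R_big = 2 ^ n := (hF.reg _ rfl).trans (by simp [hs₁, hbig])
    refine Ensures.cond (fun h => Ensures.skip ?_) (fun h => Ensures.seq (Ensures.setReg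
      (Ensures.setReg ?_)))
    · simp only [holds_less, eval, hI.2, e1] at h
      have h0 : K.card - min j K.card = 0 := by
        by_contra hne
        have := Nat.mul_le_mul_right (2 ^ n) (Nat.one_le_iff_ne_zero.2 hne)
        omega
      have h1 : min (j + 1) K.card = min j K.card := by omega
      simp [h1, hI.1, hI.2]
    · simp only [holds_less, eval, hI.2, e1, not_lt] at h
      have h0 : K.card - min j K.card ≠ 0 := by
        intro h0
        rw [h0] at h
        omega
      have h1 : min (j + 1) K.card = min j K.card + 1 := by omega
      have h2 : K.card - min j K.card = (K.card - (min j K.card + 1)) + 1 := by omega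
      rw [h1]
      refine ⟨by simp [hI.1], ?_⟩
      simp only [writeReg_reg, eval]
      simp only [hI.2, e1]
      simp only [show ¬ R_val = R_j by decide, show ¬ R_val = R_cnt by decide, if_false, if_true]
      rw [h2, Nat.succ_mul]
      omega
  · intro s₂ hF hI
    rw [min_eq_right hcard, Nat.sub_self, zero_mul, zero_add] at hI
    refine Ensures.seq ?_
    refine Ensures.forUp (M := n) (fun j s' =>
        s'.reg R_val = ∑ v ∈ K.filter (fun v : Fin n => (v : ℕ) < n - j), 2 ^ (v : ℕ) ∧
        ∀ v : Fin n, s'.arr A_out v = if n ≤ v + j ∧ v ∈ K then 1 else 0)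
      ((hF.reg _ rfl).trans (by simp [hs₁, hn])) hB rfl rfl ?_ ?_ ?_
    · refine ⟨?_, fun v => ?_⟩
      · rw [Finset.filter_true_of_mem fun v _ => by rw [Nat.sub_zero]; exact v.2]
        simp [hI.2]
      · have : s₂.arr A_out = s.arr A_out := hF.arr _ rfl
        rw [if_neg (by have := v.2; omega), writeReg_arr, this, hout]
    · intro j s₃ hj hF' hrj hI'
      have e1 : s₃.reg R_n = n :=
        (hF'.reg _ rfl).trans ((hF.reg _ rfl).trans (by simp [hs₁, hn]))
      have e2 : s₃.arr A_two = s.arr A_two := (hF'.arr _ rfl).trans (hF.arr _ rfl)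
      set u : Fin n := ⟨n - 1 - j, by omega⟩ with hu
      have huv : (u : ℕ) = n - 1 - j := rfl
      have hnj : n - j = u + 1 := by omega
      have hnj' : n - (j + 1) = u := by omega
      have hfil : (K.filter fun v : Fin n => (v : ℕ) < n - j) =
          if u ∈ K then insert u (K.filter fun v : Fin n => (v : ℕ) < u)
          else K.filter fun v : Fin n => (v : ℕ) < u := by
        ext a
        have : (a : ℕ) < n - j ↔ a = u ∨ (a : ℕ) < u := by rw [Fin.ext_iff]; omega
        split_ifs with huK
        · simp only [Finset.mem_filter, Finset.mem_insert, this]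
          constructor
          · tauto
          · rintro (rfl | h)
            · exact ⟨huK, .inl rfl⟩
            · exact ⟨h.1, .inr h.2⟩
        · simp only [Finset.mem_filter, this]
          constructor
          · rintro ⟨h, rfl | h'⟩
            · exact absurd h huK
            · exact ⟨h, h'⟩
          · tauto
      have hsum : ∑ v ∈ K.filter (fun v : Fin n => (v : ℕ) < n - j), 2 ^ (v : ℕ) =
          (if u ∈ K then 2 ^ (u : ℕ) else 0) +
            ∑ v ∈ K.filter (fun v : Fin n => (v : ℕ) < (u : ℕ)), 2 ^ (v : ℕ) := by
        rw [hfil]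
        split_ifs
        · rw [Finset.sum_insert (by simp)]
        · simp
      have hlt := sum_two_pow_lt K u
      rw [hsum] at hI'
      have hle : ∀ v : Fin n, n ≤ v + (j + 1) ↔ n ≤ v + j ∨ v = u := by
        intro v; rw [Fin.ext_iff]; omega
      have hun : ¬ n ≤ u + j := by omega
      refine Ensures.seq (Ensures.setReg (Ensures.cond (fun h => Ensures.skip ?_)
        (fun h => Ensures.seq (Ensures.setCell (Ensures.setReg ?_)))))
      all_goals
        have e3 : (Expr.minus (.minus (.reg R_n) (.lit 1)) (.reg R_j)).eval s₃ = u := by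
          simp [e1, hrj, huv]
        rw [e3] at h ⊢
        simp only [holds_less, eval, writeReg_reg, writeReg_arr, if_true, e2, htwo u u.2.le,
          show ¬ R_val = R_u by decide, if_false, hI'.1, not_lt] at h
      · have huK : u ∉ K := by
          intro huK
          rw [if_pos huK] at h; omega
        rw [hnj']
        refine ⟨by simp [hI'.1, huK], fun v => ?_⟩
        simp only [writeReg_arr, hI'.2, hle]
        by_cases hvu : v = u
        · simp [hvu, huK]
        · simp [hvu]
      · have huK : u ∈ K := by
          by_contra huK
          rw [if_neg huK] at h; omega
        rw [hnj']
        refine ⟨by simp [hI'.1, huK, e2, htwo u u.2.le], fun v => ?_⟩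
        simp only [writeReg_arr, writeCell_arr, if_true, eval, writeReg_reg, hle,
          Function.update_apply]
        by_cases hvu : v = u
        · simp [hvu, huK]
        · have : (v : ℕ) ≠ u := fun h => hvu (Fin.ext h)
          simp [hvu, this, hI'.2]
    · intro s₃ hF' hI'
      refine Ensures.setReg ⟨?_, fun v => ?_⟩
      · have : s₃.reg R_cnt = K.card := (hF'.reg _ rfl).trans hI.1
        simp [this]
      · rw [writeReg_arr, hI'.2]
        simp

/-! ### The algorithm -/

/-- Computes a perfect elimination order and a colouring. -/
def prepare : Prog :=
  .seq (.setReg R_base (.plus (.plus (.reg R_d) (.reg R_d)) (.lit 3))) <|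
  .seq (.setReg R_two (.lit 2)) <|
  .seq (.setReg R_rows (.plus (.reg R_n) (.lit 1))) <|
  .seq (multiples A_row R_n) <|
  .seq elimOrder colouring

/-- What is known after `prepare`. -/
structure Prepared {n : ℕ} (G : SimpleGraph (Fin n)) (d : ℕ) (pos : Fin n → ℕ) (s : State) :
    Prop where
  graph : HasGraph G s
  order : HasOrder pos s
  colouring : PartialColouring G pos n (s.reg R_q) (s.arr A_col)
  pos_inj : Function.Injective pos
  pos_lt : ∀ v, pos v < n
  peo : ∀ v a b, G.Adj v a → G.Adj v b → pos v < pos a → pos v < pos b → a ≠ b → G.Adj a b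
  reg_d : s.reg R_d = d
  reg_base : s.reg R_base = 2 * d + 3
  reg_two : s.reg R_two = 2
  reg_rows : s.reg R_rows = n + 1
  zero : ∀ i, s.arr A_out i = 0 ∧ s.arr A_cap i = 0 ∧ s.arr A_off i = 0 ∧ s.arr A_big i = 0

theorem prepare_spec {n B : ℕ} {G : SimpleGraph (Fin n)} (hG : IsChordal G) (d k : ℕ) (hB : n ≤ B) :
    Ensures B prepare (inputState G d k) fun s => s.reg R_k = k ∧ ∃ pos, Prepared G d pos s := by
  set s₀ := inputState G d k with hs₀
  have hn : s₀.reg R_n = n := by simp [hs₀, inputState]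
  have hd : s₀.reg R_d = d := by simp [hs₀, inputState]
  have hk : s₀.reg R_k = k := by simp [hs₀, inputState]
  have hzero : ∀ a ≠ A_adj, ∀ i, s₀.arr a i = 0 := fun a ha i => by simp [hs₀, inputState, ha]
  have hadj : ∀ u v : Fin n, s₀.arr A_adj (u * n + v) ≠ 0 ↔ G.Adj u v := by
    intro u v
    have h : (∃ u' v' : Fin n, G.Adj u' v' ∧ (u : ℕ) * n + v = u' * n + v') ↔ G.Adj u v := by
      constructor
      · rintro ⟨u', v', h, he⟩
        have hn0 : 0 < n := u.pos
        have h1 : ((u : ℕ) * n + v) / n = u := by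
          rw [mul_comm, Nat.mul_add_div hn0, Nat.div_eq_of_lt v.2, add_zero]
        have h2 : ((u' : ℕ) * n + v') / n = u' := by
          rw [mul_comm, Nat.mul_add_div hn0, Nat.div_eq_of_lt v'.2, add_zero]
        have hu : u = u' := Fin.ext (by rw [← h1, he, h2])
        subst hu
        have hv : v = v' := Fin.ext (by omega)
        exact hv ▸ h
      · exact fun h => ⟨u, v, h, rfl⟩
    rw [← h]
    simp [hs₀, inputState]
  refine Ensures.seq (Ensures.setReg (Ensures.seq (Ensures.setReg (Ensures.seq
    (Ensures.setReg (Ensures.seq ?_))))))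
  set s₁ := ((s₀.writeReg R_base _).writeReg R_two _).writeReg R_rows _ with hs₁
  have hn₁ : s₁.reg R_n = n := by simp [hs₁, hn]
  have harr₁ : s₁.arr = s₀.arr := rfl
  refine (multiples_spec (a := A_row) (r := R_n) (s := s₁) (by decide)
    (by rw [harr₁, hzero _ (by decide)]) (hn₁.le.trans hB)).mono fun s₂ hF₂ h₂ => Ensures.seq ?_
  rw [hn₁] at h₂
  have hg₂ : HasGraph G s₂ := by
    refine ⟨(hF₂.reg _ rfl).trans hn₁, fun u => h₂ u u.2.le, ?_⟩
    rw [hF₂.arr _ rfl, harr₁]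
    exact hadj
  refine (elimOrder_spec hG hg₂ hB fun v => ?_).mono
    fun s₃ hF₃ ⟨pos, hinj, hlt, hord, hpeo⟩ => ?_
  · rw [hF₂.arr _ rfl, harr₁, hzero _ (by decide)]
  have hg₃ := hg₂.frame hF₃ rfl rfl rfl
  refine (colouring_spec hg₃ hord hinj hB).mono fun s₄ hF₄ hcol => ?_
  have hreg : ∀ x, (multiples A_row R_n).writesReg x = false → elimOrder.writesReg x = false →
      colouring.writesReg x = false → s₄.reg x = s₁.reg x := fun x h1 h2 h3 =>
    (hF₄.reg x h3).trans ((hF₃.reg x h2).trans (hF₂.reg x h1))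
  have harr : ∀ a ≠ A_adj, (multiples A_row R_n).writesArr a = false →
      elimOrder.writesArr a = false → colouring.writesArr a = false → ∀ i, s₄.arr a i = 0 :=
    fun a ha h1 h2 h3 i => by
      rw [hF₄.arr a h3, hF₃.arr a h2, hF₂.arr a h1, harr₁, hzero a ha]
  refine ⟨?_, pos, ?_⟩
  · rw [hreg _ rfl rfl rfl]; simp [hs₁, hk]
  · exact
      { graph := hg₃.frame hF₄ rfl rfl rfl
        order := ⟨hF₄.arr A_pos rfl ▸ hord.rank_eq, hF₄.arr A_ord rfl ▸ hord.ord_eq⟩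
        colouring := hcol
        pos_inj := hinj
        pos_lt := hlt
        peo := hpeo
        reg_d := by rw [hreg _ rfl rfl rfl]; simp [hs₁, hd]
        reg_base := by rw [hreg _ rfl rfl rfl]; simp [hs₁, hd]; omega
        reg_two := by rw [hreg _ rfl rfl rfl]; simp [hs₁]
        reg_rows := by rw [hreg _ rfl rfl rfl]; simp [hs₁, hn]
        zero := fun i => ⟨harr _ (by decide) rfl rfl rfl i, harr _ (by decide) rfl rfl rfl i,
          harr _ (by decide) rfl rfl rfl i, harr _ (by decide) rfl rfl rfl i⟩ }

/-- Tabulates the constants of the dynamic program, runs it and reads off a solution. -/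
def optimise : Prog :=
  .seq (powers A_pow R_base) <|
  .seq (powers A_two R_two) <|
  .seq (.setReg R_N (.cell A_pow (.reg R_q))) <|
  .seq (.setReg R_NN (.plus (.reg R_N) (.reg R_N))) <|
  .seq (.setReg R_big (.cell A_two (.reg R_n))) <|
  .seq (multiples A_big R_big) <|
  .seq (.setReg R_top
    (.plus (.plus (.cell A_big (.reg R_n)) (.cell A_big (.reg R_n))) (.lit 1))) <|
  .seq capTable <|
  .seq (multiples A_off R_N) <|
  .seq initTables <|
  .seq mainLoop decode

/-- The elimination on which the dynamic program runs. The weights are such that a deletion set of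
least weight has least cardinality and can be recovered from its weight. -/
def Prepared.elim {n : ℕ} {G : SimpleGraph (Fin n)} {d : ℕ} {pos : Fin n → ℕ} {s : State}
    (h : Prepared G d pos s) : Elim n where
  G := G
  d := d
  q := s.reg R_q
  top := n * 2 ^ n + n * 2 ^ n + 1
  pos := pos
  col := fun v => s.arr A_col v
  w := fun v => 2 ^ n + 2 ^ (v : ℕ)
  pos_inj := h.pos_inj
  peo := h.peo
  col_lt := fun v => h.colouring.lt v (Nat.le_add_left _ _)
  col_ne := fun v u hu hlt =>
    h.colouring.ne v (Nat.le_add_left _ _) u (mem_laterNbs.2 ⟨hu, hlt⟩)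

theorem Prepared.q_le {n : ℕ} {G : SimpleGraph (Fin n)} {d : ℕ} {pos : Fin n → ℕ} {s : State}
    (h : Prepared G d pos s) : s.reg R_q ≤ n := by
  rcases h.colouring.q_le with h | ⟨v, hv⟩
  · omega
  · have : (laterNbs G pos v).card < (Finset.univ : Finset (Fin n)).card := by
      refine Finset.card_lt_card ((Finset.ssubset_univ_iff).2 fun h => ?_)
      have := mem_laterNbs.1 (h ▸ Finset.mem_univ v)
      omega
    rw [Finset.card_univ, Fintype.card_fin] at this
    omega

/-- An orientation in which the vertices of in-degree more than `d` have least total weight yields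
a smallest deletion set. -/
theorem isMinDeletionSet_of_weight {n d : ℕ} {G : SimpleGraph (Fin n)} {pos : Fin n → ℕ}
    (hpos : Function.Injective pos) {x : Fin n → ℕ} (hx : x ∈ degSet (arcs G pos))
    (hmin : ∀ y ∈ degSet (arcs G pos), (∑ v, if d < x v then 2 ^ n + 2 ^ (v : ℕ) else 0) ≤
      ∑ v, if d < y v then 2 ^ n + 2 ^ (v : ℕ) else 0) :
    IsMinDeletionSet G d (Finset.univ.filter fun v => d < x v) := by
  refine ⟨isDeletionSet_of_mem_degSet hpos hx, fun K hK => ?_⟩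
  obtain ⟨y, hy, hyK⟩ := exists_mem_degSet_of_isDeletionSet pos hK
  have h1 : (∑ v, if d < y v then 2 ^ n + 2 ^ (v : ℕ) else 0) ≤ ∑ v ∈ K, (2 ^ n + 2 ^ (v : ℕ)) := by
    rw [← Finset.sum_filter]
    refine Finset.sum_le_sum_of_subset fun v hv => ?_
    rw [Finset.mem_filter] at hv
    by_contra hvK
    exact absurd (hyK v hvK) (by omega)
  -- As `∑ v, 2 ^ v < 2 ^ n`, comparing the weights compares the cardinalities first.
  have h2 := (hmin y hy).trans h1
  rw [← Finset.sum_filter, Finset.sum_add_distrib, Finset.sum_add_distrib, Finset.sum_const,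
    Finset.sum_const, smul_eq_mul, smul_eq_mul] at h2
  have h3 := sum_two_pow_lt K n
  rw [Finset.filter_true_of_mem fun v _ => v.2] at h3
  by_contra hlt
  push Not at hlt
  have h4 := Nat.mul_le_mul_right (2 ^ n) (Nat.succ_le_of_lt hlt)
  rw [Nat.succ_mul] at h4
  omega

theorem optimise_spec {n B d : ℕ} {G : SimpleGraph (Fin n)} {pos : Fin n → ℕ} {s : State}
    (h : Prepared G d pos s) (hB : n + 1 ≤ B) (hB' : 2 * d + 3 ≤ B)
    (hBN : (2 * d + 3) ^ s.reg R_q + (2 * d + 3) ^ s.reg R_q ≤ B) :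
    Ensures B optimise s fun s' => ∃ K, IsMinDeletionSet G d K ∧ s'.reg R_n = K.card ∧
      ∀ v : Fin n, s'.arr A_out v = if v ∈ K then 1 else 0 := by
  have hn := h.graph.reg_n
  have hN0 : 0 < (2 * d + 3) ^ s.reg R_q := Nat.pow_pos (by omega)
  refine Ensures.seq ((powers_spec (by decide) (by decide) (by decide) (by omega)
    (by rw [h.reg_base]; exact hB')).mono fun s₁ hF₁ h₁ => Ensures.seq ?_)
  rw [hn, h.reg_base] at h₁
  have hn₁ : s₁.reg R_n = n := (hF₁.reg _ rfl).trans hn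
  have htwo₁ : s₁.reg R_two = 2 := (hF₁.reg _ rfl).trans h.reg_two
  refine (powers_spec (by decide) (by decide) (by decide) (by omega) (by omega)).mono
    fun s₂ hF₂ h₂ => ?_
  rw [hn₁, htwo₁] at h₂
  have hn₂ : s₂.reg R_n = n := (hF₂.reg _ rfl).trans hn₁
  have hq₂ : s₂.reg R_q = s.reg R_q := (hF₂.reg _ rfl).trans (hF₁.reg _ rfl)
  have hpow₂ : ∀ c ≤ n, s₂.arr A_pow c = (2 * d + 3) ^ c := by
    rw [hF₂.arr _ rfl]; exact h₁
  refine Ensures.seq (Ensures.setReg (Ensures.seq (Ensures.setReg (Ensures.seq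
    (Ensures.setReg (Ensures.seq ?_))))))
  set s₃ := ((s₂.writeReg R_N _).writeReg R_NN _).writeReg R_big _ with hs₃
  have hn₃ : s₃.reg R_n = n := by simp [hs₃, hn₂]
  have hN₃ : s₃.reg R_N = (2 * d + 3) ^ s.reg R_q := by simp [hs₃, hq₂, hpow₂ _ h.q_le]
  have hNN₃ : s₃.reg R_NN = (2 * d + 3) ^ s.reg R_q + (2 * d + 3) ^ s.reg R_q := by
    simp [hs₃, hq₂, hpow₂ _ h.q_le]
  have hbig₃ : s₃.reg R_big = 2 ^ n := by simp [hs₃, hn₂, h₂]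
  have hreg₃ : ∀ x, (powers A_pow R_base).writesReg x = false →
      (powers A_two R_two).writesReg x = false → x ≠ R_N → x ≠ R_NN → x ≠ R_big →
      s₃.reg x = s.reg x := fun x h1 h2 h3 h4 h5 => by
    simp [hs₃, h3, h4, h5, hF₂.reg x h2, hF₁.reg x h1]
  have harr₃ : ∀ a, a ≠ A_pow → a ≠ A_two → s₃.arr a = s.arr a := fun a h1 h2 =>
    (hF₂.arr a (by simp [powers, forUp, writesArr, h2])).trans
      (hF₁.arr a (by simp [powers, forUp, writesArr, h1]))
  refine (multiples_spec (by decide)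
    (by rw [harr₃ _ (by decide) (by decide)]; exact (h.zero 0).2.2.2) (by omega)).mono
    fun s₄ hF₄ h₄ => Ensures.seq (Ensures.setReg ?_)
  rw [hn₃, hbig₃] at h₄
  have hn₄ : s₄.reg R_n = n := (hF₄.reg _ rfl).trans hn₃
  set s₅ := s₄.writeReg R_top _ with hs₅
  have htop₅ : s₅.reg R_top = n * 2 ^ n + n * 2 ^ n + 1 := by simp [hs₅, hn₄, h₄]
  have hreg₅ : ∀ x, (multiples A_big R_big).writesReg x = false → x ≠ R_top →
      s₅.reg x = s₃.reg x := fun x h1 h2 => by simp [hs₅, h2, hF₄.reg x h1]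
  have harr₅ : ∀ a, a ≠ A_big → s₅.arr a = s₃.arr a := fun a h1 =>
    hF₄.arr a (by simp [multiples, forUp, writesArr, h1])
  refine Ensures.seq ((capTable_spec (s := s₅) (d := d) (q := s.reg R_q)
    (M := (2 * d + 3) ^ s.reg R_q + (2 * d + 3) ^ s.reg R_q) ?_ ?_ ?_ ?_ hBN ?_ ?_ ?_).mono
    fun s₆ hF₆ h₆ => ?_)
  · rw [hreg₅ _ rfl (by decide), hreg₃ _ rfl rfl (by decide) (by decide) (by decide), h.reg_d]
  · rw [hreg₅ _ rfl (by decide), hreg₃ _ rfl rfl (by decide) (by decide) (by decide), h.reg_base]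
  · rw [hreg₅ _ rfl (by decide), hreg₃ _ rfl rfl (by decide) (by decide) (by decide)]
  · rw [hreg₅ _ rfl (by decide), hNN₃]
  · have := h.q_le; omega
  · intro c hc
    rw [harr₅ _ (by decide)]
    exact hpow₂ c (by have := h.q_le; omega)
  · intro m
    rw [harr₅ _ (by decide), harr₃ _ (by decide) (by decide)]
    exact (h.zero m).2.1
  have hreg₆ : ∀ x, capTable.writesReg x = false → s₆.reg x = s₅.reg x := fun x h1 => hF₆.reg x h1
  have harr₆ : ∀ a, capTable.writesArr a = false → s₆.arr a = s₅.arr a := fun a h1 => hF₆.arr a h1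
  have hn₆ : s₆.reg R_n = n := by
    rw [hreg₆ _ rfl, hreg₅ _ rfl (by decide), hn₃]
  have hN₆ : s₆.reg R_N = (2 * d + 3) ^ s.reg R_q := by
    rw [hreg₆ _ rfl, hreg₅ _ rfl (by decide), hN₃]
  refine Ensures.seq ((multiples_spec (by decide) ?_ (by omega)).mono fun s₇ hF₇ h₇ => ?_)
  · rw [harr₆ _ rfl, harr₅ _ (by decide), harr₃ _ (by decide) (by decide)]
    exact (h.zero 0).2.2.1
  rw [hn₆, hN₆] at h₇
  have hreg₇ : ∀ x, (multiples A_off R_N).writesReg x = false → capTable.writesReg x = false →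
      (multiples A_big R_big).writesReg x = false → x ≠ R_top → s₇.reg x = s₃.reg x :=
    fun x h1 h2 h3 h4 => by rw [hF₇.reg x h1, hreg₆ x h2, hreg₅ x h3 h4]
  have harr₇ : ∀ a, a ≠ A_off → capTable.writesArr a = false → a ≠ A_big →
      s₇.arr a = s₃.arr a := fun a h1 h2 h3 => by
    rw [hF₇.arr a (by simp [multiples, forUp, writesArr, h1]), harr₆ a h2, harr₅ a h3]
  have hs₇ : HasSetup h.elim s₇ :=
    { graph := by
        refine h.graph.congr ?_ ?_ ?_
        · rw [hreg₇ _ rfl rfl rfl (by decide), hn₃, hn]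
        · rw [harr₇ _ (by decide) rfl (by decide), harr₃ _ (by decide) (by decide)]
        · rw [harr₇ _ (by decide) rfl (by decide), harr₃ _ (by decide) (by decide)]
      order := by
        refine ⟨?_, ?_⟩
        · rw [harr₇ _ (by decide) rfl (by decide), harr₃ _ (by decide) (by decide)]
          exact h.order.rank_eq
        · rw [harr₇ _ (by decide) rfl (by decide), harr₃ _ (by decide) (by decide)]
          exact h.order.ord_eq
      col := by
        rw [harr₇ _ (by decide) rfl (by decide), harr₃ _ (by decide) (by decide)]
        exact fun v => rfl
      reg_d := by
        rw [hreg₇ _ rfl rfl rfl (by decide), hreg₃ _ rfl rfl (by decide) (by decide) (by decide)]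
        exact h.reg_d
      reg_base := by
        rw [hreg₇ _ rfl rfl rfl (by decide), hreg₃ _ rfl rfl (by decide) (by decide) (by decide)]
        exact h.reg_base
      reg_N := by rw [hreg₇ _ rfl rfl rfl (by decide)]; exact hN₃
      reg_NN := by rw [hreg₇ _ rfl rfl rfl (by decide)]; exact hNN₃
      reg_top := by rw [hF₇.reg _ rfl, hreg₆ _ rfl]; exact htop₅
      pow := by
        rw [harr₇ _ (by decide) rfl (by decide)]
        exact fun c hc => hpow₂ c (by have : c < s.reg R_q := hc; have := h.q_le; omega)
      weight := by
        intro v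
        rw [hreg₇ _ rfl rfl rfl (by decide), hbig₃, harr₇ _ (by decide) rfl (by decide)]
        exact congrArg (2 ^ n + ·) (h₂ v v.2.le)
      cap := by
        rw [hF₇.arr _ rfl]
        exact h₆
      off := h₇ }
  have hΓN : h.elim.N = (2 * d + 3) ^ s.reg R_q := rfl
  refine Ensures.seq ((initTables_spec hs₇ (by omega) ?_ hB).mono fun s₈ hF₈ h₈ => ?_)
  · rw [hreg₇ _ rfl rfl rfl (by decide), hreg₃ _ rfl rfl (by decide) (by decide) (by decide)]
    exact h.reg_rows
  have hs₈ := hs₇.frame hF₈ rfl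
  refine Ensures.seq ((mainLoop_spec hs₈ (by omega) (by omega) h₈).mono
    fun s₉ hF₉ ⟨owner, h₉⟩ => ?_)
  have hs₉ := hs₈.frame hF₉ rfl
  have hw : ∑ v, h.elim.w v < h.elim.top := by
    have h1 : ∑ v : Fin n, (2 ^ n + 2 ^ (v : ℕ)) ≤ ∑ _v : Fin n, (2 ^ n + 2 ^ n) :=
      Finset.sum_le_sum fun v _ =>
        Nat.add_le_add_left (Nat.pow_le_pow_right (by omega) v.2.le) _
    rw [Finset.sum_const, Finset.card_univ, Fintype.card_fin, smul_eq_mul, mul_add] at h1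
    exact Nat.lt_succ_of_le h1
  obtain ⟨⟨x, hx, hx'⟩, hmin⟩ := h₉.final h.pos_lt hw
  refine (decode_spec hs₉.graph.reg_n (by omega) ?_ ?_ ?_
    (K := Finset.univ.filter fun v => d < x v) ?_).mono fun s' _ hs' => ⟨_, ?_, hs'⟩
  · rw [hF₉.reg _ rfl, hF₈.reg _ rfl, hreg₇ _ rfl rfl rfl (by decide), hbig₃]
  · rw [hF₉.arr _ rfl, hF₈.arr _ rfl, harr₇ _ (by decide) rfl (by decide)]
    exact h₂
  · intro i
    rw [hF₉.arr _ rfl, hF₈.arr _ rfl, harr₇ _ (by decide) rfl (by decide),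
      harr₃ _ (by decide) (by decide)]
    exact (h.zero i).1
  · rw [hs₉.off n le_rfl, Finset.sum_filter]
    exact hx'
  · exact isMinDeletionSet_of_weight h.pos_inj hx fun y hy => hx' ▸ hmin y hy

/-! ### Running time -/

theorem base_pow_le (d k : ℕ) :
    (2 * d + 3) ^ (2 * d + 1 + k) ≤ 3 * (max d 2) ^ (9 * (d + k)) := by
  rcases Nat.eq_zero_or_pos d with rfl | hd
  · have h1 : 3 ^ k ≤ (2 ^ 9) ^ k := Nat.pow_le_pow_left (by norm_num) k
    rw [← pow_mul] at h1
    simp only [Nat.mul_zero, Nat.zero_add, pow_add, pow_one, Nat.zero_max]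
    exact Nat.mul_le_mul_left 3 h1
  · set M := max d 2 with hM
    have h2 : 2 ≤ M := le_max_right _ _
    have hdM : d ≤ M := le_max_left _ _
    have h1 : 2 * d + 3 ≤ M ^ 3 := by
      rcases Nat.lt_or_ge d 3 with h | h
      · have : M = 2 := by omega
        rw [this]; omega
      · have : M = d := by omega
        rw [this]
        nlinarith [Nat.mul_le_mul h h, Nat.mul_le_mul (Nat.mul_le_mul h h) (le_refl d)]
    calc (2 * d + 3) ^ (2 * d + 1 + k) ≤ (M ^ 3) ^ (2 * d + 1 + k) := Nat.pow_le_pow_left h1 _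
      _ = M ^ (3 * (2 * d + 1 + k)) := (pow_mul _ _ _).symm
      _ ≤ M ^ (9 * (d + k)) := Nat.pow_le_pow_right (by omega) (by omega)
      _ ≤ 3 * M ^ (9 * (d + k)) := Nat.le_mul_of_pos_left _ (by omega)

/-- A bound for the number of rounds of every loop, provided that there are at most `2 d + 1 + k`
colours. -/
def rounds (n d k : ℕ) : ℕ := (n + 1) + 3 * (2 * d + 3) ^ (2 * d + 1 + k)

theorem base_le_rounds (n d k : ℕ) : 2 * d + 3 ≤ rounds n d k := by
  have : (2 * d + 3) ^ 1 ≤ (2 * d + 3) ^ (2 * d + 1 + k) :=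
    Nat.pow_le_pow_right (by omega) (by omega)
  rw [pow_one] at this
  rw [rounds]
  omega

theorem states_le_rounds {n d k q : ℕ} (hq : q ≤ 2 * d + 1 + k) :
    (2 * d + 3) ^ q + (2 * d + 3) ^ q ≤ rounds n d k := by
  have : (2 * d + 3) ^ q ≤ (2 * d + 3) ^ (2 * d + 1 + k) := Nat.pow_le_pow_right (by omega) hq
  rw [rounds]
  omega

theorem exists_timeBound (p : Prog) :
    ∃ c, ∀ n d k, p.time (rounds n d k) ≤ timeBound c n d k := by
  obtain ⟨C, e, h⟩ := p.exists_time_le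
  refine ⟨C * 10 ^ e + 9 * e + e, fun n d k => ?_⟩
  set M := max d 2 with hM
  have hM1 : 1 ≤ M := by omega
  have hB : rounds n d k ≤ 10 * (n + 1) * M ^ (9 * (d + k)) := by
    have h1 := base_pow_le d k
    have h2 : 1 ≤ M ^ (9 * (d + k)) := Nat.one_le_pow _ _ hM1
    rw [← hM] at h1
    have h3 : n + 1 ≤ (n + 1) * M ^ (9 * (d + k)) := Nat.le_mul_of_pos_right _ h2
    have h4 : M ^ (9 * (d + k)) ≤ (n + 1) * M ^ (9 * (d + k)) :=
      Nat.le_mul_of_pos_left _ (Nat.succ_pos n)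
    rw [rounds, mul_assoc]
    omega
  calc p.time (rounds n d k) ≤ C * rounds n d k ^ e := h _ (by rw [rounds]; omega)
    _ ≤ C * (10 * (n + 1) * M ^ (9 * (d + k))) ^ e :=
        Nat.mul_le_mul_left _ (Nat.pow_le_pow_left hB e)
    _ = C * 10 ^ e * M ^ (9 * e * (d + k)) * (n + 1) ^ e := by
        rw [mul_pow, mul_pow, ← pow_mul]; ring
    _ ≤ timeBound (C * 10 ^ e + 9 * e + e) n d k := by
        rw [timeBound]
        refine Nat.mul_le_mul (Nat.mul_le_mul ?_ (Nat.pow_le_pow_right hM1 ?_))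
          (Nat.pow_le_pow_right (by omega) ?_)
        · omega
        · exact Nat.mul_le_mul_right _ (by omega)
        · omega

/-! ### The two versions of the problem -/

/-- The algorithm for the optimization problem. -/
def solver : Prog := .seq prepare optimise

/-- The algorithm for the decision problem. If the colouring has more than `2 d + 1 + k` colours,
then `k` vertices do not suffice. -/
def decider : Prog :=
  .seq prepare <|
  .ite (.less (.plus (.plus (.plus (.reg R_d) (.reg R_d)) (.lit 1)) (.reg R_k)) (.reg R_q))
    (.setReg R_n (.lit 0))
    (.seq optimise (.setReg R_n (.less (.reg R_n) (.plus (.reg R_k) (.lit 1)))))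

theorem exists_isMinDeletionSet {n : ℕ} (G : SimpleGraph (Fin n)) (d : ℕ) :
    ∃ K, IsMinDeletionSet G d K := by
  have huniv : IsDeletionSet G d Finset.univ :=
    ⟨⟨fun _ _ => False⟩, ⟨fun u => absurd (Finset.mem_univ _) u.2, fun _ _ h => h.1⟩,
      fun u => absurd (Finset.mem_univ _) u.2⟩
  classical
  obtain ⟨K, hK, hmin⟩ := Finset.exists_min_image (Finset.univ.filter (IsDeletionSet G d))
    Finset.card ⟨Finset.univ, by simpa using huniv⟩
  exact ⟨K, by simpa using hK, fun K' hK' => hmin K' (by simpa using hK')⟩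

/-- The loops are bounded in terms of the size of any deletion set, which the algorithm does not
know. -/
theorem solver_spec {n : ℕ} {G : SimpleGraph (Fin n)} (hG : IsChordal G) {d : ℕ}
    {K₀ : Finset (Fin n)} (hK₀ : IsDeletionSet G d K₀) :
    Ensures (rounds n d K₀.card) solver (inputState G d 0) fun s =>
      ∃ K, IsMinDeletionSet G d K ∧ s.reg R_n = K.card ∧
        ∀ v : Fin n, s.arr A_out v = if v ∈ K then 1 else 0 :=
  Ensures.seq <| (prepare_spec hG d 0 (by rw [rounds]; omega)).mono fun _ _ ⟨_, _, h⟩ =>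
    optimise_spec h (by rw [rounds]; omega) (base_le_rounds _ _ _)
      (states_le_rounds (h.colouring.q_le_of_isDeletionSet h.peo hK₀))

theorem decider_spec {n : ℕ} {G : SimpleGraph (Fin n)} (hG : IsChordal G) (d k : ℕ) :
    Ensures (rounds n d k) decider (inputState G d k) fun s =>
      ((∃ K, IsDeletionSet G d K ∧ K.card ≤ k) → s.reg R_n = 1) ∧
        ((¬ ∃ K, IsDeletionSet G d K ∧ K.card ≤ k) → s.reg R_n = 0) := by
  refine Ensures.seq ((prepare_spec hG d k (by rw [rounds]; omega)).mono
    fun s _ ⟨hk, pos, h⟩ => ?_)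
  have hd := h.reg_d
  refine Ensures.ite (fun hq => Ensures.setReg ?_) fun hq => Ensures.seq ?_
  · have hq' : d + d + 1 + k < s.reg R_q := by
      simpa [Expr.eval, hd, hk] using hq
    refine ⟨fun ⟨K, hK, hKk⟩ => ?_, fun _ => by simp⟩
    have := h.colouring.q_le_of_isDeletionSet h.peo hK
    omega
  · have hq' : s.reg R_q ≤ d + d + 1 + k := by
      simpa [Expr.eval, hd, hk] using hq
    refine (optimise_spec h (by rw [rounds]; omega) (base_le_rounds _ _ _)
      (states_le_rounds (k := k) (by omega))).mono fun s' hF ⟨K, hK, hcard, _⟩ =>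
        Ensures.setReg ?_
    have hk' : s'.reg R_k = k := (hF.reg _ rfl).trans hk
    have hval : (Expr.less (.reg R_n) (.plus (.reg R_k) (.lit 1))).eval s' =
        if K.card < k + 1 then 1 else 0 := by
      simp [Expr.eval, hcard, hk']
    rw [hval]
    constructor
    · rintro ⟨K', hK', hK'k⟩
      have := hK.2 K' hK'
      have hlt : K.card < k + 1 := by omega
      simp [hlt]
    · intro hno
      have hlt : ¬ K.card < k + 1 := fun hlt => hno ⟨K, hK.1, by omega⟩
      simp [hlt]

theorem exists_solvesOnChordal : ∃ c, SolvesOnChordal solver (timeBound c) := by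
  obtain ⟨c, hc⟩ := exists_timeBound solver
  refine ⟨c, fun n G hG d => ?_⟩
  obtain ⟨K₀, hK₀⟩ := exists_isMinDeletionSet G d
  obtain ⟨t, s, hrun, ht, K, hK, hcard, hout⟩ := solver_spec hG hK₀.1
  have he : K₀.card = K.card := le_antisymm (hK₀.2 K hK.1) (hK.2 K₀ hK₀.1)
  exact ⟨t, s, K, hrun, hK, he ▸ ht.trans (hc _ _ _), hcard, hout⟩

theorem exists_decidesOnChordal : ∃ c, DecidesOnChordal decider (timeBound c) := by
  obtain ⟨c, hc⟩ := exists_timeBound decider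
  refine ⟨c, fun n G hG d k => ?_⟩
  obtain ⟨t, s, hrun, ht, h⟩ := decider_spec hG d k
  exact ⟨t, s, hrun, ht.trans (hc _ _ _), h⟩

theorem computable_parameter_bound (c : ℕ) : Computable fun m => c * (max m 2) ^ (c * m) := by
  have hpow : Primrec₂ ((· ^ ·) : ℕ → ℕ → ℕ) := Primrec₂.unpaired'.1 Nat.Primrec.pow
  exact (Primrec.nat_mul.comp (Primrec.const c)
    (hpow.comp (Primrec.nat_max.comp Primrec.id (Primrec.const 2))
      (Primrec.nat_mul.comp (Primrec.const c) Primrec.id))).to_comp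

theorem isFPTOnChordal : IsFPTOnChordal := by
  obtain ⟨c, hc⟩ := exists_decidesOnChordal
  refine ⟨decider, _, c, computable_parameter_bound c, fun n G hG d k => ?_⟩
  obtain ⟨t, s, hrun, ht, h⟩ := hc n G hG d k
  refine ⟨t, s, hrun, ht.trans ?_, h⟩
  rw [timeBound]
  exact Nat.mul_le_mul_right _ (Nat.mul_le_mul_left _
    (Nat.pow_le_pow_left (max_le_max_right 2 (Nat.le_add_right d k)) _))

end OrientableDeletion

theorem mainTheorem9 :
    (∃ (P : OrientableDeletion.Prog) (c : ℕ),
      OrientableDeletion.SolvesOnChordal P (OrientableDeletion.timeBound c)) ∧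
    (∃ (P : OrientableDeletion.Prog) (c : ℕ),
      OrientableDeletion.DecidesOnChordal P (OrientableDeletion.timeBound c)) ∧
    OrientableDeletion.IsFPTOnChordal :=
  ⟨⟨_, OrientableDeletion.exists_solvesOnChordal⟩, ⟨_, OrientableDeletion.exists_decidesOnChordal⟩,
    OrientableDeletion.isFPTOnChordal⟩
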